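/- Let $0<T<\infty$ and let $\alpha,\beta,\delta$ be either $(\alpha,\beta,\delta)=(1,1,0)$ (problem (CB)) or $(\alpha,\beta,\delta)=(\tfrac12,\tfrac32,\tfrac12)$ (problem (SCB)). Consider, for $(x,t)\in[0,1]\times[0,T]$, the initial-boundary-value problem $$\eta_t+u_x+\alpha(\eta u)_x=0,\qquad u_t+\eta_x+\beta uu_x+\delta\eta\eta_x-\tfrac13u_{xxt}=0,$$ $$\eta(x,0)=\eta_0(x),\quad u(x,0)=u_0(x),\qquad u(0,t)=u(1,t)=0 .$$ Let $C^k=C^k[0,1]$ and $C^k_0=\{\phi\in C^k:\phi(0)=\phi(1)=0\}$, let $C(0,T;X)$ be the space of continuous maps $[0,T]\to X$, let $(\cdot,\cdot)$ and $\|\cdot\|$ be the inner product and norm of $L^2(0,1)$, and put $a(\psi,\chi)=(\psi,\chi)+\tfrac13(\psi',\chi')$ and $\|v\|_1=(\|v\|^2+\tfrac13\|v'\|^2)^{1/2}$. For an integer $N\ge2$ let $h=1/N$, let $S_h$ be the space of continuous functions on $[0,1]$ that are polynomials of degree at most $1$ on each interval $[ih,(i+1)h]$, $0\le i<N$, let $S_{h,0}=\{\phi\in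 S_h:\phi(0)=\phi(1)=0\}$, and let $I_h$, $I_{h,0}$ denote interpolation at the points $ih$, $0\le i\le N$, into $S_h$ and $S_{h,0}$, respectively. The semidiscrete problem is to find $\eta_h:[0,T]\to S_h$ and $u_h:[0,T]\to S_{h,0}$, differentiable in $t$, such that for all $t\in[0,T]$ $$(\eta_{ht},\phi)+(u_{hx},\phi)+\alpha((\eta_hu_h)_x,\phi)=0\quad\forall\phi\in S_h,$$ $$a(u_{ht},\chi)+(\eta_{hx},\chi)+\beta(u_hu_{hx},\chi)+\delta(\eta_h\eta_{hx},\chi)=0\quad\forall\chi\in S_{h,0},$$ $$\eta_h(0)=I_h\eta_0,\qquad u_h(0)=I_{h,0}u_0 .$$ **Theorem 2.1.** In each of the two cases (CB) and (SCB), suppose that $(\eta,u)$ is a solution of the initial-boundary-value problem on $[0,T]$ with $\eta\in C(0,T;C^3)$, $\eta_t\in C(0,T;C^2)$ and $u,u_t\in C(0,T;C^3_0)$. Then there are constants $C$ and $h_0>0$, independent of $h$, such that for every $h=1/N\le h_0$, $N\ge2$, the semidiscrete problem has a unique solution $(\eta_h,u_h)$ for $0\le t\le T$, and $$\text{(i)}\quad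 \max_{0\le t\le T}\|\eta(t)-\eta_h(t)\|\le Ch^{3/2},\qquad \max_{0\le t\le T}\|u(t)-u_h(t)\|_1\le Ch,$$ $$\text{(ii)}\quad \max_{0\le t\le T}\|u(t)-u_h(t)\|\le Ch^2,\qquad \max_{0\le t\le T}\|u_t(t)-u_{ht}(t)\|\le Ch^2 .$$ -/

import Mathlib

open Set Filter Topology

noncomputable section

namespace BoussinesqGalerkin

/-- The spatial interval `[0,1]`. -/
abbrev I01 : Set ℝ := Icc 0 1

/-- Spatial derivative of a function on `[0,1]` (one-sided at the end points).  Functions on `[0,1]`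
are represented by functions `ℝ → ℝ`; only the values on `[0,1]` are ever used. -/
def dx (f : ℝ → ℝ) (x : ℝ) : ℝ := derivWithin f I01 x

/-- The `L²(0,1)` inner product. -/
def ip (f g : ℝ → ℝ) : ℝ := ∫ x in (0 : ℝ)..1, f x * g x

/-- The `L²(0,1)` norm. -/
def normL2 (f : ℝ → ℝ) : ℝ := √(ip f f)

/-- The norm `‖v‖₁ = (‖v‖² + ⅓ ‖v'‖²)^(1/2)` on `H¹(0,1)`; it is applied only to continuous, piecewise
smooth functions, whose weak derivative is the classical derivative off the break points. -/
def normH1 (f : ℝ → ℝ) : ℝ := √(normL2 f ^ 2 + 1 / 3 * normL2 (dx f) ^ 2)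

/-- The bilinear form `a(ψ,χ) = (ψ,χ) + ⅓ (ψ',χ')`. -/
def bilin (ψ χ : ℝ → ℝ) : ℝ := ip ψ χ + 1 / 3 * ip (dx ψ) (dx χ)

/-- The norm of `C^k[0,1]`: the sum of the maximum norms of the derivatives up to order `k`. -/
def normCk (k : ℕ) (f : ℝ → ℝ) : ℝ :=
  ∑ j ∈ Finset.range (k + 1), ⨆ x : I01, |iteratedDerivWithin j f I01 x|

/-- `f ∈ C(0,T; C^k[0,1])`; here `f t x` is the value at time `t` and position `x`. -/
def InCTCk (T : ℝ) (k : ℕ) (f : ℝ → ℝ → ℝ) : Prop :=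
  (∀ t ∈ Icc 0 T, ContDiffOn ℝ k (f t) I01) ∧
  ∀ t₀ ∈ Icc 0 T, Tendsto (fun t => normCk k (f t - f t₀)) (𝓝[Icc 0 T] t₀) (𝓝 0)

/-- `f ∈ C(0,T; C^k_0[0,1])`, where `C^k_0` is the subspace of `C^k[0,1]` of functions vanishing at
`0` and `1`. -/
def InCTCk0 (T : ℝ) (k : ℕ) (f : ℝ → ℝ → ℝ) : Prop :=
  InCTCk T k f ∧ ∀ t ∈ Icc 0 T, f t 0 = 0 ∧ f t 1 = 0

/-- `ft` is the time derivative of `f` on `[0,T] × [0,1]` (one-sided at `t = 0` and `t = T`). -/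
def HasTimeDeriv (T : ℝ) (f ft : ℝ → ℝ → ℝ) : Prop :=
  ∀ t ∈ Icc 0 T, ∀ x ∈ I01, HasDerivWithinAt (fun s => f s x) (ft t x) (Icc 0 T) t

/-- `(η,u)`, with time derivatives `ηt`, `ut`, solves on `[0,1] × [0,T]`, pointwise, the
initial-boundary-value problem with parameters `α`, `β`, `δ`

`η_t + u_x + α (η u)_x = 0`,
`u_t + η_x + β u u_x + δ η η_x - ⅓ u_xxt = 0`,
`η(x,0) = η₀(x)`, `u(x,0) = u₀(x)`, `u(0,t) = u(1,t) = 0`. -/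
structure IsIBVPSolution (α β δ T : ℝ) (η₀ u₀ : ℝ → ℝ) (η ηt u ut : ℝ → ℝ → ℝ) : Prop where
  timeDeriv_η : HasTimeDeriv T η ηt
  timeDeriv_u : HasTimeDeriv T u ut
  mass : ∀ t ∈ Icc 0 T, ∀ x ∈ I01,
    ηt t x + dx (u t) x + α * dx (fun y => η t y * u t y) x = 0
  momentum : ∀ t ∈ Icc 0 T, ∀ x ∈ I01,
    ut t x + dx (η t) x + β * (u t x * dx (u t) x) + δ * (η t x * dx (η t) x)
      - 1 / 3 * iteratedDerivWithin 2 (ut t) I01 x = 0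
  initial_η : ∀ x ∈ I01, η 0 x = η₀ x
  initial_u : ∀ x ∈ I01, u 0 x = u₀ x
  boundary : ∀ t ∈ Icc 0 T, u t 0 = 0 ∧ u t 1 = 0

/-- The regularity `η ∈ C(0,T;C³)`, `η_t ∈ C(0,T;C²)`, `u, u_t ∈ C(0,T;C³_0)`. -/
structure IsSmooth (T : ℝ) (η ηt u ut : ℝ → ℝ → ℝ) : Prop where
  η_mem : InCTCk T 3 η
  ηt_mem : InCTCk T 2 ηt
  u_mem : InCTCk0 T 3 u
  ut_mem : InCTCk0 T 3 ut

/-- The node `i h`, `h = 1/N`, `0 ≤ i ≤ N`, of the uniform mesh. -/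
def node (N i : ℕ) : ℝ := (i : ℝ) / N

/-- `φ ∈ S_h`: continuous on `[0,1]` and a polynomial of degree at most one on each mesh interval. -/
def InSh (N : ℕ) (φ : ℝ → ℝ) : Prop :=
  ContinuousOn φ I01 ∧
  ∀ i < N, ∃ a b : ℝ, ∀ x ∈ Icc (node N i) (node N (i + 1)), φ x = a * x + b

/-- `φ ∈ S_{h,0}`: `φ ∈ S_h` and `φ(0) = φ(1) = 0`. -/
def InSh0 (N : ℕ) (φ : ℝ → ℝ) : Prop := InSh N φ ∧ φ 0 = 0 ∧ φ 1 = 0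

/-- `φ` is the interpolant of `f` in `S_h`. -/
def IsInterpolant (N : ℕ) (f φ : ℝ → ℝ) : Prop :=
  InSh N φ ∧ ∀ i ≤ N, φ (node N i) = f (node N i)

/-- `φ` is the interpolant in `S_{h,0}` of a function `f` that vanishes at `0` and `1`. -/
def IsInterpolant0 (N : ℕ) (f φ : ℝ → ℝ) : Prop :=
  InSh0 N φ ∧ ∀ i ≤ N, φ (node N i) = f (node N i)

/-- `ηh : [0,T] → S_h`, `uh : [0,T] → S_{h,0}`, with time derivatives `ηht`, `uht`, solve the standard
Galerkin semidiscretization, with initial values the interpolants of `η₀`, `u₀`, of the problem with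
parameters `α`, `β`, `δ`. -/
structure IsGalerkinSolution (α β δ T : ℝ) (N : ℕ) (η₀ u₀ : ℝ → ℝ)
    (ηh ηht uh uht : ℝ → ℝ → ℝ) : Prop where
  mem_η : ∀ t ∈ Icc 0 T, InSh N (ηh t)
  mem_u : ∀ t ∈ Icc 0 T, InSh0 N (uh t)
  timeDeriv_η : HasTimeDeriv T ηh ηht
  timeDeriv_u : HasTimeDeriv T uh uht
  mass : ∀ t ∈ Icc 0 T, ∀ φ, InSh N φ →
    ip (ηht t) φ + ip (dx (uh t)) φ + α * ip (dx (fun x => ηh t x * uh t x)) φ = 0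
  momentum : ∀ t ∈ Icc 0 T, ∀ χ, InSh0 N χ →
    bilin (uht t) χ + ip (dx (ηh t)) χ + β * ip (fun x => uh t x * dx (uh t) x) χ
      + δ * ip (fun x => ηh t x * dx (ηh t) x) χ = 0
  initial_η : IsInterpolant N η₀ (ηh 0)
  initial_u : IsInterpolant0 N u₀ (uh 0)

/-- The semidiscrete problem has a unique solution on `[0,T]` (solutions being identified when they
agree on `[0,T] × [0,1]`), and this solution satisfies the four error bounds, with constant `C` and
`h = 1/N`. -/
def UniqueSolutionWithErrorBounds (α β δ T : ℝ) (η₀ u₀ : ℝ → ℝ) (η u ut : ℝ → ℝ → ℝ)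
    (C : ℝ) (N : ℕ) : Prop :=
  ∃ ηh ηht uh uht : ℝ → ℝ → ℝ,
    IsGalerkinSolution α β δ T N η₀ u₀ ηh ηht uh uht ∧
    (∀ ηh' ηht' uh' uht' : ℝ → ℝ → ℝ,
      IsGalerkinSolution α β δ T N η₀ u₀ ηh' ηht' uh' uht' →
        ∀ t ∈ Icc 0 T, EqOn (ηh' t) (ηh t) I01 ∧ EqOn (uh' t) (uh t) I01) ∧
    ∀ t ∈ Icc 0 T,
      normL2 (η t - ηh t) ≤ C * (1 / (N : ℝ)) ^ (3 / 2 : ℝ) ∧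
      normH1 (u t - uh t) ≤ C * (1 / (N : ℝ)) ∧
      normL2 (u t - uh t) ≤ C * (1 / (N : ℝ)) ^ 2 ∧
      normL2 (ut t - uht t) ≤ C * (1 / (N : ℝ)) ^ 2

/-- The problem (CB): `η_t + u_x + (ηu)_x = 0`, `u_t + η_x + u u_x - ⅓ u_xxt = 0`. -/
abbrev IsCBSolution := IsIBVPSolution 1 1 0

/-- The problem (SCB): `η_t + u_x + ½ (ηu)_x = 0`,
`u_t + η_x + (3/2) u u_x + ½ η η_x - ⅓ u_xxt = 0`. -/
abbrev IsSCBSolution := IsIBVPSolution (1 / 2) (3 / 2) (1 / 2)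

/-- Unique solvability and error bounds for the Galerkin semidiscretization of (CB). -/
abbrev CBUniqueSolutionWithErrorBounds := UniqueSolutionWithErrorBounds 1 1 0

/-- Unique solvability and error bounds for the Galerkin semidiscretization of (SCB). -/
abbrev SCBUniqueSolutionWithErrorBounds :=
  UniqueSolutionWithErrorBounds (1 / 2) (3 / 2) (1 / 2)

end BoussinesqGalerkin

end

open Set Filter Topology

noncomputable section

namespace BoussinesqGalerkin

open MeasureTheory
open scoped NNReal ENNReal

/-! Put h = 1/N and split the errors at the interpolants: η − η_h = θ + ρ and u − u_h = ξ + σ, with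
θ, ξ piecewise linear (`pl N a`, `pl N b`), zero at t = 0, and ρ, σ interpolation errors, O(h²) in
L². In conservation form all fluxes are paired with derivatives of test functions. Since (σ_t', χ')
= 0 for piecewise linear χ (`ip_dx_sub_interp_dx_pl`), interpolation serves as an elliptic
projection up to an L² term.

First level. The mass equation gives no control of θ', so the fluxes of ρ and σ, paired with θ',
would cost a factor 1/h by the inverse inequality. Superconvergence (`ip_mul_interp_error_dx_pl_le`)
repairs this: cell integrals of g(w − I_h w) are O(h³) and change by O(h⁴) from one cell to the
next, so summation by parts leaves O(h²)‖θ‖ from the interior and O(h^{3/2})‖θ‖ from the two end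
cells. As long as E = ‖θ‖² + ‖ξ‖₁² ≤ h², the nonlinear terms are harmless and E' ≤ C(E + h³)
(`energy_deriv_le`). Gronwall gives E ≤ K h³, which is below h² for small h, so the assumption never
fails. The same bound keeps the solution of the ordinary differential system in a bounded set, hence
global existence (`exists_integralCurve_of_apriori`).

Second level. This energy gives only O(h^{3/2}) for ξ. Order h² comes from weaker norms: with the
primitive Θ of θ, Θ(0) = 0, the quantity ‖Θ‖² + Θ(1)² + ‖ξ‖² satisfies a Gronwall inequality with
source O(h⁴). Testing the mass equation with the interpolant of G, G' = −Θ, G(1) = 0, controls ‖Θ‖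
(`negative_norm_deriv_le`); testing with 1 controls Θ(1); and ‖ξ_t‖ is bounded by duality with the
problem −B'' = ξ_t, where θ enters only through Θ, Θ(1) and h‖θ‖ (`ErrorEquations.norm_bt_le`). The
bound for ξ_t then yields the estimate of u_t as well. -/

/-- Lebesgue measure on `[0,1]`. -/
abbrev vol01 : Measure ℝ := volume.restrict I01

/-- Essentially bounded functions on `[0,1]`. -/
@[fun_prop]
def Bdd (f : ℝ → ℝ) : Prop := MemLp f ∞ vol01

/-- Lipschitz functions on `[0,1]`. -/
@[fun_prop]
def Lip01 (f : ℝ → ℝ) : Prop := ∃ K : ℝ≥0, LipschitzOnWith K f I01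

/-! ### Bounded and Lipschitz functions on [0,1] and their almost everywhere derivatives -/

@[fun_prop]
theorem Bdd.const (c : ℝ) : Bdd (fun _ => c) := memLp_top_const c

@[fun_prop]
theorem Bdd.add {f g : ℝ → ℝ} (hf : Bdd f) (hg : Bdd g) : Bdd (fun x => f x + g x) :=
  MemLp.add hf hg

@[fun_prop]
theorem Bdd.sub {f g : ℝ → ℝ} (hf : Bdd f) (hg : Bdd g) : Bdd (fun x => f x - g x) :=
  MemLp.sub hf hg

@[fun_prop]
theorem Bdd.neg {f : ℝ → ℝ} (hf : Bdd f) : Bdd (fun x => - f x) :=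
  MemLp.neg hf

@[fun_prop]
theorem Bdd.mul {f g : ℝ → ℝ} (hf : Bdd f) (hg : Bdd g) : Bdd (fun x => f x * g x) :=
  MemLp.mul (p := ∞) (q := ∞) hg hf

@[fun_prop]
theorem Bdd.pow {f : ℝ → ℝ} (hf : Bdd f) (n : ℕ) : Bdd (fun x => f x ^ n) := by
  induction n with
  | zero => simpa using Bdd.const 1
  | succ n ih => simpa [pow_succ] using ih.mul hf

theorem Bdd.sum {ι : Type*} (s : Finset ι) {f : ι → ℝ → ℝ} (hf : ∀ i ∈ s, Bdd (f i)) :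
    Bdd (fun x => ∑ i ∈ s, f i x) := memLp_finsetSum s hf

@[fun_prop]
theorem Lip01.const (c : ℝ) : Lip01 (fun _ => c) := ⟨0, (LipschitzWith.const c).lipschitzOnWith⟩

@[fun_prop]
theorem Lip01.add {f g : ℝ → ℝ} (hf : Lip01 f) (hg : Lip01 g) : Lip01 (fun x => f x + g x) := by
  obtain ⟨K, hK⟩ := hf
  obtain ⟨L, hL⟩ := hg
  exact ⟨K + L, hK.add hL⟩

@[fun_prop]
theorem Lip01.neg {f : ℝ → ℝ} (hf : Lip01 f) : Lip01 (fun x => - f x) := by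
  obtain ⟨K, hK⟩ := hf
  exact ⟨K, hK.neg⟩

@[fun_prop]
theorem Lip01.sub {f g : ℝ → ℝ} (hf : Lip01 f) (hg : Lip01 g) : Lip01 (fun x => f x - g x) := by
  simpa [sub_eq_add_neg] using hf.add hg.neg

theorem Lip01.continuousOn {f : ℝ → ℝ} (hf : Lip01 f) : ContinuousOn f I01 := by
  obtain ⟨K, hK⟩ := hf
  exact hK.continuousOn

theorem Lip01.exists_bound {f : ℝ → ℝ} (hf : Lip01 f) : ∃ C, 0 ≤ C ∧ ∀ x ∈ I01, |f x| ≤ C := by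
  obtain ⟨C, hC⟩ := isCompact_Icc.exists_bound_of_continuousOn hf.continuousOn
  exact ⟨C, (abs_nonneg _).trans (hC 0 (by simp)), hC⟩

@[fun_prop]
theorem Lip01.mul {f g : ℝ → ℝ} (hf : Lip01 f) (hg : Lip01 g) : Lip01 (fun x => f x * g x) := by
  obtain ⟨C, hC0, hC⟩ := hf.exists_bound
  obtain ⟨D, hD0, hD⟩ := hg.exists_bound
  obtain ⟨K, hK⟩ := hf
  obtain ⟨L, hL⟩ := hg
  refine ⟨Real.toNNReal (C * L + K * D), LipschitzOnWith.of_dist_le_mul fun x hx y hy => ?_⟩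
  have h1 := hK.dist_le_mul x hx y hy
  have h2 := hL.dist_le_mul x hx y hy
  rw [Real.dist_eq] at h1 h2 ⊢
  rw [Real.coe_toNNReal _ (by positivity)]
  have e : f x * g x - f y * g y = f x * (g x - g y) + (f x - f y) * g y := by ring
  rw [e]
  calc _ ≤ |f x| * |g x - g y| + |f x - f y| * |g y| := by
        rw [← abs_mul, ← abs_mul]; exact abs_add_le _ _
    _ ≤ C * (L * dist x y) + (K * dist x y) * D := by
        gcongr
        · exact hC x hx
        · exact hD y hy
    _ = _ := by ring

theorem Lip01.sum {ι : Type*} (s : Finset ι) {f : ι → ℝ → ℝ} (hf : ∀ i ∈ s, Lip01 (f i)) :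
    Lip01 (fun x => ∑ i ∈ s, f i x) := by
  classical
  induction s using Finset.induction_on with
  | empty => simpa using Lip01.const 0
  | insert a s ha ih =>
    simp only [Finset.sum_insert ha]
    exact (hf a (by simp)).add (ih fun i hi => hf i (by simp [hi]))

theorem bdd_of_continuousOn {f : ℝ → ℝ} (hf : ContinuousOn f I01) : Bdd f := by
  obtain ⟨C, hC⟩ := isCompact_Icc.exists_bound_of_continuousOn hf
  exact memLp_top_of_bound (hf.aestronglyMeasurable measurableSet_Icc) C
    ((ae_restrict_iff' measurableSet_Icc).2 (Eventually.of_forall hC))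

@[fun_prop]
theorem Lip01.bdd {f : ℝ → ℝ} (hf : Lip01 f) : Bdd f := bdd_of_continuousOn hf.continuousOn

theorem Lip01.acOn {f : ℝ → ℝ} (hf : Lip01 f) : AbsolutelyContinuousOnInterval f 0 1 := by
  obtain ⟨K, hK⟩ := hf
  exact LipschitzOnWith.absolutelyContinuousOnInterval (by rwa [uIcc_of_le zero_le_one])

theorem ae_mem_Ioo : ∀ᵐ x ∂vol01, x ∈ Ioo (0 : ℝ) 1 := by
  have : vol01 = volume.restrict (Ioo 0 1) := Measure.restrict_congr_set Ioo_ae_eq_Icc.symm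
  rw [this]
  exact ae_restrict_mem measurableSet_Ioo

theorem dx_eq_deriv {f : ℝ → ℝ} {x : ℝ} (hx : x ∈ Ioo (0 : ℝ) 1) : dx f x = deriv f x :=
  derivWithin_of_mem_nhds (Icc_mem_nhds hx.1 hx.2)

/-- Lipschitz functions are absolutely continuous, hence differentiable almost everywhere; inside
the interval the one-sided convention in `dx` is immaterial. -/
theorem Lip01.ae_hasDerivAt {f : ℝ → ℝ} (hf : Lip01 f) :
    ∀ᵐ x ∂vol01, HasDerivAt f (dx f x) x := by
  have h := hf.acOn.ae_differentiableAt
  rw [uIcc_of_le zero_le_one] at h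
  have h' := (ae_restrict_iff' (μ := volume) (s := I01) measurableSet_Icc).2 h
  filter_upwards [h', ae_mem_Ioo] with x hx hx'
  rw [dx_eq_deriv hx']
  exact hx.hasDerivAt

@[fun_prop]
theorem Lip01.bdd_dx {f : ℝ → ℝ} (hf : Lip01 f) : Bdd (dx f) := by
  obtain ⟨K, hK⟩ := hf
  refine memLp_top_of_bound ?_ K ?_
  · refine (measurable_deriv f).aestronglyMeasurable.congr ?_
    filter_upwards [ae_mem_Ioo] with x hx
    exact (dx_eq_deriv hx).symm
  · filter_upwards [ae_mem_Ioo] with x hx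
    rw [dx_eq_deriv hx]
    exact norm_deriv_le_of_lipschitzOn (Icc_mem_nhds hx.1 hx.2) hK

theorem dx_ae_of_hasDerivAt {f f' : ℝ → ℝ} (h : ∀ᵐ x ∂vol01, HasDerivAt f (f' x) x) :
    dx f =ᵐ[vol01] f' := by
  filter_upwards [h, ae_mem_Ioo] with x hx hx'
  rw [dx_eq_deriv hx', hx.deriv]

theorem dx_add_ae {f g : ℝ → ℝ} (hf : Lip01 f) (hg : Lip01 g) :
    dx (fun x => f x + g x) =ᵐ[vol01] fun x => dx f x + dx g x := by
  apply dx_ae_of_hasDerivAt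
  filter_upwards [hf.ae_hasDerivAt, hg.ae_hasDerivAt] with x h1 h2 using h1.add h2

theorem dx_sub_ae {f g : ℝ → ℝ} (hf : Lip01 f) (hg : Lip01 g) :
    dx (fun x => f x - g x) =ᵐ[vol01] fun x => dx f x - dx g x := by
  apply dx_ae_of_hasDerivAt
  filter_upwards [hf.ae_hasDerivAt, hg.ae_hasDerivAt] with x h1 h2 using h1.sub h2

theorem dx_mul_ae {f g : ℝ → ℝ} (hf : Lip01 f) (hg : Lip01 g) :
    dx (fun x => f x * g x) =ᵐ[vol01] fun x => dx f x * g x + f x * dx g x := by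
  apply dx_ae_of_hasDerivAt
  filter_upwards [hf.ae_hasDerivAt, hg.ae_hasDerivAt] with x h1 h2 using h1.mul h2

theorem dx_const_mul_ae {f : ℝ → ℝ} (c : ℝ) (hf : Lip01 f) :
    dx (fun x => c * f x) =ᵐ[vol01] fun x => c * dx f x := by
  apply dx_ae_of_hasDerivAt
  filter_upwards [hf.ae_hasDerivAt] with x h1 using h1.const_mul c

theorem dx_sum_ae {ι : Type*} (s : Finset ι) {f : ι → ℝ → ℝ} (hf : ∀ i ∈ s, Lip01 (f i)) :
    dx (fun x => ∑ i ∈ s, f i x) =ᵐ[vol01] fun x => ∑ i ∈ s, dx (f i) x := by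
  apply dx_ae_of_hasDerivAt
  have : ∀ᵐ x ∂vol01, ∀ i ∈ s, HasDerivAt (f i) (dx (f i) x) x :=
    (Finset.eventually_all s).2 fun i hi => (hf i hi).ae_hasDerivAt
  filter_upwards [this] with x hx using HasDerivAt.fun_sum hx

theorem dx_congr {f g : ℝ → ℝ} (h : EqOn f g I01) : EqOn (dx f) (dx g) I01 := fun _ hx =>
  derivWithin_congr h (h hx)

theorem Bdd.intervalIntegrable {f : ℝ → ℝ} (hf : Bdd f) {a b : ℝ} (ha : a ∈ I01) (hb : b ∈ I01) :
    IntervalIntegrable f volume a b := by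
  have h : IntegrableOn f I01 := MemLp.integrable (q := ∞) le_top hf
  rw [intervalIntegrable_iff]
  exact h.mono_set ((uIoc_subset_uIcc).trans ((convex_Icc _ _).ordConnected.uIcc_subset ha hb))

theorem zero_mem_I01 : (0 : ℝ) ∈ I01 := by simp
theorem one_mem_I01 : (1 : ℝ) ∈ I01 := by simp

theorem Bdd.intervalIntegrable' {f : ℝ → ℝ} (hf : Bdd f) : IntervalIntegrable f volume 0 1 :=
  hf.intervalIntegrable zero_mem_I01 one_mem_I01

theorem integral_congr_ae01 {f g : ℝ → ℝ} (h : f =ᵐ[vol01] g) {a b : ℝ} (ha : a ∈ I01)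
    (hb : b ∈ I01) : ∫ x in a..b, f x = ∫ x in a..b, g x := by
  apply intervalIntegral.integral_congr_ae
  have h' := (ae_restrict_iff' (μ := volume) (s := I01) measurableSet_Icc).1 h
  filter_upwards [h'] with x hx hx'
  exact hx ((convex_Icc _ _).ordConnected.uIcc_subset ha hb (uIoc_subset_uIcc hx'))

theorem integral_dx {f : ℝ → ℝ} (hf : Lip01 f) {a b : ℝ} (ha : a ∈ I01) (hb : b ∈ I01) :
    ∫ x in a..b, dx f x = f b - f a := by
  have hs : uIcc a b ⊆ I01 := (convex_Icc _ _).ordConnected.uIcc_subset ha hb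
  have hac : AbsolutelyContinuousOnInterval f a b :=
    hf.acOn.mono (by rwa [uIcc_of_le zero_le_one])
  rw [← hac.integral_deriv_eq_sub]
  refine integral_congr_ae01 ?_ ha hb
  filter_upwards [ae_mem_Ioo] with x hx using dx_eq_deriv hx

theorem ae_of_eqOn {f g : ℝ → ℝ} (h : EqOn f g I01) : f =ᵐ[vol01] g :=
  (ae_restrict_iff' measurableSet_Icc).2 (Eventually.of_forall h)

/-! ### The L² inner product and norm -/

theorem ip_congr_ae {f g f' g' : ℝ → ℝ} (hf : f =ᵐ[vol01] f') (hg : g =ᵐ[vol01] g') :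
    ip f g = ip f' g' := by
  refine integral_congr_ae01 ?_ zero_mem_I01 one_mem_I01
  filter_upwards [hf, hg] with x h1 h2
  rw [h1, h2]

theorem ip_comm (f g : ℝ → ℝ) : ip f g = ip g f := by simp [ip, mul_comm]

theorem ip_add_left {f g k : ℝ → ℝ} (hf : Bdd f) (hg : Bdd g) (hk : Bdd k) :
    ip (fun x => f x + g x) k = ip f k + ip g k := by
  unfold ip
  rw [← intervalIntegral.integral_add (hf.mul hk).intervalIntegrable'
    (hg.mul hk).intervalIntegrable']
  simp [add_mul]

theorem ip_sub_left {f g k : ℝ → ℝ} (hf : Bdd f) (hg : Bdd g) (hk : Bdd k) :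
    ip (fun x => f x - g x) k = ip f k - ip g k := by
  unfold ip
  rw [← intervalIntegral.integral_sub (hf.mul hk).intervalIntegrable'
    (hg.mul hk).intervalIntegrable']
  simp [sub_mul]

theorem ip_add_right {f g k : ℝ → ℝ} (hf : Bdd f) (hg : Bdd g) (hk : Bdd k) :
    ip k (fun x => f x + g x) = ip k f + ip k g := by
  rw [ip_comm, ip_add_left hf hg hk, ip_comm f, ip_comm g]

theorem ip_sub_right {f g k : ℝ → ℝ} (hf : Bdd f) (hg : Bdd g) (hk : Bdd k) :
    ip k (fun x => f x - g x) = ip k f - ip k g := by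
  rw [ip_comm, ip_sub_left hf hg hk, ip_comm f, ip_comm g]

theorem ip_const_mul_left (c : ℝ) (f g : ℝ → ℝ) : ip (fun x => c * f x) g = c * ip f g := by
  unfold ip
  rw [← intervalIntegral.integral_const_mul]
  simp [mul_assoc]

theorem ip_const_mul_right (c : ℝ) (f g : ℝ → ℝ) : ip f (fun x => c * g x) = c * ip f g := by
  rw [ip_comm, ip_const_mul_left, ip_comm]

theorem ip_sum_left {ι : Type*} (s : Finset ι) {f : ι → ℝ → ℝ} {g : ℝ → ℝ}
    (hf : ∀ i ∈ s, Bdd (f i)) (hg : Bdd g) :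
    ip (fun x => ∑ i ∈ s, f i x) g = ∑ i ∈ s, ip (f i) g := by
  unfold ip
  rw [← intervalIntegral.integral_finsetSum fun i hi => ((hf i hi).mul hg).intervalIntegrable']
  simp [Finset.sum_mul]

theorem ip_sum_right {ι : Type*} (s : Finset ι) {f : ι → ℝ → ℝ} {g : ℝ → ℝ}
    (hf : ∀ i ∈ s, Bdd (f i)) (hg : Bdd g) :
    ip g (fun x => ∑ i ∈ s, f i x) = ∑ i ∈ s, ip g (f i) := by
  rw [ip_comm, ip_sum_left s hf hg]
  simp [ip_comm]

theorem ip_dx_left {f g : ℝ → ℝ} (hf : Lip01 f) (hg : Lip01 g) :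
    ip (dx f) g = f 1 * g 1 - f 0 * g 0 - ip f (dx g) := by
  have h := integral_dx (hf.mul hg) zero_mem_I01 one_mem_I01
  rw [integral_congr_ae01 (dx_mul_ae hf hg) zero_mem_I01 one_mem_I01,
    intervalIntegral.integral_add (hf.bdd_dx.mul hg.bdd).intervalIntegrable'
      (hf.bdd.mul hg.bdd_dx).intervalIntegrable'] at h
  unfold ip
  linarith

theorem ip_self_nonneg (f : ℝ → ℝ) : 0 ≤ ip f f :=
  intervalIntegral.integral_nonneg zero_le_one fun x _ => mul_self_nonneg (f x)

theorem normL2_sq (f : ℝ → ℝ) : normL2 f ^ 2 = ip f f := Real.sq_sqrt (ip_self_nonneg f)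

theorem normL2_nonneg (f : ℝ → ℝ) : 0 ≤ normL2 f := Real.sqrt_nonneg _

/-- Cauchy–Schwarz, from the nonpositive discriminant of s ↦ ∫ (s f + g)². -/
theorem integral_mul_sq_le {f g : ℝ → ℝ} (hf : Bdd f) (hg : Bdd g) {a b : ℝ} (ha : a ∈ I01)
    (hb : b ∈ I01) (hab : a ≤ b) :
    (∫ x in a..b, f x * g x) ^ 2 ≤ (∫ x in a..b, f x ^ 2) * ∫ x in a..b, g x ^ 2 := by
  have h : ∀ s : ℝ, 0 ≤ (∫ x in a..b, f x ^ 2) * (s * s) + (2 * ∫ x in a..b, f x * g x) * s +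
      ∫ x in a..b, g x ^ 2 := by
    intro s
    have : 0 ≤ ∫ x in a..b, (f x ^ 2 * (s * s) + 2 * (f x * g x) * s) + g x ^ 2 :=
      intervalIntegral.integral_nonneg hab fun x _ => by nlinarith [sq_nonneg (f x * s + g x)]
    rw [intervalIntegral.integral_add
      (Bdd.intervalIntegrable (by fun_prop) ha hb) (Bdd.intervalIntegrable (by fun_prop) ha hb),
      intervalIntegral.integral_add
      (Bdd.intervalIntegrable (by fun_prop) ha hb) (Bdd.intervalIntegrable (by fun_prop) ha hb),
      intervalIntegral.integral_mul_const, intervalIntegral.integral_mul_const,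
      intervalIntegral.integral_const_mul] at this
    exact this
  have := discrim_le_zero h
  unfold discrim at this
  nlinarith

theorem abs_ip_le {f g : ℝ → ℝ} (hf : Bdd f) (hg : Bdd g) :
    |ip f g| ≤ normL2 f * normL2 g := by
  apply abs_le_of_sq_le_sq _ (mul_nonneg (normL2_nonneg _) (normL2_nonneg _))
  rw [mul_pow, normL2_sq, normL2_sq]
  simpa only [ip, ← pow_two] using integral_mul_sq_le hf hg zero_mem_I01 one_mem_I01 zero_le_one

theorem normL2_add_le {f g : ℝ → ℝ} (hf : Bdd f) (hg : Bdd g) :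
    normL2 (fun x => f x + g x) ≤ normL2 f + normL2 g := by
  apply Real.sqrt_le_iff.2 ⟨add_nonneg (normL2_nonneg _) (normL2_nonneg _), ?_⟩
  rw [ip_add_left hf hg (by fun_prop), ip_add_right hf hg hf, ip_add_right hf hg hg, ip_comm g f,
    add_sq, normL2_sq, normL2_sq]
  linarith [le_abs_self (ip f g), abs_ip_le hf hg]

theorem normL2_const_mul (c : ℝ) (f : ℝ → ℝ) : normL2 (fun x => c * f x) = |c| * normL2 f := by
  unfold normL2
  rw [ip_const_mul_left, ip_const_mul_right, ← mul_assoc, ← pow_two, Real.sqrt_mul (sq_nonneg c),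
    Real.sqrt_sq_eq_abs]

theorem normL2_neg (f : ℝ → ℝ) : normL2 (fun x => - f x) = normL2 f := by
  simpa using normL2_const_mul (-1) f

theorem normL2_sub_le {f g : ℝ → ℝ} (hf : Bdd f) (hg : Bdd g) :
    normL2 (fun x => f x - g x) ≤ normL2 f + normL2 g := by
  have := normL2_add_le hf hg.neg
  rwa [normL2_neg] at this

theorem normL2_congr_ae {f g : ℝ → ℝ} (h : f =ᵐ[vol01] g) : normL2 f = normL2 g := by
  unfold normL2
  rw [ip_congr_ae h h]

theorem normL2_le_of_ae_abs_le {f g : ℝ → ℝ} (hf : Bdd f) (hg : Bdd g)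
    (h : ∀ᵐ x ∂vol01, |f x| ≤ |g x|) : normL2 f ≤ normL2 g := by
  apply Real.sqrt_le_sqrt
  apply intervalIntegral.integral_mono_ae_restrict zero_le_one (hf.mul hf).intervalIntegrable'
    (hg.mul hg).intervalIntegrable'
  filter_upwards [h] with x hx
  exact abs_le_iff_mul_self_le.1 hx

theorem normL2_mul_le {f g : ℝ → ℝ} {M : ℝ} (hf : Bdd f) (hg : Bdd g) (hM : 0 ≤ M)
    (h : ∀ x ∈ I01, |f x| ≤ M) : normL2 (fun x => f x * g x) ≤ M * normL2 g := by
  rw [← abs_of_nonneg hM, ← normL2_const_mul]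
  apply normL2_le_of_ae_abs_le (by fun_prop) (by fun_prop)
  filter_upwards [ae_restrict_mem measurableSet_Icc] with x hx
  rw [abs_mul, abs_mul, abs_of_nonneg hM]
  gcongr
  exact h x hx

theorem normL2_le_of_abs_le {f : ℝ → ℝ} {M : ℝ} (hf : Bdd f) (hM : 0 ≤ M)
    (h : ∀ x ∈ I01, |f x| ≤ M) : normL2 f ≤ M := by
  have h1 := normL2_mul_le hf (Bdd.const 1) hM h
  have h2 : normL2 (fun _ => (1 : ℝ)) = 1 := by simp [normL2, ip]
  simpa [h2] using h1

/-! ### Poincaré inequalities, integration by parts and primitives -/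

/-- Pointwise bound of a Lipschitz function with a zero in `[a,b]`. -/
theorem sq_le_of_zero {f : ℝ → ℝ} (hf : Lip01 f) {a b y : ℝ} (ha : a ∈ I01) (hb : b ∈ I01)
    (hy : y ∈ Icc a b) (h0 : f y = 0) {x : ℝ} (hx : x ∈ Icc a b) :
    f x ^ 2 ≤ (b - a) * ∫ t in a..b, dx f t ^ 2 := by
  have hab : a ≤ b := hy.1.trans hy.2
  -- The fundamental theorem of calculus and Cauchy–Schwarz against 1 bound every increment;
  -- afterwards one of the two points is the zero y.
  have key : ∀ p q : ℝ, p ∈ Icc a b → q ∈ Icc a b → p ≤ q →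
      (f q - f p) ^ 2 ≤ (b - a) * ∫ t in a..b, dx f t ^ 2 := by
    intro p q hp hq hpq
    have hp' : p ∈ I01 := ⟨ha.1.trans hp.1, hp.2.trans hb.2⟩
    have hq' : q ∈ I01 := ⟨ha.1.trans hq.1, hq.2.trans hb.2⟩
    have h1 := integral_mul_sq_le (Bdd.const 1) hf.bdd_dx hp' hq' hpq
    simp only [one_mul, one_pow, intervalIntegral.integral_const, smul_eq_mul, mul_one] at h1
    rw [integral_dx hf hp' hq'] at h1
    have h2 : ∫ t in p..q, dx f t ^ 2 ≤ ∫ t in a..b, dx f t ^ 2 :=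
      intervalIntegral.integral_mono_interval hp.1 hpq hq.2
        (Eventually.of_forall fun t => sq_nonneg _) ((hf.bdd_dx.pow 2).intervalIntegrable ha hb)
    have h3 : 0 ≤ ∫ t in p..q, dx f t ^ 2 :=
      intervalIntegral.integral_nonneg hpq fun t _ => sq_nonneg _
    refine h1.trans (mul_le_mul ?_ h2 h3 (by linarith))
    linarith [hp.1, hq.2]
  rcases le_total x y with h | h
  · have := key x y hx hy h
    rw [h0] at this
    simpa using this
  · have := key y x hy hx h
    rw [h0] at this
    simpa using this

/-- The Poincaré inequality on `[a,b]` for functions with a zero. -/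
theorem integral_sq_le_of_zero {f : ℝ → ℝ} (hf : Lip01 f) {a b y : ℝ} (ha : a ∈ I01) (hb : b ∈ I01)
    (hy : y ∈ Icc a b) (h0 : f y = 0) :
    ∫ t in a..b, f t ^ 2 ≤ (b - a) ^ 2 * ∫ t in a..b, dx f t ^ 2 := by
  have hab : a ≤ b := hy.1.trans hy.2
  calc ∫ t in a..b, f t ^ 2 ≤ ∫ _ in a..b, (b - a) * ∫ t in a..b, dx f t ^ 2 :=
        intervalIntegral.integral_mono_on hab ((hf.bdd.pow 2).intervalIntegrable ha hb)
          (by simp) fun x hx => sq_le_of_zero hf ha hb hy h0 hx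
    _ = _ := by rw [intervalIntegral.integral_const, smul_eq_mul]; ring

theorem ip_self_eq (f : ℝ → ℝ) : ip f f = ∫ x in (0 : ℝ)..1, f x ^ 2 := by simp [ip, pow_two]

theorem abs_le_normL2_dx {f : ℝ → ℝ} (hf : Lip01 f) {y : ℝ} (hy : y ∈ I01) (h0 : f y = 0) {x : ℝ}
    (hx : x ∈ I01) : |f x| ≤ normL2 (dx f) := by
  apply abs_le_of_sq_le_sq _ (normL2_nonneg _)
  have := sq_le_of_zero hf zero_mem_I01 one_mem_I01 hy h0 hx
  rwa [sub_zero, one_mul, ← ip_self_eq, ← normL2_sq] at this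

theorem normL2_le_normL2_dx {f : ℝ → ℝ} (hf : Lip01 f) {y : ℝ} (hy : y ∈ I01) (h0 : f y = 0) :
    normL2 f ≤ normL2 (dx f) :=
  normL2_le_of_abs_le hf.bdd (normL2_nonneg _) fun _ hx => abs_le_normL2_dx hf hy h0 hx

/-- `(v f, f') = -½ (v' f, f)` if `v` vanishes at the end points. -/
theorem ip_mul_dx_self {v f : ℝ → ℝ} (hv : Lip01 v) (hf : Lip01 f) (h0 : v 0 * f 0 = 0)
    (h1 : v 1 * f 1 = 0) :
    ip (fun x => v x * f x) (dx f) = -(1 / 2) * ip (fun x => dx v x * f x) f := by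
  have h := ip_dx_left (hv.mul hf) hf
  rw [ip_congr_ae (dx_mul_ae hv hf) (ae_eq_refl f), ip_add_left (hv.bdd_dx.mul hf.bdd)
    (hv.bdd.mul hf.bdd_dx) hf.bdd, h0, h1] at h
  have h2 : ip (fun x => v x * dx f x) f = ip (fun x => v x * f x) (dx f) := by
    simp only [ip]
    congr 1
    ext x
    ring
  rw [h2] at h
  linarith

theorem lip01_primitive {f : ℝ → ℝ} (hf : ContinuousOn f I01) :
    Lip01 (fun x => ∫ y in (0 : ℝ)..x, f y) := by
  obtain ⟨C, hC⟩ := isCompact_Icc.exists_bound_of_continuousOn hf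
  refine ⟨Real.toNNReal C, LipschitzOnWith.of_dist_le_mul fun x hx y hy => ?_⟩
  have hb := bdd_of_continuousOn hf
  rw [Real.dist_eq, intervalIntegral.integral_interval_sub_left
    (hb.intervalIntegrable zero_mem_I01 hx) (hb.intervalIntegrable zero_mem_I01 hy),
    Real.coe_toNNReal _ ((norm_nonneg _).trans (hC 0 zero_mem_I01)), Real.dist_eq]
  have h : ∀ z ∈ uIoc y x, ‖f z‖ ≤ C := fun z hz =>
    hC z ((convex_Icc _ _).ordConnected.uIcc_subset hy hx (uIoc_subset_uIcc hz))
  exact intervalIntegral.norm_integral_le_of_norm_le_const h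

theorem hasDerivAt_primitive {f : ℝ → ℝ} (hf : ContinuousOn f I01) {x : ℝ}
    (hx : x ∈ Ioo (0 : ℝ) 1) : HasDerivAt (fun x => ∫ y in (0 : ℝ)..x, f y) (f x) x := by
  have hn : I01 ∈ 𝓝 x := Icc_mem_nhds hx.1 hx.2
  exact intervalIntegral.integral_hasDerivAt_right
    ((bdd_of_continuousOn hf).intervalIntegrable zero_mem_I01 (Ioo_subset_Icc_self hx))
    (ContinuousAt.stronglyMeasurableAtFilter isOpen_Ioo
      (fun y hy => hf.continuousAt (Icc_mem_nhds hy.1 hy.2)) x hx) (hf.continuousAt hn)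

/-! ### Piecewise linear functions and inverse inequalities -/

/-- The hat function of the node `i / N`. -/
def hat (N i : ℕ) (x : ℝ) : ℝ := max 0 (1 - |N * x - i|)

/-- The continuous piecewise linear function with nodal values `c i`, `0 ≤ i ≤ N`. -/
def pl (N : ℕ) (c : ℕ → ℝ) (x : ℝ) : ℝ := ∑ i ∈ Finset.range (N + 1), c i * hat N i x

@[fun_prop]
theorem lip01_hat (N i : ℕ) : Lip01 (hat N i) := by
  have h : LipschitzWith N (fun x : ℝ => (N : ℝ) * x - i) := by
    apply LipschitzWith.of_dist_le_mul
    intro x y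
    rw [Real.dist_eq, Real.dist_eq, show (N : ℝ) * x - i - (N * y - i) = N * (x - y) by ring,
      abs_mul]
    simp
  have h2 : LipschitzWith N (fun x : ℝ => 1 - |(N : ℝ) * x - i|) := by
    apply LipschitzWith.of_dist_le_mul
    intro x y
    refine le_trans ?_ (h.dist_le_mul x y)
    rw [Real.dist_eq, Real.dist_eq, abs_sub_comm, sub_sub_sub_cancel_left]
    exact abs_abs_sub_abs_le_abs_sub _ _
  exact ⟨N, (h2.const_max 0).lipschitzOnWith⟩

@[fun_prop]
theorem lip01_pl (N : ℕ) (c : ℕ → ℝ) : Lip01 (pl N c) :=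
  Lip01.sum _ fun _ _ => by fun_prop

theorem hat_eq_zero {N i j : ℕ} {x : ℝ} (h1 : (i : ℝ) ≤ N * x) (h2 : N * x ≤ i + 1) (hj : j ≠ i)
    (hj' : j ≠ i + 1) : hat N j x = 0 := by
  apply max_eq_left
  rcases lt_or_gt_of_ne hj with h | h
  · have : (j : ℝ) + 1 ≤ i := by exact_mod_cast h
    linarith [le_abs_self (N * x - j)]
  · have : (i : ℝ) + 2 ≤ j := by exact_mod_cast (by omega : i + 2 ≤ j)
    linarith [neg_le_abs (N * x - j)]

section mesh

variable {N : ℕ}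

theorem mem_cell_iff (hN : 0 < N) {i : ℕ} {x : ℝ} :
    x ∈ Icc (node N i) (node N (i + 1)) ↔ (i : ℝ) ≤ N * x ∧ N * x ≤ i + 1 := by
  have : (0 : ℝ) < N := by exact_mod_cast hN
  rw [mem_Icc, node, node, div_le_iff₀' this, le_div_iff₀' this]
  push_cast
  rfl

theorem pl_eq (hN : 0 < N) (c : ℕ → ℝ) {i : ℕ} (hi : i < N) {x : ℝ}
    (hx : x ∈ Icc (node N i) (node N (i + 1))) :
    pl N c x = c i + (c (i + 1) - c i) * (N * x - i) := by
  obtain ⟨h1, h2⟩ := (mem_cell_iff hN).1 hx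
  have hs : ({i, i + 1} : Finset ℕ) ⊆ Finset.range (N + 1) := by
    intro j hj
    simp only [Finset.mem_insert, Finset.mem_singleton] at hj
    simp only [Finset.mem_range]
    omega
  rw [pl, ← Finset.sum_subset hs, Finset.sum_pair (by omega)]
  · have e1 : hat N i x = 1 - (N * x - i) := by
      rw [hat, abs_of_nonneg (by linarith), max_eq_right (by linarith)]
    have e2 : hat N (i + 1) x = N * x - i := by
      rw [hat, abs_of_nonpos (by push_cast; linarith), max_eq_right (by push_cast; linarith)]
      push_cast
      ring
    rw [e1, e2]
    ring
  · intro j _ hj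
    simp only [Finset.mem_insert, Finset.mem_singleton, not_or] at hj
    rw [hat_eq_zero h1 h2 hj.1 hj.2, mul_zero]

theorem node_mem (hN : 0 < N) {i : ℕ} (hi : i ≤ N) : node N i ∈ I01 := by
  have : (0 : ℝ) < N := by exact_mod_cast hN
  have hi' : (i : ℝ) ≤ N := by exact_mod_cast hi
  exact ⟨by unfold node; positivity, (div_le_one this).2 hi'⟩

theorem node_zero (N : ℕ) : node N 0 = 0 := by simp [node]

theorem node_last (hN : 0 < N) : node N N = 1 := by
  have : (N : ℝ) ≠ 0 := by exact_mod_cast hN.ne'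
  simp [node, this]

theorem node_succ (N i : ℕ) : node N (i + 1) = node N i + 1 / N := by
  simp only [node]; push_cast; ring

theorem node_lt_succ (hN : 0 < N) (i : ℕ) : node N i < node N (i + 1) := by
  have : (0 : ℝ) < N := by exact_mod_cast hN
  rw [node_succ]
  have : 0 < 1 / (N : ℝ) := by positivity
  linarith

theorem mul_node (hN : 0 < N) (i : ℕ) : N * node N i = i := by
  have : (N : ℝ) ≠ 0 := by exact_mod_cast hN.ne'
  rw [node]; field_simp

theorem cell_subset (hN : 0 < N) {i : ℕ} (hi : i < N) :
    Icc (node N i) (node N (i + 1)) ⊆ I01 :=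
  Icc_subset_Icc (node_mem hN hi.le).1 (node_mem hN hi).2

theorem cell_interior_subset (hN : 0 < N) {i : ℕ} (hi : i < N) :
    Ioo (node N i) (node N (i + 1)) ⊆ Ioo 0 1 :=
  Ioo_subset_Ioo (node_mem hN hi.le).1 (node_mem hN hi).2

theorem pl_node (hN : 0 < N) (c : ℕ → ℝ) {j : ℕ} (hj : j ≤ N) : pl N c (node N j) = c j := by
  rcases hj.lt_or_eq with h | h
  · rw [pl_eq hN c h (left_mem_Icc.2 (node_lt_succ hN j).le), mul_node hN]
    ring
  · obtain ⟨i, rfl⟩ : ∃ i, j = i + 1 := ⟨j - 1, by omega⟩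
    rw [pl_eq hN c (i := i) (by omega) (right_mem_Icc.2 (node_lt_succ hN i).le), mul_node hN]
    push_cast
    ring

theorem pl_zero (hN : 0 < N) (c : ℕ → ℝ) : pl N c 0 = c 0 := by
  simpa [node_zero] using pl_node hN c (Nat.zero_le N)

theorem pl_one (hN : 0 < N) (c : ℕ → ℝ) : pl N c 1 = c N := by
  simpa [node_last hN] using pl_node hN c le_rfl

theorem exists_cell (hN : 0 < N) {x : ℝ} (hx : x ∈ I01) :
    ∃ i < N, x ∈ Icc (node N i) (node N (i + 1)) := by
  have hN' : (0 : ℝ) < N := by exact_mod_cast hN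
  have h0 : 0 ≤ N * x := mul_nonneg hN'.le hx.1
  rcases hx.2.lt_or_eq with h | h
  · refine ⟨⌊N * x⌋₊, (Nat.floor_lt h0).2 (by nlinarith), (mem_cell_iff hN).2 ⟨?_, ?_⟩⟩
    · exact Nat.floor_le h0
    · exact (Nat.lt_floor_add_one _).le
  · refine ⟨N - 1, by omega, (mem_cell_iff hN).2 ?_⟩
    rw [h, Nat.cast_sub (by omega : 1 ≤ N)]
    constructor <;> push_cast <;> linarith

theorem inSh_pl (hN : 0 < N) (c : ℕ → ℝ) : InSh N (pl N c) := by
  refine ⟨(lip01_pl N c).continuousOn, fun i hi => ⟨(c (i + 1) - c i) * N,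
    c i - (c (i + 1) - c i) * i, fun x hx => ?_⟩⟩
  rw [pl_eq hN c hi hx]
  ring

/-- An affine function on a cell is fixed by its two end values, so nodal values are coordinates on
S_h. -/
theorem InSh.eqOn (hN : 0 < N) {φ : ℝ → ℝ} (hφ : InSh N φ) :
    EqOn φ (pl N fun i => φ (node N i)) I01 := by
  intro x hx
  obtain ⟨i, hi, hxi⟩ := exists_cell hN hx
  obtain ⟨a, b, hab⟩ := hφ.2 i hi
  rw [pl_eq hN _ hi hxi, hab x hxi, hab _ (left_mem_Icc.2 (node_lt_succ hN i).le),
    hab _ (right_mem_Icc.2 (node_lt_succ hN i).le)]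
  have h1 := mul_node hN i
  have h2 := mul_node hN (i + 1)
  have hN' : (N : ℝ) ≠ 0 := by exact_mod_cast hN.ne'
  rw [node, node]
  push_cast
  field_simp
  ring

theorem integral_eq_sum_cells (hN : 0 < N) {f : ℝ → ℝ} (hf : Bdd f) :
    ∫ x in (0 : ℝ)..1, f x = ∑ i ∈ Finset.range N, ∫ x in (node N i)..(node N (i + 1)), f x := by
  rw [intervalIntegral.sum_integral_adjacent_intervals, node_zero, node_last hN]
  intro k hk
  exact hf.intervalIntegrable (node_mem hN (by omega)) (node_mem hN (by omega))

theorem integral_congr_interior {f g : ℝ → ℝ} {a b : ℝ} (hab : a ≤ b)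
    (h : ∀ x ∈ Ioo a b, f x = g x) : ∫ x in a..b, f x = ∫ x in a..b, g x := by
  rw [intervalIntegral.integral_of_le hab, intervalIntegral.integral_of_le hab,
    integral_Ioc_eq_integral_Ioo, integral_Ioc_eq_integral_Ioo]
  exact setIntegral_congr_fun measurableSet_Ioo h

theorem hasDerivAt_pl (hN : 0 < N) (c : ℕ → ℝ) {i : ℕ} (hi : i < N) {x : ℝ}
    (hx : x ∈ Ioo (node N i) (node N (i + 1))) :
    HasDerivAt (pl N c) (N * (c (i + 1) - c i)) x := by
  have h : HasDerivAt (fun y : ℝ => c i + (c (i + 1) - c i) * (N * y - i))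
      ((c (i + 1) - c i) * (N * 1)) x :=
    ((((hasDerivAt_id x).const_mul (N : ℝ)).sub_const _).const_mul _).const_add _
  refine (h.congr_of_eventuallyEq ?_).congr_deriv (by ring)
  filter_upwards [Icc_mem_nhds hx.1 hx.2] with y hy using pl_eq hN c hi hy

theorem dx_pl (hN : 0 < N) (c : ℕ → ℝ) {i : ℕ} (hi : i < N) {x : ℝ}
    (hx : x ∈ Ioo (node N i) (node N (i + 1))) : dx (pl N c) x = N * (c (i + 1) - c i) := by
  rw [dx_eq_deriv (cell_interior_subset hN hi hx), (hasDerivAt_pl hN c hi hx).deriv]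

theorem ip_dx_pl (hN : 0 < N) {f : ℝ → ℝ} (hf : Bdd f) (c : ℕ → ℝ) :
    ip f (dx (pl N c)) = ∑ i ∈ Finset.range N,
      N * (c (i + 1) - c i) * ∫ x in (node N i)..(node N (i + 1)), f x := by
  unfold ip
  rw [integral_eq_sum_cells hN (by fun_prop)]
  refine Finset.sum_congr rfl fun i hi => ?_
  rw [← intervalIntegral.integral_const_mul]
  refine integral_congr_interior (node_lt_succ hN i).le fun x hx => ?_
  rw [dx_pl hN c (Finset.mem_range.1 hi) hx]
  ring

theorem integral_cell_pl_sq (hN : 0 < N) (c : ℕ → ℝ) {i : ℕ} (hi : i < N) :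
    ∫ x in (node N i)..(node N (i + 1)), pl N c x ^ 2 =
      1 / N * ((c i ^ 2 + c i * c (i + 1) + c (i + 1) ^ 2) / 3) := by
  have hN' : (N : ℝ) ≠ 0 := by exact_mod_cast hN.ne'
  have e : ∫ x in (node N i)..(node N (i + 1)), pl N c x ^ 2 =
      ∫ x in (node N i)..(node N (i + 1)),
        (fun s : ℝ => (c i + (c (i + 1) - c i) * s) ^ 2) (N * x - i) :=
    integral_congr_interior (node_lt_succ hN i).le fun x hx => by
      rw [pl_eq hN c hi (Ioo_subset_Icc_self hx)]
  rw [e, intervalIntegral.integral_comp_mul_sub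
    (fun s : ℝ => (c i + (c (i + 1) - c i) * s) ^ 2) hN', mul_node hN, mul_node hN, smul_eq_mul,
    ← one_div, sub_self]
  push_cast
  rw [add_sub_cancel_left]
  congr 1
  have h : ∀ x ∈ uIcc (0 : ℝ) 1, HasDerivAt (fun s : ℝ => c i ^ 2 * s +
      c i * (c (i + 1) - c i) * s ^ 2 + (c (i + 1) - c i) ^ 2 * s ^ 3 / 3)
      ((c i + (c (i + 1) - c i) * x) ^ 2) x := by
    intro x _
    have h1 := (((hasDerivAt_id x).const_mul (c i ^ 2)).add
      ((hasDerivAt_pow 2 x).const_mul (c i * (c (i + 1) - c i)))).add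
      (((hasDerivAt_pow 3 x).const_mul ((c (i + 1) - c i) ^ 2)).div_const 3)
    refine h1.congr_deriv ?_
    push_cast
    ring
  rw [intervalIntegral.integral_eq_sub_of_hasDerivAt h
    (Continuous.intervalIntegrable (by fun_prop) _ _)]
  ring

/-- In each cell x² + xy + y² ≥ (x² + y²)/2, so the exact cell integral of the square is at least
h(x² + y²)/6. -/
theorem sum_sq_le (hN : 0 < N) (c : ℕ → ℝ) :
    ∑ i ∈ Finset.range N, (c i ^ 2 + c (i + 1) ^ 2) ≤ 6 * N * normL2 (pl N c) ^ 2 := by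
  have hN' : (0 : ℝ) < N := by exact_mod_cast hN
  rw [normL2_sq, ip_self_eq, integral_eq_sum_cells hN (by fun_prop), Finset.mul_sum]
  refine Finset.sum_le_sum fun i hi => ?_
  rw [integral_cell_pl_sq hN c (Finset.mem_range.1 hi)]
  field_simp
  nlinarith [sq_nonneg (c i + c (i + 1))]

/-- Inverse inequality for the maximum norm: on a cell the square of a convex combination is at most
the sum of the squared end values, which is one term of `sum_sq_le`. -/
theorem pl_sq_le (hN : 0 < N) (c : ℕ → ℝ) {x : ℝ} (hx : x ∈ I01) :
    pl N c x ^ 2 ≤ 6 * N * normL2 (pl N c) ^ 2 := by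
  obtain ⟨i, hi, hxi⟩ := exists_cell hN hx
  obtain ⟨h1, h2⟩ := (mem_cell_iff hN).1 hxi
  refine le_trans ?_ (sum_sq_le hN c)
  refine le_trans ?_ (Finset.single_le_sum (f := fun i => c i ^ 2 + c (i + 1) ^ 2)
    (fun j _ => by positivity) (Finset.mem_range.2 hi))
  rw [pl_eq hN c hi hxi]
  have h3 : 0 ≤ N * x - i := by linarith
  have h4 : N * x - i ≤ 1 := by linarith
  generalize N * x - i = s at h3 h4
  nlinarith [mul_nonneg (mul_nonneg h3 (sub_nonneg.2 h4)) (sq_nonneg (c (i + 1) - c i)),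
    mul_nonneg h3 (sq_nonneg (c i)), mul_nonneg (sub_nonneg.2 h4) (sq_nonneg (c (i + 1)))]

theorem coeff_sq_le (hN : 0 < N) (c : ℕ → ℝ) {i : ℕ} (hi : i ≤ N) :
    c i ^ 2 ≤ 6 * N * normL2 (pl N c) ^ 2 := by
  simpa [pl_node hN c hi] using pl_sq_le hN c (node_mem hN hi)

/-- Inverse inequality: the derivative is N(c (i+1) − c i) on each cell, and (x − y)² ≤ 2(x² + y²)
with `sum_sq_le` gives 12 N² ≤ (4N)². -/
theorem normL2_dx_pl_le (hN : 0 < N) (c : ℕ → ℝ) :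
    normL2 (dx (pl N c)) ≤ 4 * N * normL2 (pl N c) := by
  have hN' : (0 : ℝ) < N := by exact_mod_cast hN
  apply abs_le_of_sq_le_sq' _ (mul_nonneg (by positivity) (normL2_nonneg _)) |>.2
  rw [normL2_sq, ip_dx_pl hN (by fun_prop)]
  have h : ∀ i ∈ Finset.range N, N * (c (i + 1) - c i) *
      ∫ x in (node N i)..(node N (i + 1)), dx (pl N c) x ≤ 2 * N * (c i ^ 2 + c (i + 1) ^ 2) := by
    intro i hi
    rw [integral_dx (by fun_prop) (node_mem hN (Finset.mem_range.1 hi).le)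
      (node_mem hN (Finset.mem_range.1 hi)), pl_node hN c (Finset.mem_range.1 hi),
      pl_node hN c (Finset.mem_range.1 hi).le]
    nlinarith [mul_nonneg hN'.le (sq_nonneg (c i + c (i + 1)))]
  refine (Finset.sum_le_sum h).trans ?_
  rw [← Finset.mul_sum]
  have h1 := mul_le_mul_of_nonneg_left (sum_sq_le hN c) (by positivity : (0 : ℝ) ≤ 2 * N)
  nlinarith [mul_nonneg (sq_nonneg (N : ℝ)) (sq_nonneg (normL2 (pl N c)))]

/-! ### Interpolation errors in L² and in H¹ -/

section interpolation

/-- The piecewise linear interpolant of `f`. -/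
def interp (N : ℕ) (f : ℝ → ℝ) : ℝ → ℝ := pl N fun i => f (node N i)

@[fun_prop]
theorem lip01_interp (N : ℕ) (f : ℝ → ℝ) : Lip01 (interp N f) := lip01_pl _ _

theorem lip01_of_hasDerivAt {B b : ℝ → ℝ} (hB : ContinuousOn B I01) (hb : Bdd b)
    {M : ℝ} (hM : ∀ x ∈ I01, |b x| ≤ M) (h : ∀ x ∈ Ioo (0 : ℝ) 1, HasDerivAt B (b x) x) :
    Lip01 B := by
  have hM0 : 0 ≤ M := (abs_nonneg _).trans (hM 0 zero_mem_I01)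
  refine ⟨Real.toNNReal M, LipschitzOnWith.of_dist_le_mul ?_⟩
  have key : ∀ x ∈ I01, ∀ y ∈ I01, x ≤ y → |B y - B x| ≤ M * |y - x| := by
    intro x hx y hy hxy
    have hs : Icc x y ⊆ I01 := Icc_subset_Icc hx.1 hy.2
    rw [← intervalIntegral.integral_eq_sub_of_hasDerivAt_of_le hxy (hB.mono hs)
      (fun z hz => h z (Ioo_subset_Ioo hx.1 hy.2 hz)) (hb.intervalIntegrable hx hy)]
    have : ∀ z ∈ uIoc x y, ‖b z‖ ≤ M := fun z hz =>
      hM z ((convex_Icc _ _).ordConnected.uIcc_subset hx hy (uIoc_subset_uIcc hz))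
    exact intervalIntegral.norm_integral_le_of_norm_le_const this
  intro x hx y hy
  rw [Real.dist_eq, Real.dist_eq, Real.coe_toNNReal _ hM0]
  rcases le_total x y with hxy | hxy
  · rw [abs_sub_comm, abs_sub_comm x]
    exact key x hx y hy hxy
  · exact key y hy x hx hxy

/-- `b` is Lipschitz continuous and the derivative of the continuous function `B`. -/
structure IsC11 (B b : ℝ → ℝ) : Prop where
  cont : ContinuousOn B I01
  lip : Lip01 b
  deriv : ∀ x ∈ Ioo (0 : ℝ) 1, HasDerivAt B (b x) x

variable {B b : ℝ → ℝ}

theorem IsC11.lip01 (h : IsC11 B b) : Lip01 B := by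
  obtain ⟨M, _, hM⟩ := h.lip.exists_bound
  exact lip01_of_hasDerivAt h.cont h.lip.bdd hM h.deriv

theorem IsC11.dx_ae (h : IsC11 B b) : dx B =ᵐ[vol01] b := by
  apply dx_ae_of_hasDerivAt
  filter_upwards [ae_mem_Ioo] with x hx using h.deriv x hx

theorem IsC11.dx_sub_interp_cell (hN : 0 < N) (h : IsC11 B b) {i : ℕ} (hi : i < N) {x : ℝ}
    (hx : x ∈ Ioo (node N i) (node N (i + 1))) :
    dx (fun x => B x - interp N B x) x = b x - N * (B (node N (i + 1)) - B (node N i)) := by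
  have hx' := cell_interior_subset hN hi hx
  rw [dx_eq_deriv hx']
  exact ((h.deriv x hx').sub (hasDerivAt_pl hN _ hi hx)).deriv

/-- On a cell the derivative of the error is b minus the mean slope of B. By the mean value theorem
it has a zero there, so the Poincaré inequality applies to it. -/
theorem IsC11.integral_cell_dx_le (hN : 0 < N) (h : IsC11 B b) {i : ℕ} (hi : i < N) :
    ∫ x in (node N i)..(node N (i + 1)), dx (fun x => B x - interp N B x) x ^ 2 ≤
      (1 / N) ^ 2 * ∫ x in (node N i)..(node N (i + 1)), dx b x ^ 2 := by
  have hlt := node_lt_succ hN i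
  set s : ℝ := N * (B (node N (i + 1)) - B (node N i)) with hs
  have hN' : (N : ℝ) ≠ 0 := by exact_mod_cast hN.ne'
  obtain ⟨y, hy, hys⟩ := exists_hasDerivAt_eq_slope B b hlt (h.cont.mono (cell_subset hN hi))
    fun x hx => h.deriv x (cell_interior_subset hN hi hx)
  have hys' : b y - s = 0 := by
    rw [hys, hs, node_succ, add_sub_cancel_left]
    field_simp
    ring
  have key := integral_sq_le_of_zero (f := fun x => b x - s) (h.lip.sub (Lip01.const s))
    (node_mem hN hi.le) (node_mem hN hi) (Ioo_subset_Icc_self hy) hys'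
  rw [node_succ, add_sub_cancel_left, ← node_succ] at key
  have e1 : ∫ x in (node N i)..(node N (i + 1)), dx (fun x => B x - interp N B x) x ^ 2 =
      ∫ x in (node N i)..(node N (i + 1)), (b x - s) ^ 2 :=
    integral_congr_interior hlt.le fun x hx => by rw [h.dx_sub_interp_cell hN hi hx]
  have e2 : dx (fun x => b x - s) = dx b := by
    funext x
    exact derivWithin_sub_const s
  rwa [e1, ← e2]

/-- The error itself vanishes at the nodes: a second use of the Poincaré inequality gains the second
power of h. -/
theorem IsC11.integral_cell_le (hN : 0 < N) (h : IsC11 B b) {i : ℕ} (hi : i < N) :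
    ∫ x in (node N i)..(node N (i + 1)), (B x - interp N B x) ^ 2 ≤
      (1 / N) ^ 2 * ((1 / N) ^ 2 * ∫ x in (node N i)..(node N (i + 1)), dx b x ^ 2) := by
  have key := integral_sq_le_of_zero (h.lip01.sub (lip01_interp N B))
    (node_mem hN hi.le) (node_mem hN hi) (left_mem_Icc.2 (node_lt_succ hN i).le)
    (by rw [interp, pl_node hN _ hi.le, sub_self])
  rw [node_succ, add_sub_cancel_left, ← node_succ] at key
  exact key.trans (mul_le_mul_of_nonneg_left (h.integral_cell_dx_le hN hi) (by positivity))

theorem IsC11.normL2_dx_sub_interp_le (hN : 0 < N) (h : IsC11 B b) :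
    normL2 (dx fun x => B x - interp N B x) ≤ 1 / N * normL2 (dx b) := by
  have hl := h.lip
  have hB := h.lip01
  apply (abs_le_of_sq_le_sq' _ (mul_nonneg (by positivity) (normL2_nonneg _))).2
  rw [mul_pow, normL2_sq, normL2_sq, ip_self_eq, ip_self_eq,
    integral_eq_sum_cells hN (by fun_prop), integral_eq_sum_cells hN (by fun_prop), Finset.mul_sum]
  exact Finset.sum_le_sum fun i hi => h.integral_cell_dx_le hN (Finset.mem_range.1 hi)

theorem IsC11.normL2_sub_interp_le (hN : 0 < N) (h : IsC11 B b) :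
    normL2 (fun x => B x - interp N B x) ≤ (1 / N) ^ 2 * normL2 (dx b) := by
  have hl := h.lip
  have hB := h.lip01
  apply (abs_le_of_sq_le_sq' _ (mul_nonneg (by positivity) (normL2_nonneg _))).2
  rw [mul_pow, normL2_sq, normL2_sq, ip_self_eq, ip_self_eq,
    integral_eq_sum_cells hN (by fun_prop), integral_eq_sum_cells hN (by fun_prop), Finset.mul_sum]
  refine Finset.sum_le_sum fun i hi => (h.integral_cell_le hN (Finset.mem_range.1 hi)).trans ?_
  rw [← mul_assoc, ← pow_two]

theorem IsC11.abs_sub_interp_le (hN : 0 < N) (h : IsC11 B b) {x : ℝ} (hx : x ∈ I01) :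
    |B x - interp N B x| ≤ 1 / N * normL2 (dx b) :=
  (abs_le_normL2_dx (h.lip01.sub (lip01_interp N B)) zero_mem_I01
    (by rw [interp, pl_zero hN, node_zero, sub_self]) hx).trans (h.normL2_dx_sub_interp_le hN)

/-- The derivative of the error has mean zero on each cell, where the other factor is constant. -/
theorem ip_dx_sub_interp_dx_pl (hN : 0 < N) (hB : Lip01 B) (c : ℕ → ℝ) :
    ip (dx fun x => B x - interp N B x) (dx (pl N c)) = 0 := by
  rw [ip_dx_pl hN (by fun_prop)]
  refine Finset.sum_eq_zero fun i hi => ?_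
  have hi := Finset.mem_range.1 hi
  rw [integral_dx (by fun_prop) (node_mem hN hi.le) (node_mem hN hi), interp, pl_node hN _ hi.le,
    pl_node hN _ hi]
  ring

end interpolation

/-! ### Superconvergence of the interpolation error against derivatives of S_h -/

section superconvergence

/-- Pointwise error of linear interpolation on an interval. -/
theorem abs_sub_linear_interp_le {f f₁ f₂ : ℝ → ℝ} {a b M : ℝ} (hab : a < b)
    (h1 : ∀ x ∈ Icc a b, HasDerivWithinAt f (f₁ x) (Icc a b) x)
    (h2 : ∀ x ∈ Icc a b, HasDerivWithinAt f₁ (f₂ x) (Icc a b) x)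
    (hM : ∀ x ∈ Icc a b, |f₂ x| ≤ M) {x : ℝ} (hx : x ∈ Icc a b) :
    |f x - (f a + (f b - f a) / (b - a) * (x - a))| ≤ M * (b - a) ^ 2 := by
  set s := (f b - f a) / (b - a) with hs
  obtain ⟨y, hy, hys⟩ := exists_hasDerivAt_eq_slope f f₁ hab
    (fun x hx => (h1 x hx).continuousWithinAt)
    fun x hx => (h1 x (Ioo_subset_Icc_self hx)).hasDerivAt (Icc_mem_nhds hx.1 hx.2)
  rw [← hs] at hys
  have hM0 : 0 ≤ M := (abs_nonneg _).trans (hM x hx)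
  -- The chord slope s is a value of f₁, so f₁ − s is controlled by f₂; one more integration from
  -- the node a gives the claim, with a constant that is not sharp.
  have hd : ∀ z ∈ Icc a b, |f₁ z - s| ≤ M * (b - a) := by
    intro z hz
    rw [← hys]
    have := (convex_Icc a b).norm_image_sub_le_of_norm_hasDerivWithin_le h2 hM
      (Ioo_subset_Icc_self hy) hz
    refine this.trans (mul_le_mul_of_nonneg_left ?_ hM0)
    rw [Real.norm_eq_abs, abs_le]
    constructor <;> linarith [hz.1, hz.2, hy.1, hy.2]
  have he : ∀ z ∈ Icc a b,
      HasDerivWithinAt (fun x => f x - (f a + s * (x - a))) (f₁ z - s) (Icc a b) z := by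
    intro z hz
    have := (h1 z hz).sub (((((hasDerivWithinAt_id z (Icc a b)).sub_const a).const_mul
      s)).const_add (f a))
    rw [mul_one] at this
    exact this
  have := (convex_Icc a b).norm_image_sub_le_of_norm_hasDerivWithin_le he hd
    (left_mem_Icc.2 hab.le) hx
  simp only [sub_self, mul_zero, add_zero, sub_zero, Real.norm_eq_abs] at this
  refine this.trans ?_
  rw [abs_of_nonneg (by linarith [hx.1]), pow_two, ← mul_assoc]
  exact mul_le_mul_of_nonneg_left (by linarith [hx.2])
    (mul_nonneg hM0 (by linarith))

theorem sum_by_parts (e J : ℕ → ℝ) (n : ℕ) :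
    ∑ i ∈ Finset.range (n + 1), (e (i + 1) - e i) * J i =
      e (n + 1) * J n - e 0 * J 0 - ∑ i ∈ Finset.range n, e (i + 1) * (J (i + 1) - J i) := by
  induction n with
  | zero => simp; ring
  | succ n ih => rw [Finset.sum_range_succ, ih, Finset.sum_range_succ _ n]; ring

variable {w w₁ w₂ g : ℝ → ℝ} {M : ℝ}

theorem interp_cell (hN : 0 < N) (f : ℝ → ℝ) {i : ℕ} (hi : i < N) {x : ℝ}
    (hx : x ∈ Icc (node N i) (node N (i + 1))) :
    interp N f x = f (node N i) + (f (node N (i + 1)) - f (node N i)) /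
      (node N (i + 1) - node N i) * (x - node N i) := by
  have hN' : (N : ℝ) ≠ 0 := by exact_mod_cast hN.ne'
  have h1 := mul_node hN i
  rw [interp, pl_eq hN _ hi hx, node_succ, add_sub_cancel_left, ← h1]
  field_simp

/-- The error of linear interpolation of a function with Lipschitz continuous second derivative
changes by `O(h³)` from a mesh interval to the next one. -/
theorem interp_error_shift (hN : 0 < N)
    (h1 : ∀ x ∈ I01, HasDerivWithinAt w (w₁ x) I01 x)
    (h2 : ∀ x ∈ I01, HasDerivWithinAt w₁ (w₂ x) I01 x)
    (hL : ∀ x ∈ I01, ∀ y ∈ I01, |w₂ x - w₂ y| ≤ M * |x - y|) {i : ℕ} (hi : i + 1 < N) {x : ℝ}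
    (hx : x ∈ Icc (node N i) (node N (i + 1))) :
    |(w (x + 1 / N) - interp N w (x + 1 / N)) - (w x - interp N w x)| ≤ M * (1 / N) ^ 3 := by
  have hN' : (0 : ℝ) < N := by exact_mod_cast hN
  set h : ℝ := 1 / N with hh
  have hpos : 0 < h := by positivity
  have hs0 : Icc (node N i) (node N (i + 1)) ⊆ I01 := cell_subset hN (by omega)
  have hmaps : MapsTo (fun y => y + h) (Icc (node N i) (node N (i + 1)))
      (Icc (node N (i + 1)) (node N (i + 1 + 1))) := by
    intro y hy
    rw [node_succ N (i + 1), node_succ N i, ← hh]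
    rw [node_succ N i, ← hh] at hy
    exact ⟨by linarith [hy.1], by linarith [hy.2]⟩
  have hs1 : Icc (node N (i + 1)) (node N (i + 1 + 1)) ⊆ I01 := cell_subset hN hi
  have hD : ∀ F F' : ℝ → ℝ, (∀ x ∈ I01, HasDerivWithinAt F (F' x) I01 x) →
      ∀ x ∈ Icc (node N i) (node N (i + 1)), HasDerivWithinAt (fun y => F (y + h) - F y)
        (F' (x + h) - F' x) (Icc (node N i) (node N (i + 1))) x := by
    intro F F' hF x hx
    have a1 := (hF _ (hs1 (hmaps hx))).comp x ((hasDerivWithinAt_id x _).add_const h)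
      (fun y hy => hs1 (hmaps hy))
    rw [mul_one] at a1
    exact a1.sub ((hF x (hs0 hx)).mono hs0)
  -- Interpolation commutes with the shift by h. Hence the change in question is the interpolation
  -- error of y ↦ w(y + h) − w(y), whose second derivative is at most M h.
  have key := abs_sub_linear_interp_le (M := M * h) (node_lt_succ hN i) (hD w w₁ h1)
    (hD w₁ w₂ h2) (fun y hy => by
      refine (hL _ (hs1 (hmaps hy)) _ (hs0 hy)).trans ?_
      rw [add_sub_cancel_left, abs_of_pos hpos]) hx
  have e1 := interp_cell hN w (by omega : i < N) hx
  have e2 := interp_cell hN w hi (hmaps hx)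
  have n1 : node N (i + 1) = node N i + h := node_succ N i
  have n2 : node N (i + 1 + 1) = node N i + h + h := by rw [node_succ, n1]
  simp only [n1, n2, add_sub_cancel_left] at key e1 e2
  rw [e1, e2]
  calc _ = _ := by congr 1; ring
    _ ≤ _ := key
    _ = _ := by ring

theorem interp_error_le (hN : 0 < N)
    (h1 : ∀ x ∈ I01, HasDerivWithinAt w (w₁ x) I01 x)
    (h2 : ∀ x ∈ I01, HasDerivWithinAt w₁ (w₂ x) I01 x)
    (hM : ∀ x ∈ I01, |w₂ x| ≤ M) {x : ℝ} (hx : x ∈ I01) :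
    |w x - interp N w x| ≤ M * (1 / N) ^ 2 := by
  obtain ⟨i, hi, hxi⟩ := exists_cell hN hx
  have hs := cell_subset hN hi
  have key := abs_sub_linear_interp_le (M := M) (node_lt_succ hN i)
    (fun y hy => (h1 y (hs hy)).mono hs) (fun y hy => (h2 y (hs hy)).mono hs)
    (fun y hy => hM y (hs hy)) hxi
  rw [← interp_cell hN w hi hxi] at key
  simpa only [node_succ, add_sub_cancel_left] using key

theorem lip01_of_hasDerivWithinAt (h1 : ∀ x ∈ I01, HasDerivWithinAt w (w₁ x) I01 x)
    (hM : ∀ x ∈ I01, |w₁ x| ≤ M) : Lip01 w :=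
  ⟨⟨M, (abs_nonneg _).trans (hM 0 zero_mem_I01)⟩,
    (convex_Icc 0 1).lipschitzOnWith_of_nnnorm_hasDerivWithin_le h1 fun x hx => hM x hx⟩

/-- The derivative of `pl N c` is a difference quotient of nodal values; summation by parts moves
the difference onto the cell integrals J of g(w − I_h w), which vary slowly from cell to cell. The
inverse inequality alone would give only the first power of h. The exponent 3/2 is due to the two
boundary terms, because g need not vanish at the ends. -/
theorem ip_mul_interp_error_dx_pl_le (hN : 0 < N)
    (h1 : ∀ x ∈ I01, HasDerivWithinAt w (w₁ x) I01 x)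
    (h2 : ∀ x ∈ I01, HasDerivWithinAt w₁ (w₂ x) I01 x)
    (hM1 : ∀ x ∈ I01, |w₁ x| ≤ M)
    (hM : ∀ x ∈ I01, |w₂ x| ≤ M)
    (hL : ∀ x ∈ I01, ∀ y ∈ I01, |w₂ x - w₂ y| ≤ M * |x - y|)
    (hg : ∀ x ∈ I01, |g x| ≤ M) (hgL : ∀ x ∈ I01, ∀ y ∈ I01, |g x - g y| ≤ M * |x - y|)
    (c : ℕ → ℝ) :
    |ip (fun x => g x * (w x - interp N w x)) (dx (pl N c))| ≤
      12 * M ^ 2 * (1 / N * √(1 / N)) * normL2 (pl N c) := by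
  have hN' : (0 : ℝ) < N := by exact_mod_cast hN
  have hM0 : 0 ≤ M := (abs_nonneg _).trans (hM 0 zero_mem_I01)
  have hgl : Lip01 g := ⟨⟨M, hM0⟩, LipschitzOnWith.of_dist_le_mul hgL⟩
  have hwl : Lip01 w := lip01_of_hasDerivWithinAt h1 hM1
  obtain ⟨n, rfl⟩ : ∃ n, N = n + 1 := ⟨N - 1, by omega⟩
  set N := n + 1
  set h : ℝ := 1 / N with hh
  have hpos : 0 < h := by positivity
  have hNh : (N : ℝ) * h = 1 := by rw [hh]; field_simp
  set f : ℝ → ℝ := fun x => g x * (w x - interp N w x)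
  have hf : Lip01 f := by fun_prop
  set J : ℕ → ℝ := fun i => ∫ x in (node N i)..(node N (i + 1)), f x with hJ
  have hJ1 : ∀ i < N, |J i| ≤ M ^ 2 * h ^ 3 := by
    intro i hi
    have : ∀ x ∈ uIoc (node N i) (node N (i + 1)), ‖f x‖ ≤ M * (M * h ^ 2) := by
      intro x hx
      rw [uIoc_of_le (node_lt_succ hN i).le] at hx
      have hx' := cell_subset hN hi (Ioc_subset_Icc_self hx)
      rw [Real.norm_eq_abs, abs_mul]
      exact mul_le_mul (hg x hx') (interp_error_le hN h1 h2 hM hx') (abs_nonneg _) hM0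
    refine (intervalIntegral.norm_integral_le_of_norm_le_const this).trans (le_of_eq ?_)
    rw [node_succ, add_sub_cancel_left, ← hh, abs_of_pos hpos]
    ring
  have hJ2 : ∀ i < n, |J (i + 1) - J i| ≤ 2 * M ^ 2 * h ^ 4 := by
    intro i hi
    have e : J (i + 1) = ∫ x in (node N i)..(node N (i + 1)), f (x + h) := by
      rw [intervalIntegral.integral_comp_add_right, hJ]
      simp only [node_succ, ← hh]
    have hmem : ∀ x ∈ Icc (node N i) (node N (i + 1)), x ∈ I01 ∧ x + h ∈ I01 := by
      intro x hx
      refine ⟨cell_subset hN (by omega) hx, cell_subset hN (by omega : i + 1 < N) ?_⟩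
      rw [node_succ N (i + 1), node_succ N i, ← hh]
      rw [node_succ N i, ← hh] at hx
      exact ⟨by linarith [hx.1], by linarith [hx.2]⟩
    have hint : IntervalIntegrable (fun x => f (x + h)) volume (node N i) (node N (i + 1)) := by
      have := (hf.bdd.intervalIntegrable (node_mem hN (by omega : i + 1 ≤ N))
        (node_mem hN (by omega : i + 1 + 1 ≤ N))).comp_add_right h
      rw [node_succ N (i + 1), node_succ N i, ← hh, add_sub_cancel_right,
        add_sub_cancel_right] at this
      rwa [node_succ N i]
    rw [e, hJ]
    simp only
    rw [← intervalIntegral.integral_sub hint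
      (hf.bdd.intervalIntegrable (node_mem hN (by omega)) (node_mem hN (by omega)))]
    -- Either the interpolation error changes, by O(h³), or the weight g changes, by O(h), against
    -- an error O(h²).
    have : ∀ x ∈ uIoc (node N i) (node N (i + 1)), ‖f (x + h) - f x‖ ≤
        M * (M * h ^ 3) + M * h * (M * h ^ 2) := by
      intro x hx
      rw [uIoc_of_le (node_lt_succ hN i).le] at hx
      obtain ⟨hx1, hx2⟩ := hmem x (Ioc_subset_Icc_self hx)
      have e : f (x + h) - f x = g (x + h) * ((w (x + h) - interp N w (x + h)) -
          (w x - interp N w x)) + (g (x + h) - g x) * (w x - interp N w x) := by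
        simp only [f]; ring
      rw [e]
      refine (norm_add_le _ _).trans (add_le_add ?_ ?_)
      · rw [Real.norm_eq_abs, abs_mul]
        exact mul_le_mul (hg _ hx2) (interp_error_shift hN h1 h2 hL (by omega)
          (Ioc_subset_Icc_self hx)) (abs_nonneg _) hM0
      · rw [Real.norm_eq_abs, abs_mul]
        have := hgL _ hx2 _ hx1
        rw [add_sub_cancel_left, abs_of_pos hpos] at this
        exact mul_le_mul this (interp_error_le hN h1 h2 hM hx1) (abs_nonneg _) (by positivity)
    refine (intervalIntegral.norm_integral_le_of_norm_le_const this).trans (le_of_eq ?_)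
    rw [node_succ, add_sub_cancel_left, ← hh, abs_of_pos hpos]
    ring
  set X := normL2 (pl N c)
  have hX : 0 ≤ X := normL2_nonneg _
  have hsq : √h ^ 2 = h := Real.sq_sqrt hpos.le
  -- A single nodal value costs the factor √N = N√h: here half a power of h is lost for the boundary
  -- terms.
  have hc : ∀ i ≤ N, |c i| ≤ 3 * (N * √h) * X := by
    intro i hi
    apply abs_le_of_sq_le_sq _ (by positivity)
    refine (coeff_sq_le hN c hi).trans ?_
    rw [mul_pow, mul_pow, mul_pow, hsq]
    have : (N : ℝ) ^ 2 * h = N := by rw [pow_two, mul_assoc, hNh, mul_one]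
    rw [this]
    nlinarith [mul_nonneg hN'.le (sq_nonneg X)]
  -- All interior values together cost N, by Cauchy–Schwarz; against the O(h⁴) differences and the
  -- outer factor N this leaves h².
  have hcs : ∑ i ∈ Finset.range n, |c (i + 1)| ≤ 3 * N * X := by
    apply (abs_le_of_sq_le_sq' _ (by positivity)).2
    have a1 := sq_sum_le_card_mul_sum_sq (s := Finset.range n) (f := fun i => |c (i + 1)|)
    simp only [Finset.card_range, sq_abs] at a1
    have a2 : ∑ i ∈ Finset.range n, c (i + 1) ^ 2 ≤ 6 * N * X ^ 2 := by
      refine le_trans ?_ (sum_sq_le hN c)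
      refine le_trans ?_ (Finset.sum_le_sum_of_subset_of_nonneg
        (Finset.range_mono (by omega : n ≤ N)) fun i _ _ => by positivity)
      exact Finset.sum_le_sum fun i _ => by nlinarith [sq_nonneg (c i)]
    have a3 : (n : ℝ) ≤ N := by exact_mod_cast (by omega : n ≤ N)
    calc _ ≤ (n : ℝ) * ∑ i ∈ Finset.range n, c (i + 1) ^ 2 := a1
      _ ≤ N * (6 * N * X ^ 2) := by gcongr
      _ ≤ _ := by nlinarith [mul_nonneg (sq_nonneg (N : ℝ)) (sq_nonneg X)]
  have hsum : ip f (dx (pl N c)) = N * (c N * J n - c 0 * J 0 -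
      ∑ i ∈ Finset.range n, c (i + 1) * (J (i + 1) - J i)) := by
    rw [ip_dx_pl hN hf.bdd, ← sum_by_parts c J n, Finset.mul_sum]
    exact Finset.sum_congr rfl fun i _ => by ring
  have hb3 : |∑ i ∈ Finset.range n, c (i + 1) * (J (i + 1) - J i)| ≤
      3 * N * X * (2 * M ^ 2 * h ^ 4) := by
    refine (Finset.abs_sum_le_sum_abs _ _).trans ?_
    refine le_trans ?_ (mul_le_mul_of_nonneg_right hcs (by positivity))
    rw [Finset.sum_mul]
    refine Finset.sum_le_sum fun i hi => ?_
    rw [abs_mul]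
    exact mul_le_mul_of_nonneg_left (hJ2 i (Finset.mem_range.1 hi)) (abs_nonneg _)
  have hb1 : |c N * J n| ≤ 3 * (N * √h) * X * (M ^ 2 * h ^ 3) := by
    rw [abs_mul]
    exact mul_le_mul (hc N le_rfl) (hJ1 n (by omega)) (abs_nonneg _) (by positivity)
  have hb2 : |c 0 * J 0| ≤ 3 * (N * √h) * X * (M ^ 2 * h ^ 3) := by
    rw [abs_mul]
    exact mul_le_mul (hc 0 (by omega)) (hJ1 0 (by omega)) (abs_nonneg _) (by positivity)
  rw [hsum, abs_mul, abs_of_pos hN']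
  have hh1 : h ≤ 1 := by
    rw [hh, div_le_one hN']
    exact_mod_cast hN
  have hs1 : h ≤ √h := by
    rw [Real.le_sqrt hpos.le hpos.le]
    nlinarith
  calc (N : ℝ) * |c N * J n - c 0 * J 0 - ∑ i ∈ Finset.range n, c (i + 1) * (J (i + 1) - J i)|
      ≤ N * (3 * (N * √h) * X * (M ^ 2 * h ^ 3) + 3 * (N * √h) * X * (M ^ 2 * h ^ 3) +
          3 * N * X * (2 * M ^ 2 * h ^ 4)) := by
        refine mul_le_mul_of_nonneg_left ?_ hN'.le
        exact (abs_sub _ _).trans (add_le_add ((abs_sub _ _).trans (add_le_add hb1 hb2)) hb3)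
    _ = (N * h) ^ 2 * (6 * M ^ 2 * (h * √h) * X + 6 * M ^ 2 * (h * h) * X) := by ring
    _ ≤ (N * h) ^ 2 * (6 * M ^ 2 * (h * √h) * X + 6 * M ^ 2 * (h * √h) * X) := by gcongr
    _ = _ := by rw [hNh]; ring

end superconvergence

end mesh

/-! ### Primitives of Lipschitz functions -/

/-- The primitive vanishing at `0`. -/
def prim (f : ℝ → ℝ) (x : ℝ) : ℝ := ∫ y in (0 : ℝ)..x, f y

theorem prim_zero (f : ℝ → ℝ) : prim f 0 = 0 := by simp [prim]

theorem Lip01.isC11_prim {f : ℝ → ℝ} (hf : Lip01 f) : IsC11 (prim f) f where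
  cont := (lip01_primitive hf.continuousOn).continuousOn
  lip := hf
  deriv := fun _ hx => hasDerivAt_primitive hf.continuousOn hx

@[fun_prop]
theorem lip01_prim {f : ℝ → ℝ} (hf : Lip01 f) : Lip01 (prim f) := lip01_primitive hf.continuousOn

theorem Lip01.dx_prim_ae {f : ℝ → ℝ} (hf : Lip01 f) :
    dx (prim f) =ᵐ[vol01] f := hf.isC11_prim.dx_ae

theorem Lip01.abs_prim_le {f : ℝ → ℝ} (hf : Lip01 f) {x : ℝ} (hx : x ∈ I01) :
    |prim f x| ≤ normL2 f := by
  rw [← normL2_congr_ae hf.dx_prim_ae]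
  exact abs_le_normL2_dx (lip01_prim hf) zero_mem_I01 (prim_zero f) hx

theorem prim_one (f : ℝ → ℝ) : prim f 1 = ip f fun _ => 1 := by simp [prim, ip]

/-! ### Error equations and the energy inequality at a fixed time -/

/-- Errors of the semidiscretization at a fixed time.  The error of `η` is `pl N a + ρ`, with
time derivative `pl N a' + ρt`; the error of `u` is `pl N b + σ`, with time derivative
`pl N b' + σt`; the exact solution is `(w, v)`. -/
structure ErrorEquations (α β δ M : ℝ) (N : ℕ) (w v ρ σ ρt σt : ℝ → ℝ) (a b a' b' : ℕ → ℝ) :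
    Prop where
  two_le : 2 ≤ N
  one_le : 1 ≤ M
  hα : |α| ≤ 2
  hβ : |β| ≤ 2
  hδ : |δ| ≤ 2
  lip_w : Lip01 w
  lip_v : Lip01 v
  lip_ρ : Lip01 ρ
  lip_σ : Lip01 σ
  lip_ρt : Lip01 ρt
  lip_σt : Lip01 σt
  w_le : ∀ x ∈ I01, |w x| ≤ M
  v_le : ∀ x ∈ I01, |v x| ≤ M
  dw_le : ∀ x ∈ I01, |dx w x| ≤ M
  dv_le : ∀ x ∈ I01, |dx v x| ≤ M
  v_zero : v 0 = 0
  v_one : v 1 = 0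
  b_zero : b 0 = 0
  b_last : b N = 0
  bt_zero : b' 0 = 0
  bt_last : b' N = 0
  ρ_le : ∀ x ∈ I01, |ρ x| ≤ M * (1 / N)
  σ_le : ∀ x ∈ I01, |σ x| ≤ M * (1 / N)
  normρ_le : normL2 ρ ≤ M * (1 / N) ^ 2
  normσ_le : normL2 σ ≤ M * (1 / N) ^ 2
  normρt_le : normL2 ρt ≤ M * (1 / N) ^ 2
  normσt_le : normL2 σt ≤ M * (1 / N) ^ 2
  super_ρ : ∀ e, |ip (fun x => v x * ρ x) (dx (pl N e))| ≤
    12 * M ^ 2 * (1 / N * √(1 / N)) * normL2 (pl N e)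
  -- The weight 1 + α w is bounded by 3M only, and 108 = 12 · 3².
  super_σ : ∀ e, |ip (fun x => (1 + α * w x) * σ x) (dx (pl N e))| ≤
    108 * M ^ 2 * (1 / N * √(1 / N)) * normL2 (pl N e)
  -- With p = θ + ρ and q = ξ + σ the difference of the fluxes is w v − (w − p)(v − q) = w q + v p −
  -- p q; likewise v² − (v − q)² = 2 v q − q² in the momentum equation.
  mass : ∀ e, ip (pl N a') (pl N e) = ip (fun x => (1 + α * w x) * (pl N b x + σ x) +
    α * (v x * (pl N a x + ρ x)) - α * ((pl N a x + ρ x) * (pl N b x + σ x))) (dx (pl N e)) -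
    ip ρt (pl N e)
  momentum : ∀ e : ℕ → ℝ, e 0 = 0 → e N = 0 → bilin (pl N b') (pl N e) =
    ip (fun x => (pl N a x + ρ x) + β / 2 * (2 * v x * (pl N b x + σ x) - (pl N b x + σ x) ^ 2) +
      δ / 2 * (2 * w x * (pl N a x + ρ x) - (pl N a x + ρ x) ^ 2)) (dx (pl N e)) - ip σt (pl N e)

/-- `‖θ‖² + ‖ξ‖₁²` for `θ = pl N a`, `ξ = pl N b`. -/
def energy (N : ℕ) (a b : ℕ → ℝ) : ℝ := normL2 (pl N a) ^ 2 + bilin (pl N b) (pl N b)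

theorem energy_eq (N : ℕ) (a b : ℕ → ℝ) : energy N a b =
    normL2 (pl N a) ^ 2 + normL2 (pl N b) ^ 2 + 1 / 3 * normL2 (dx (pl N b)) ^ 2 := by
  rw [energy, bilin, normL2_sq, normL2_sq, normL2_sq]
  ring

theorem abs_mul_le_of_le {x y A B : ℝ} (hx : |x| ≤ A) (hy : |y| ≤ B) : |x * y| ≤ A * B := by
  rw [abs_mul]
  exact mul_le_mul hx hy (abs_nonneg _) ((abs_nonneg _).trans hx)

theorem abs_ip_le_of_le {f g : ℝ → ℝ} {A B : ℝ} (hf : Bdd f) (hg : Bdd g) (hA : normL2 f ≤ A)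
    (hB : normL2 g ≤ B) : |ip f g| ≤ A * B :=
  (abs_ip_le hf hg).trans (mul_le_mul hA hB (normL2_nonneg _) ((normL2_nonneg _).trans hA))

namespace ErrorEquations

variable {α β δ M : ℝ} {N : ℕ} {w v ρ σ ρt σt : ℝ → ℝ} {a b a' b' : ℕ → ℝ}

section basic

variable (H : ErrorEquations α β δ M N w v ρ σ ρt σt a b a' b')
include H

theorem N_pos : 0 < N := by have := H.two_le; omega

theorem castN_pos : (0 : ℝ) < N := by exact_mod_cast H.N_pos

theorem h_pos : (0 : ℝ) < 1 / N := by have := H.castN_pos; positivity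

theorem h_le_half : (1 : ℝ) / N ≤ 1 / 2 :=
  one_div_le_one_div_of_le (by norm_num) (by exact_mod_cast H.two_le)

theorem N_mul_h : (N : ℝ) * (1 / N) = 1 := by have := H.castN_pos; field_simp

theorem norm_b_le : normL2 (pl N b) ≤ normL2 (dx (pl N b)) :=
  normL2_le_normL2_dx (lip01_pl _ _) zero_mem_I01 (by rw [pl_zero H.N_pos, H.b_zero])

theorem normp_le : normL2 (fun x => pl N a x + ρ x) ≤ normL2 (pl N a) + M * (1 / N) ^ 2 := by
  have hρ := H.lip_ρ
  exact (normL2_add_le (by fun_prop) (by fun_prop)).trans (by linarith [H.normρ_le])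

theorem normq_le : normL2 (fun x => pl N b x + σ x) ≤ normL2 (pl N b) + M * (1 / N) ^ 2 := by
  have hσ := H.lip_σ
  exact (normL2_add_le (by fun_prop) (by fun_prop)).trans (by linarith [H.normσ_le])

theorem coef_le {x : ℝ} {γ : ℝ} (hγ : |γ| ≤ 2) (hx : x ∈ I01) : |1 + γ * w x| ≤ 3 * M := by
  have h1 := abs_mul_le_of_le hγ (H.w_le x hx)
  have := abs_add_le 1 (γ * w x)
  rw [abs_one] at this
  linarith [H.one_le]

end basic

section small

variable (H : ErrorEquations α β δ M N w v ρ σ ρt σt a b a' b')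
  (hE : energy N a b ≤ (1 / N : ℝ) ^ 2)
include H hE

theorem norm_a_le : normL2 (pl N a) ≤ 1 / N := by
  rw [energy_eq] at hE
  have h1 := sq_nonneg (normL2 (pl N b))
  have h2 := sq_nonneg (normL2 (dx (pl N b)))
  exact (abs_le_of_sq_le_sq' (by linarith) H.h_pos.le).2

theorem norm_db_le : normL2 (dx (pl N b)) ≤ 2 * (1 / N) := by
  rw [energy_eq] at hE
  refine (abs_le_of_sq_le_sq' ?_ (by linarith [H.h_pos])).2
  nlinarith [sq_nonneg (normL2 (pl N b)), sq_nonneg (normL2 (pl N a))]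

/-- The function ξ vanishes at 0 and is bounded by ‖ξ'‖, so no inverse inequality is spent. The
factor h gained here later pays for ‖θ'‖ ≤ 4N‖θ‖. -/
theorem q_le {x : ℝ} (hx : x ∈ I01) : |pl N b x + σ x| ≤ 3 * M * (1 / N) := by
  have h1 := (abs_le_normL2_dx (lip01_pl N b) zero_mem_I01
    (by rw [pl_zero H.N_pos, H.b_zero]) hx).trans (H.norm_db_le hE)
  have h2 := H.σ_le x hx
  have := mul_le_mul_of_nonneg_right H.one_le H.h_pos.le
  linarith [abs_add_le (pl N b x) (σ x)]

theorem q_le' {x : ℝ} (hx : x ∈ I01) : |pl N b x + σ x| ≤ 3 * M := by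
  refine (H.q_le hE hx).trans ?_
  have := H.one_le
  have := H.h_le_half
  nlinarith

/-- For θ only the inverse inequality is available: |θ|² ≤ 6N h² = 6h ≤ 3, which gives boundedness
but no smallness. -/
theorem p_le {x : ℝ} (hx : x ∈ I01) : |pl N a x + ρ x| ≤ 4 * M := by
  have h1 : |pl N a x| ≤ 3 := by
    apply abs_le_of_sq_le_sq _ (by norm_num)
    have h1 := pl_sq_le H.N_pos a hx
    have h2 : normL2 (pl N a) ^ 2 ≤ (1 / N : ℝ) ^ 2 :=
      pow_le_pow_left₀ (normL2_nonneg _) (H.norm_a_le hE) 2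
    have h3 := mul_le_mul_of_nonneg_left h2 H.castN_pos.le
    have h4 : (N : ℝ) * (1 / N) ^ 2 = 1 / N := by rw [pow_two, ← mul_assoc, H.N_mul_h, one_mul]
    have h5 := H.h_le_half
    nlinarith
  have h2 := H.ρ_le x hx
  have := H.one_le
  have := H.h_le_half
  have h3 : M * (1 / N) ≤ M := by nlinarith
  linarith [abs_add_le (pl N a x) (ρ x)]

/-- Every flux paired with θ' must be treated without losing a power of h: ξ by integration by
parts, v θ by antisymmetry, ρ and σ by superconvergence, and the product p q by the smallness of q.
-/
theorem mass_energy : ip (pl N a') (pl N a) ≤ 5 * M * (normL2 (dx (pl N b)) * normL2 (pl N a)) +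
    25 * M * normL2 (pl N a) ^ 2 + 157 * M ^ 2 * (1 / N * √(1 / N)) * normL2 (pl N a) := by
  have hw := H.lip_w
  have hv := H.lip_v
  have hρ := H.lip_ρ
  have hσ := H.lip_σ
  have hρt := H.lip_ρt
  have hM := H.one_le
  have hh := H.h_pos
  have hNp := H.N_pos
  have hNh := H.N_mul_h
  have hτ : 0 ≤ normL2 (pl N a) := normL2_nonneg _
  have hlip_a := lip01_pl N a
  have hlip_b := lip01_pl N b
  have hζ := H.norm_b_le
  have hz : 0 ≤ normL2 (dx (pl N b)) := normL2_nonneg _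
  have hinv := normL2_dx_pl_le hNp a
  have eq := H.mass a
  have hp := H.normp_le
  have hqb := fun x hx => H.q_le hE (x := x) hx
  have hsρ := H.super_ρ a
  have hsσ := H.super_σ a
  have hb0 : pl N b 0 = 0 := by rw [pl_zero hNp, H.b_zero]
  have hb1 : pl N b 1 = 0 := by rw [pl_one hNp, H.b_last]
  have hlip_a' := lip01_pl N a'
  generalize pl N a' = θt at *
  generalize pl N a = θ at *
  generalize pl N b = ξ at *
  have e : (fun x => (1 + α * w x) * (ξ x + σ x) + α * (v x * (θ x + ρ x)) -
      α * ((θ x + ρ x) * (ξ x + σ x))) = fun x => (1 + α * w x) * ξ x + (1 + α * w x) * σ x +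
      α * (v x * θ x) + α * (v x * ρ x) - α * ((θ x + ρ x) * (ξ x + σ x)) := by
    funext x; ring
  rw [e, ip_sub_left (by fun_prop) (by fun_prop) (by fun_prop),
    ip_add_left (by fun_prop) (by fun_prop) (by fun_prop),
    ip_add_left (by fun_prop) (by fun_prop) (by fun_prop),
    ip_add_left (by fun_prop) (by fun_prop) (by fun_prop),
    ip_const_mul_left, ip_const_mul_left, ip_const_mul_left] at eq
  -- The derivative returns to (1 + α w) ξ, without boundary terms since ξ(0) = ξ(1) = 0.
  have t1 : |ip (fun x => (1 + α * w x) * ξ x) (dx θ)| ≤ 5 * M * normL2 (dx ξ) * normL2 θ := by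
    have hg : Lip01 fun x => 1 + α * w x := by fun_prop
    have h1 := ip_dx_left (hg.mul hlip_b) hlip_a
    simp only [hb0, hb1, mul_zero, zero_mul, sub_zero, zero_sub] at h1
    rw [← abs_neg, ← h1]
    refine abs_ip_le_of_le (by fun_prop) (by fun_prop) ?_ le_rfl
    rw [normL2_congr_ae (dx_mul_ae hg hlip_b)]
    refine (normL2_add_le (by fun_prop) (by fun_prop)).trans ?_
    have d1 : normL2 (fun x => dx (fun x => 1 + α * w x) x * ξ x) ≤ 2 * M * normL2 ξ := by
      refine normL2_mul_le (by fun_prop) (by fun_prop) (by linarith) fun x hx => ?_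
      have : dx (fun x => 1 + α * w x) x = α * dx w x := by
        rw [dx, derivWithin_const_add]
        exact derivWithin_const_mul_field α
      rw [this]
      exact abs_mul_le_of_le H.hα (H.dw_le x hx)
    have d2 : normL2 (fun x => (1 + α * w x) * dx ξ x) ≤ 3 * M * normL2 (dx ξ) :=
      normL2_mul_le (by fun_prop) (by fun_prop) (by linarith) fun x hx => H.coef_le H.hα hx
    nlinarith
  have t3 : |α * ip (fun x => v x * θ x) (dx θ)| ≤ M * normL2 θ ^ 2 := by
    rw [ip_mul_dx_self hv hlip_a (by rw [H.v_zero, zero_mul]) (by rw [H.v_one, zero_mul])]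
    have h1 : |ip (fun x => dx v x * θ x) θ| ≤ M * normL2 θ * normL2 θ :=
      abs_ip_le_of_le (by fun_prop) (by fun_prop)
        (normL2_mul_le (by fun_prop) (by fun_prop) (by linarith) H.dv_le) le_rfl
    have h2 : |α * (-(1 / 2))| ≤ 1 := by
      rw [abs_mul]
      norm_num
      linarith [H.hα]
    rw [← mul_assoc]
    refine (abs_mul_le_of_le h2 h1).trans (le_of_eq ?_)
    ring
  -- The 3M h from `q_le` cancels the 4N from the inverse inequality; 24 = 2 · 3 · 4.
  have t5 : |α * ip (fun x => (θ x + ρ x) * (ξ x + σ x)) (dx θ)| ≤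
      24 * M * (normL2 θ + M * (1 / N) ^ 2) * normL2 θ := by
    have h1 : normL2 (fun x => (θ x + ρ x) * (ξ x + σ x)) ≤
        3 * M * (1 / N) * (normL2 θ + M * (1 / N) ^ 2) := by
      simp_rw [mul_comm (θ _ + ρ _)]
      refine (normL2_mul_le (by fun_prop) (by fun_prop) (by positivity) hqb).trans ?_
      gcongr
    refine (abs_mul_le_of_le H.hα (abs_ip_le_of_le (by fun_prop) (by fun_prop) h1 hinv)).trans
      (le_of_eq ?_)
    calc _ = (N * (1 / N : ℝ)) * (24 * M * (normL2 θ + M * (1 / N) ^ 2) * normL2 θ) := by ring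
      _ = _ := by rw [hNh, one_mul]
  have t4 := abs_mul_le_of_le H.hα hsρ
  have t6 : |ip ρt θ| ≤ M * (1 / N) ^ 2 * normL2 θ :=
    abs_ip_le_of_le (by fun_prop) (by fun_prop) H.normρt_le le_rfl
  have hh2 : (1 / N : ℝ) ^ 2 * normL2 θ ≤ 1 / N * √(1 / N) * normL2 θ := by
    refine mul_le_mul_of_nonneg_right ?_ hτ
    rw [pow_two]
    refine mul_le_mul_of_nonneg_left ?_ hh.le
    rw [Real.le_sqrt hh.le hh.le]
    nlinarith [H.h_le_half]
  have hM2 : M ≤ M ^ 2 := by nlinarith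
  -- Terms of order h² are absorbed into h^{3/2}. The constant 157 collects 108 from σ, 2 · 12 from
  -- ρ, 24 from p q and 1 from ρ_t.
  have hs1 := mul_le_mul_of_nonneg_left hh2 (by positivity : 0 ≤ 25 * M ^ 2)
  have hs2 := mul_le_mul_of_nonneg_right hM2
    (by positivity : 0 ≤ (1 / N : ℝ) ^ 2 * normL2 θ)
  rw [eq]
  linarith [(abs_le.1 t1).2, (abs_le.1 hsσ).2, (abs_le.1 t3).2, (abs_le.1 t4).2, (abs_le.1 t5).1,
    (abs_le.1 t6).1]

/-- The flux error is p and q times bounded coefficients. Since the momentum equation controls ξ',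
an L² bound of the flux is enough and no superconvergence is needed. -/
theorem normQ_le : normL2 (fun x => (pl N a x + ρ x) +
      β / 2 * (2 * v x * (pl N b x + σ x) - (pl N b x + σ x) ^ 2) +
      δ / 2 * (2 * w x * (pl N a x + ρ x) - (pl N a x + ρ x) ^ 2)) ≤
    7 * M * (normL2 (pl N a) + normL2 (pl N b) + 2 * M * (1 / N) ^ 2) := by
  have hw := H.lip_w
  have hv := H.lip_v
  have hρ := H.lip_ρ
  have hσ := H.lip_σ
  have hM := H.one_le
  have hp := H.normp_le
  have hq := H.normq_le
  have hqb := fun x hx => H.q_le' hE (x := x) hx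
  have hpb := fun x hx => H.p_le hE (x := x) hx
  have hp0 := normL2_nonneg fun x => pl N a x + ρ x
  have hq0 := normL2_nonneg fun x => pl N b x + σ x
  have e : (fun x => (pl N a x + ρ x) +
      β / 2 * (2 * v x * (pl N b x + σ x) - (pl N b x + σ x) ^ 2) +
      δ / 2 * (2 * w x * (pl N a x + ρ x) - (pl N a x + ρ x) ^ 2)) = fun x =>
      (1 + δ / 2 * (2 * w x - (pl N a x + ρ x))) * (pl N a x + ρ x) +
      (β / 2 * (2 * v x - (pl N b x + σ x))) * (pl N b x + σ x) := by
    funext x; ring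
  have half : ∀ γ : ℝ, |γ| ≤ 2 → |γ / 2| ≤ 1 := by
    intro γ hγ
    rw [abs_div, abs_two]
    linarith
  rw [e]
  refine (normL2_add_le (by fun_prop) (by fun_prop)).trans ?_
  have h1 : normL2 (fun x => (1 + δ / 2 * (2 * w x - (pl N a x + ρ x))) * (pl N a x + ρ x)) ≤
      7 * M * normL2 (fun x => pl N a x + ρ x) := by
    refine normL2_mul_le (by fun_prop) (by fun_prop) (by linarith) fun x hx => ?_
    have h2 : |2 * w x - (pl N a x + ρ x)| ≤ 6 * M := by
      refine (abs_sub _ _).trans ?_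
      rw [abs_mul, abs_two]
      linarith [H.w_le x hx, hpb x hx]
    have h3 := abs_mul_le_of_le (half δ H.hδ) h2
    have h4 := abs_add_le 1 (δ / 2 * (2 * w x - (pl N a x + ρ x)))
    rw [abs_one] at h4
    linarith
  have h2 : normL2 (fun x => (β / 2 * (2 * v x - (pl N b x + σ x))) * (pl N b x + σ x)) ≤
      7 * M * normL2 (fun x => pl N b x + σ x) := by
    refine normL2_mul_le (by fun_prop) (by fun_prop) (by linarith) fun x hx => ?_
    have h2 : |2 * v x - (pl N b x + σ x)| ≤ 5 * M := by
      refine (abs_sub _ _).trans ?_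
      rw [abs_mul, abs_two]
      linarith [H.v_le x hx, hqb x hx]
    have h3 := abs_mul_le_of_le (half β H.hβ) h2
    linarith
  nlinarith

theorem momentum_energy : bilin (pl N b') (pl N b) ≤
    8 * M * (normL2 (pl N a) + normL2 (pl N b) + 2 * M * (1 / N) ^ 2) * normL2 (dx (pl N b)) := by
  have hw := H.lip_w
  have hv := H.lip_v
  have hρ := H.lip_ρ
  have hσ := H.lip_σ
  have hσt := H.lip_σt
  have hM := H.one_le
  rw [H.momentum b H.b_zero H.b_last]
  have h1 := abs_ip_le_of_le (g := dx (pl N b)) (by fun_prop) (by fun_prop) (H.normQ_le hE) le_rfl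
  have h2 : |ip σt (pl N b)| ≤ M * (1 / N) ^ 2 * normL2 (dx (pl N b)) :=
    abs_ip_le_of_le (by fun_prop) (by fun_prop) H.normσt_le H.norm_b_le
  have h3 : M * (1 / N : ℝ) ^ 2 ≤
      M * (normL2 (pl N a) + normL2 (pl N b) + 2 * M * (1 / N) ^ 2) := by
    refine mul_le_mul_of_nonneg_left ?_ (by linarith)
    have := normL2_nonneg (pl N a)
    have := normL2_nonneg (pl N b)
    have := sq_nonneg (1 / N : ℝ)
    nlinarith
  have h4 := mul_le_mul_of_nonneg_right h3 (normL2_nonneg (dx (pl N b)))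
  linarith [(abs_le.1 h1).2, (abs_le.1 h2).1]

/-- The energy inequality. -/
theorem energy_deriv_le : ip (pl N a') (pl N a) + bilin (pl N b') (pl N b) ≤
    500 * M ^ 2 * (energy N a b + (1 / N) ^ 3) := by
  have h1 := H.mass_energy hE
  have h2 := H.momentum_energy hE
  have hb := H.norm_b_le
  have hM := H.one_le
  have hh := H.h_pos
  have hτ := normL2_nonneg (pl N a)
  have hζ := normL2_nonneg (pl N b)
  have hz := normL2_nonneg (dx (pl N b))
  -- The consistency error is r = h^{3/2}; its square is the h³ of the claim.
  have hr : (1 / N * √(1 / N) : ℝ) ^ 2 = (1 / N) ^ 3 := by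
    rw [mul_pow, Real.sq_sqrt hh.le]
    ring
  have hr0 : 0 ≤ (1 / N * √(1 / N) : ℝ) := by positivity
  have hh2 : (1 / N : ℝ) ^ 2 ≤ 1 / N * √(1 / N) := by
    rw [pow_two]
    refine mul_le_mul_of_nonneg_left ?_ hh.le
    rw [Real.le_sqrt hh.le hh.le]
    nlinarith [H.h_le_half]
  rw [energy_eq, ← hr]
  generalize (1 / N * √(1 / N) : ℝ) = r at *
  generalize (1 / N : ℝ) ^ 2 = s at *
  generalize normL2 (pl N a) = τ at *
  generalize normL2 (pl N b) = ζ at *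
  generalize normL2 (dx (pl N b)) = z at *
  have hM2 : M ≤ M ^ 2 := by nlinarith
  have g1 : 5 * M * (z * τ) + 25 * M * τ ^ 2 + 157 * M ^ 2 * r * τ ≤
      M ^ 2 * (5 * (z * τ) + 25 * τ ^ 2 + 157 * (r * τ)) := by
    have := mul_le_mul_of_nonneg_right hM2 (by positivity : 0 ≤ 5 * (z * τ) + 25 * τ ^ 2)
    nlinarith
  have g2 : 8 * M * (τ + ζ + 2 * M * s) * z ≤ M ^ 2 * (8 * (τ + z + 2 * r) * z) := by
    have e1 : 8 * M * (τ + ζ + 2 * M * s) * z ≤ 8 * M * (τ + z + 2 * M * r) * z := by gcongr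
    have := mul_le_mul_of_nonneg_right hM2 (by positivity : 0 ≤ 8 * (τ + z) * z)
    nlinarith
  have g3 : (5 * (z * τ) + 25 * τ ^ 2 + 157 * (r * τ)) + 8 * (τ + z + 2 * r) * z ≤
      500 * (τ ^ 2 + ζ ^ 2 + 1 / 3 * z ^ 2 + r ^ 2) := by
    nlinarith [sq_nonneg (z - τ), sq_nonneg (r - τ), sq_nonneg (r - z), sq_nonneg ζ]
  have := mul_le_mul_of_nonneg_left g3 (sq_nonneg M)
  linarith

/-- The part of the flux error that is not `α v θ`. -/
theorem normF_le : normL2 (fun x => (1 + α * w x) * (pl N b x + σ x) + α * (v x * ρ x) -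
      α * ((pl N a x + ρ x) * (pl N b x + σ x))) ≤
    13 * M ^ 2 * (normL2 (pl N b) + (1 / N) ^ 2) := by
  have hw := H.lip_w
  have hv := H.lip_v
  have hρ := H.lip_ρ
  have hσ := H.lip_σ
  have hM := H.one_le
  have hq := H.normq_le
  have hpb := fun x hx => H.p_le hE (x := x) hx
  have hq0 := normL2_nonneg fun x => pl N b x + σ x
  have hζ := normL2_nonneg (pl N b)
  have hM2 : M ≤ M ^ 2 := by nlinarith
  have e : (fun x => (1 + α * w x) * (pl N b x + σ x) + α * (v x * ρ x) -
      α * ((pl N a x + ρ x) * (pl N b x + σ x))) = fun x =>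
      ((1 + α * w x) - α * (pl N a x + ρ x)) * (pl N b x + σ x) + (α * v x) * ρ x := by
    funext x; ring
  rw [e]
  refine (normL2_add_le (by fun_prop) (by fun_prop)).trans ?_
  have h1 : normL2 (fun x => ((1 + α * w x) - α * (pl N a x + ρ x)) * (pl N b x + σ x)) ≤
      11 * M * normL2 (fun x => pl N b x + σ x) := by
    refine normL2_mul_le (by fun_prop) (by fun_prop) (by linarith) fun x hx => ?_
    have := abs_mul_le_of_le H.hα (hpb x hx)
    refine (abs_sub _ _).trans ?_
    linarith [H.coef_le H.hα hx]
  have h2 : normL2 (fun x => (α * v x) * ρ x) ≤ 2 * M * normL2 ρ :=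
    normL2_mul_le (by fun_prop) (by fun_prop) (by linarith)
      fun x hx => abs_mul_le_of_le H.hα (H.v_le x hx)
  have h3 := mul_le_mul_of_nonneg_left hq (by linarith : 0 ≤ 11 * M)
  have h4 := mul_le_mul_of_nonneg_left H.normρ_le (by linarith : 0 ≤ 2 * M)
  have h5 := mul_le_mul_of_nonneg_right hM2 hζ
  have h6 := mul_nonneg (sq_nonneg M) hζ
  linarith

end small

end ErrorEquations

/-! ### Dual functions for the weak-norm estimates -/

/-- The function `G` with `G' = -f`, `G(1) = 0`. -/
def backPrim (f : ℝ → ℝ) (x : ℝ) : ℝ := prim f 1 - prim f x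

theorem Lip01.isC11_backPrim {f : ℝ → ℝ} (hf : Lip01 f) : IsC11 (backPrim f) (fun x => - f x) where
  cont := continuousOn_const.sub hf.isC11_prim.cont
  lip := hf.neg
  deriv := fun x hx => (hf.isC11_prim.deriv x hx).const_sub (prim f 1)

theorem backPrim_one (f : ℝ → ℝ) : backPrim f 1 = 0 := sub_self _

theorem dx_neg (f : ℝ → ℝ) : dx (fun x => - f x) = fun x => - dx f x := by
  funext x
  exact derivWithin.fun_neg

theorem Lip01.normL2_dx_neg_prim {f : ℝ → ℝ} (hf : Lip01 f) :
    normL2 (dx fun x => - prim f x) = normL2 f := by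
  rw [dx_neg, normL2_neg, normL2_congr_ae hf.dx_prim_ae]

/-- Integration by parts; `prim f` vanishes at 0 and `backPrim` at 1, so no boundary terms arise.
This turns ½ d/dt ‖Θ‖² into the mass equation tested with G = `backPrim Θ`. -/
theorem ip_prim_prim {f g : ℝ → ℝ} (hf : Lip01 f) (hg : Lip01 g) :
    ip (prim f) (prim g) = ip f (backPrim (prim g)) := by
  have hG := (lip01_prim hg).isC11_backPrim
  have h := ip_dx_left (lip01_prim hf) hG.lip01
  rw [prim_zero, backPrim_one, ip_congr_ae hf.dx_prim_ae (ae_eq_refl _),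
    ip_congr_ae (ae_eq_refl _) hG.dx_ae] at h
  have h2 := ip_const_mul_right (-1) (prim f) (prim g)
  simp only [neg_mul, one_mul] at h2
  linarith

/-- The function `B` with `B'' = -f`, `B(0) = B(1) = 0`, is the primitive of this function. -/
def dualSlope (f : ℝ → ℝ) (x : ℝ) : ℝ := prim (prim f) 1 - prim f x

theorem lip01_dualSlope {f : ℝ → ℝ} (hf : Lip01 f) : Lip01 (dualSlope f) :=
  (Lip01.const _).sub (lip01_prim hf)

theorem Lip01.dx_dualSlope_ae {f : ℝ → ℝ} (hf : Lip01 f) :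
    dx (dualSlope f) =ᵐ[vol01] fun x => - f x := by
  apply dx_ae_of_hasDerivAt
  filter_upwards [ae_mem_Ioo] with x hx
  exact (hf.isC11_prim.deriv x hx).const_sub (prim (prim f) 1)

theorem Lip01.abs_dualSlope_le {f : ℝ → ℝ} (hf : Lip01 f) {x : ℝ} (hx : x ∈ I01) :
    |dualSlope f x| ≤ 2 * normL2 f := by
  have h1 := hf.abs_prim_le hx
  have h2 := (lip01_prim hf).abs_prim_le one_mem_I01
  have h3 := normL2_le_of_abs_le (lip01_prim hf).bdd (normL2_nonneg _) fun y hy => hf.abs_prim_le hy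
  exact (abs_sub _ _).trans (by linarith)

/-- The constant in `dualSlope` is the mean of `prim f`, so `dualSlope f` has mean zero: this is the
boundary condition B(1) = 0. -/
theorem Lip01.prim_dualSlope_one {f : ℝ → ℝ} (hf : Lip01 f) :
    prim (dualSlope f) 1 = 0 := by
  have h2 : prim (prim f) 1 =
    ip (prim f) fun _ => 1 := prim_one _
  rw [prim_one]
  unfold dualSlope
  rw [ip_sub_left (by fun_prop) (by fun_prop) (by fun_prop), ← h2]
  simp [ip]

/-- A discrete test function `χ` with `bilin ξ χ ≥ ‖ξ‖² / 12`, close to the solution of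
`-B'' = ξ`, `B(0) = B(1) = 0`, the derivative `s` of which is `dualSlope ξ`. -/
theorem exists_dual_test {N : ℕ} (hN2 : 2 ≤ N) {e : ℕ → ℝ} (he0 : e 0 = 0) (he1 : e N = 0) :
    ∃ (c : ℕ → ℝ) (s : ℝ → ℝ), c 0 = 0 ∧ c N = 0 ∧ Lip01 s ∧
      (dx s =ᵐ[vol01] fun x => - pl N e x) ∧ (∀ x ∈ I01, |s x| ≤ 2 * normL2 (pl N e)) ∧
      1 / 12 * normL2 (pl N e) ^ 2 ≤ bilin (pl N e) (pl N c) ∧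
      normL2 (dx (pl N c)) ≤ 3 * normL2 (pl N e) ∧ normL2 (pl N c) ≤ 3 * normL2 (pl N e) ∧
      normL2 (fun x => s x - dx (pl N c) x) ≤ 1 / N * normL2 (pl N e) := by
  have hN : 0 < N := by omega
  have hb' := lip01_pl N e
  have hs := lip01_dualSlope hb'
  have hB := hs.isC11_prim
  have hB1 := hb'.prim_dualSlope_one
  refine ⟨fun i => prim (dualSlope (pl N e)) (node N i), dualSlope (pl N e),
    by simp only [node_zero, prim_zero], by simp only [node_last hN, hB1], hs,
    hb'.dx_dualSlope_ae, fun x hx => hb'.abs_dualSlope_le hx, ?_⟩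
  change 1 / 12 * normL2 (pl N e) ^ 2 ≤ bilin (pl N e) (interp N (prim (dualSlope (pl N e)))) ∧
      normL2 (dx (interp N (prim (dualSlope (pl N e))))) ≤ 3 * normL2 (pl N e) ∧
      normL2 (interp N (prim (dualSlope (pl N e)))) ≤ 3 * normL2 (pl N e) ∧
      normL2 (fun x => dualSlope (pl N e) x - dx (interp N (prim (dualSlope (pl N e)))) x) ≤
        1 / N * normL2 (pl N e)
  have hBl := hB.lip01
  have hI1 := hB.normL2_sub_interp_le hN
  have hI2 := hB.normL2_dx_sub_interp_le hN
  have hdb := hb'.dx_dualSlope_ae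
  rw [normL2_congr_ae hdb, normL2_neg] at hI1 hI2
  have horth := ip_dx_sub_interp_dx_pl hN hBl e
  have hχ : Lip01 (interp N (prim (dualSlope (pl N e)))) := by fun_prop
  have hχ0 : interp N (prim (dualSlope (pl N e))) 0 = 0 := by
    rw [interp, pl_zero hN, node_zero, prim_zero]
  have hB0 := prim_zero (dualSlope (pl N e))
  have hdB := hB.dx_ae
  have hs_le := fun x hx => hb'.abs_dualSlope_le (x := x) hx
  have hξt0 : pl N e 0 = 0 := by rw [pl_zero hN, he0]
  have hξt1 : pl N e 1 = 0 := by rw [pl_one hN, he1]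
  generalize interp N (prim (dualSlope (pl N e))) = χ at *
  generalize prim (dualSlope (pl N e)) = B at *
  generalize dualSlope (pl N e) = s at *
  generalize pl N e = ξt at *
  have hX := normL2_nonneg ξt
  have hdsub := dx_sub_ae hBl hχ
  have hh : (0 : ℝ) < 1 / N := by
    have : (0 : ℝ) < N := by exact_mod_cast hN
    positivity
  have hh1 : (1 : ℝ) / N ≤ 1 / 2 :=
    one_div_le_one_div_of_le (by norm_num) (by exact_mod_cast hN2)
  -- This uses N ≥ 2 and decides the coercivity constant: 1/12 = 1/3 − 1/4.
  have hs2 : (1 / N : ℝ) ^ 2 ≤ 1 / 4 := by nlinarith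
  have e1 : (fun x => s x - dx χ x) =ᵐ[vol01] dx (fun x => B x - χ x) := by
    filter_upwards [hdsub, hdB] with x hx hx'
    rw [hx, hx']
  rw [← normL2_congr_ae e1] at hI2
  -- By orthogonality the derivative part of the form is computed with B in place of its interpolant
  -- χ: (ξ', χ') = (ξ', s) = ‖ξ‖².
  rw [← ip_congr_ae e1 (ae_eq_refl _), ip_comm, ip_sub_right (by fun_prop) (by fun_prop)
    (by fun_prop), ip_dx_left hb' hs, hξt0, hξt1, ip_congr_ae (ae_eq_refl ξt) hdb] at horth
  have hneg := ip_const_mul_right (-1) ξt ξt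
  simp only [neg_mul, one_mul] at hneg
  -- Indeed (−B'', B) = ‖B'‖².
  have c2 : 0 ≤ ip ξt B := by
    have h := ip_dx_left hs hBl
    rw [ip_congr_ae hdb (ae_eq_refl B), ip_congr_ae (ae_eq_refl s) hdB, hB0, hB1] at h
    have := ip_const_mul_left (-1) ξt B
    simp only [neg_mul, one_mul] at this
    linarith [ip_self_nonneg s]
  have c3 : |ip ξt (fun x => B x - χ x)| ≤ normL2 ξt * ((1 / N) ^ 2 * normL2 ξt) :=
    abs_ip_le_of_le (by fun_prop) (by fun_prop) le_rfl hI1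
  rw [ip_sub_right (by fun_prop) (by fun_prop) (by fun_prop)] at c3
  have ns : normL2 s ≤ 2 * normL2 ξt :=
    normL2_le_of_abs_le hs.bdd (by linarith) hs_le
  have ndχ : normL2 (dx χ) ≤ 3 * normL2 ξt := by
    have e2 : dx χ = fun x => s x - (s x - dx χ x) := by funext x; ring
    rw [e2]
    refine (normL2_sub_le (by fun_prop) (by fun_prop)).trans ?_
    have := mul_le_mul_of_nonneg_right hh1 hX
    linarith
  refine ⟨?_, ndχ, (normL2_le_normL2_dx hχ zero_mem_I01 hχ0).trans ndχ, hI2⟩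
  rw [bilin]
  have h1 := mul_le_mul_of_nonneg_right hs2 (sq_nonneg (normL2 ξt))
  have h2 := (abs_le.1 c3).2
  rw [normL2_sq] at *
  have h3 : normL2 ξt * ((1 / N) ^ 2 * normL2 ξt) = (1 / N) ^ 2 * ip ξt ξt := by
    rw [← normL2_sq]; ring
  linarith

/-- The term linear in θ must not be bounded by ‖θ‖, which is only O(h^{3/2}). Replacing χ' by the
Lipschitz function s costs h‖θ‖, and then θ = Θ' is integrated by parts. The function s need not
vanish at 1, which is why Θ(1) has to be tracked besides ‖Θ‖. In the application f is ξ_t. -/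
theorem ip_main_le {δ M h : ℝ} {w s Θ θ χ f : ℝ → ℝ} (hw : Lip01 w) (hs : Lip01 s)
    (hΘ : Lip01 Θ) (hθ : Lip01 θ) (hχ : Lip01 χ)
    (hcoef : ∀ x ∈ I01, |1 + δ * w x| ≤ 3 * M) (hdw : ∀ x ∈ I01, |dx w x| ≤ M) (hδ : |δ| ≤ 2)
    (hM : 1 ≤ M) (hΘ0 : Θ 0 = 0) (hdΘ : dx Θ =ᵐ[vol01] θ)
    (hs_le : ∀ x ∈ I01, |s x| ≤ 2 * normL2 f) (hds : dx s =ᵐ[vol01] fun x => - f x)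
    (hsχ : normL2 (fun x => s x - dx χ x) ≤ h * normL2 f) :
    |ip (fun x => (1 + δ * w x) * θ x) (dx χ)| ≤
      (6 * M * |Θ 1| + 7 * M * normL2 Θ + 3 * M * (h * normL2 θ)) * normL2 f := by
  have hX := normL2_nonneg f
  have ns : normL2 s ≤ 2 * normL2 f := normL2_le_of_abs_le hs.bdd (by linarith) hs_le
  set m : ℝ → ℝ := fun x => (1 + δ * w x) * s x with hm
  have hml : Lip01 m := by fun_prop
  have hm1 : |m 1| ≤ 6 * M * normL2 f :=
    (abs_mul_le_of_le (hcoef 1 one_mem_I01) (hs_le 1 one_mem_I01)).trans (le_of_eq (by ring))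
  have ndm : normL2 (dx m) ≤ 7 * M * normL2 f := by
    have hg : Lip01 fun x => 1 + δ * w x := by fun_prop
    rw [normL2_congr_ae (dx_mul_ae hg hs)]
    refine (normL2_add_le (by fun_prop) (by fun_prop)).trans ?_
    have d1 : normL2 (fun x => dx (fun x => 1 + δ * w x) x * s x) ≤ 2 * M * normL2 s := by
      refine normL2_mul_le (by fun_prop) (by fun_prop) (by linarith) fun x hx => ?_
      have : dx (fun x => 1 + δ * w x) x = δ * dx w x := by
        rw [dx, derivWithin_const_add]
        exact derivWithin_const_mul_field δ
      rw [this]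
      exact abs_mul_le_of_le hδ (hdw x hx)
    have d2 : normL2 (fun x => (1 + δ * w x) * dx s x) ≤ 3 * M * normL2 (dx s) :=
      normL2_mul_le (by fun_prop) (by fun_prop) (by linarith) hcoef
    rw [normL2_congr_ae hds, normL2_neg] at d2
    nlinarith
  have main1 : |ip θ m| ≤ (6 * M * |Θ 1| + 7 * M * normL2 Θ) * normL2 f := by
    rw [← ip_congr_ae hdΘ (ae_eq_refl m), ip_dx_left hΘ hml, hΘ0, zero_mul, sub_zero]
    have h1 : |Θ 1 * m 1| ≤ |Θ 1| * (6 * M * normL2 f) := abs_mul_le_of_le le_rfl hm1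
    have h2 : |ip Θ (dx m)| ≤ normL2 Θ * (7 * M * normL2 f) :=
      abs_ip_le_of_le (by fun_prop) (by fun_prop) le_rfl ndm
    exact (abs_sub _ _).trans ((add_le_add h1 h2).trans (le_of_eq (by ring)))
  have ngθ : normL2 (fun x => (1 + δ * w x) * θ x) ≤ 3 * M * normL2 θ :=
    normL2_mul_le (by fun_prop) (by fun_prop) (by linarith) hcoef
  have e1 : dx χ = fun x => s x - (s x - dx χ x) := by funext x; ring
  have e2 : ip (fun x => (1 + δ * w x) * θ x) s = ip θ m := by
    simp only [ip, hm]
    congr 1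
    ext x
    ring
  rw [e1, ip_sub_right (by fun_prop) (by fun_prop) (by fun_prop), e2]
  have := abs_ip_le_of_le (by fun_prop) (by fun_prop) ngθ hsχ
  exact (abs_sub _ _).trans ((add_le_add main1 this).trans (le_of_eq (by ring)))

/-- Here X stands for ‖ξ_t‖: one factor X is divided out and all constants are absorbed into M² L.
-/
theorem bt_arith {M L X T T1 τ ζ s h : ℝ} (hM : 1 ≤ M) (hL : 1 ≤ L) (hX : 0 ≤ X) (hT : 0 ≤ T)
    (hT1 : 0 ≤ T1) (hτ : 0 ≤ τ) (hζ : 0 ≤ ζ) (hs : 0 ≤ s) (hh : 0 ≤ h)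
    (total : 1 / 12 * X ^ 2 ≤ ((6 * M * T1 + 7 * M * T + 3 * M * (h * τ)) +
      3 * (3 * M * (M * s) + 5 * M * (ζ + M * s) + (L + M) * h * (τ + M * s)) + 3 * (M * s)) * X) :
    X ≤ 500 * M ^ 2 * L * (T + T1 + ζ + s + h * (τ + s)) := by
  have total' : X ≤ 12 * ((6 * M * T1 + 7 * M * T + 3 * M * (h * τ)) +
      3 * (3 * M * (M * s) + 5 * M * (ζ + M * s) + (L + M) * h * (τ + M * s)) + 3 * (M * s)) := by
    rcases hX.eq_or_lt with h0 | h0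
    · rw [← h0]
      positivity
    · rw [pow_two, ← mul_assoc] at total
      linarith [le_of_mul_le_mul_right total h0]
  refine total'.trans ?_
  have hML : M ≤ M ^ 2 * L := by nlinarith [mul_nonneg (sq_nonneg M) (sub_nonneg.2 hL)]
  have hM2L : M ^ 2 ≤ M ^ 2 * L := by nlinarith [sq_nonneg M]
  have hLM : (L + M) ≤ 2 * (M * L) := by
    nlinarith [mul_nonneg (sub_nonneg.2 hM) (sub_nonneg.2 hL)]
  have k1 := mul_le_mul_of_nonneg_right hML hT1
  have k2 := mul_le_mul_of_nonneg_right hML hT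
  have k3 := mul_le_mul_of_nonneg_right hML (by positivity : 0 ≤ h * τ)
  have k4 := mul_le_mul_of_nonneg_right hM2L hs
  have k5 := mul_le_mul_of_nonneg_right hML hζ
  have k7 := mul_le_mul_of_nonneg_right hML hs
  have k6 : (L + M) * h * (τ + M * s) ≤ 2 * (M ^ 2 * L * (h * (τ + s))) := by
    have e1 : τ + M * s ≤ M * (τ + s) := by nlinarith
    calc (L + M) * h * (τ + M * s) ≤ (2 * (M * L)) * h * (M * (τ + s)) := by gcongr
      _ = _ := by ring
  have z1 : 0 ≤ M ^ 2 * L * T1 := by positivity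
  have z2 : 0 ≤ M ^ 2 * L * T := by positivity
  have z3 : 0 ≤ M ^ 2 * L * (h * τ) := by positivity
  have z4 : 0 ≤ M ^ 2 * L * s := by positivity
  have z5 : 0 ≤ M ^ 2 * L * ζ := by positivity
  have z6 : 0 ≤ M ^ 2 * L * (h * s) := by positivity
  linarith

/-! ### Weak-norm estimates at a fixed time -/

namespace ErrorEquations

variable {α β δ M : ℝ} {N : ℕ} {w v ρ σ ρt σt : ℝ → ℝ} {a b a' b' : ℕ → ℝ}
  (H : ErrorEquations α β δ M N w v ρ σ ρt σt a b a' b')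
  (hE : energy N a b ≤ (1 / N : ℝ) ^ 2)
include H hE

/-- The mass equation is tested with θ_t itself; the inverse inequality for its derivative costs N,
hence the weight h. This suffices, as θ_t is used only against an interpolation error of order h².
-/
theorem norm_at_le : 1 / N * normL2 (pl N a') ≤
    53 * M ^ 2 * (normL2 (pl N a) + normL2 (pl N b) + (1 / N) ^ 2) := by
  have hw := H.lip_w
  have hv := H.lip_v
  have hρ := H.lip_ρ
  have hσ := H.lip_σ
  have hρt := H.lip_ρt
  have hM := H.one_le
  have hh := H.h_pos
  have hh1 := H.h_le_half
  have hNh := H.N_mul_h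
  have eq := H.mass a'
  have hF := H.normF_le hE
  have e : (fun x => (1 + α * w x) * (pl N b x + σ x) + α * (v x * (pl N a x + ρ x)) -
      α * ((pl N a x + ρ x) * (pl N b x + σ x))) = fun x =>
      ((1 + α * w x) * (pl N b x + σ x) + α * (v x * ρ x) -
      α * ((pl N a x + ρ x) * (pl N b x + σ x))) + (α * v x) * pl N a x := by
    funext x; ring
  rw [e] at eq
  have h1 : normL2 (fun x => (α * v x) * pl N a x) ≤ 2 * M * normL2 (pl N a) :=
    normL2_mul_le (by fun_prop) (by fun_prop) (by linarith)
      fun x hx => abs_mul_le_of_le H.hα (H.v_le x hx)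
  have h2 := (normL2_add_le (by fun_prop) (by fun_prop)).trans (add_le_add hF h1)
  have h3 := abs_ip_le_of_le (by fun_prop) (by fun_prop) h2 (normL2_dx_pl_le H.N_pos a')
  have h4 : |ip ρt (pl N a')| ≤ M * (1 / N) ^ 2 * normL2 (pl N a') :=
    abs_ip_le_of_le (by fun_prop) (by fun_prop) H.normρt_le le_rfl
  rw [← normL2_sq] at eq
  have hX := normL2_nonneg (pl N a')
  have hτ := normL2_nonneg (pl N a)
  have hζ := normL2_nonneg (pl N b)
  have h5 := (abs_le.1 h3).2
  have h6 := (abs_le.1 h4).1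
  have key : normL2 (pl N a') ^ 2 ≤ ((13 * M ^ 2 * (normL2 (pl N b) + (1 / N) ^ 2) +
      2 * M * normL2 (pl N a)) * (4 * N) + M * (1 / N) ^ 2) * normL2 (pl N a') := by
    rw [eq]
    refine (sub_le_sub h5 h6).trans (le_of_eq (by ring))
  have h7 : normL2 (pl N a') ≤ (13 * M ^ 2 * (normL2 (pl N b) + (1 / N) ^ 2) +
      2 * M * normL2 (pl N a)) * (4 * N) + M * (1 / N) ^ 2 := by
    rcases hX.eq_or_lt with h0 | h0
    · rw [← h0]
      have := H.castN_pos
      positivity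
    · rw [pow_two] at key
      exact le_of_mul_le_mul_right key h0
  refine (mul_le_mul_of_nonneg_left h7 hh.le).trans ?_
  have e2 : (1 / N : ℝ) * ((13 * M ^ 2 * (normL2 (pl N b) + (1 / N) ^ 2) +
      2 * M * normL2 (pl N a)) * (4 * N) + M * (1 / N) ^ 2) =
      (N * (1 / N)) * (52 * M ^ 2 * (normL2 (pl N b) + (1 / N) ^ 2) +
      8 * M * normL2 (pl N a)) + M * (1 / N) * (1 / N) ^ 2 := by ring
  rw [e2, hNh, one_mul]
  have hM2 : M ≤ M ^ 2 := by nlinarith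
  have g1 := mul_le_mul_of_nonneg_right hM2 hτ
  have g2 : M * (1 / N : ℝ) ≤ M ^ 2 := by nlinarith
  have g3 := mul_le_mul_of_nonneg_right g2 (sq_nonneg (1 / N : ℝ))
  have g4 := mul_nonneg (sq_nonneg M) hτ
  have g5 := mul_nonneg (sq_nonneg M) hζ
  linarith

/-- The negative norm estimate of the mass equation. -/
theorem negative_norm_deriv_le :
    ip (pl N a') (backPrim (prim (pl N a))) ≤ 200 * M ^ 2 * (normL2 (prim (pl N a)) ^ 2 +
      normL2 (pl N b) ^ 2 + (1 / N) ^ 4 +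
      1 / N * (normL2 (pl N a) + normL2 (pl N b) + (1 / N) ^ 2) ^ 2) := by
  have hw := H.lip_w
  have hv := H.lip_v
  have hρ := H.lip_ρ
  have hσ := H.lip_σ
  have hρt := H.lip_ρt
  have hM := H.one_le
  have hh := H.h_pos
  have hh1 := H.h_le_half
  have ha := lip01_pl N a
  have hb := lip01_pl N b
  have ha' := lip01_pl N a'
  have hat := H.norm_at_le hE
  have hF := H.normF_le hE
  have hG := (lip01_prim ha).isC11_backPrim
  have eq := H.mass fun i => backPrim (prim (pl N a)) (node N i)
  change ip (pl N a') (interp N (backPrim (prim (pl N a)))) = ip _ (dx (interp N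
    (backPrim (prim (pl N a))))) - ip ρt (interp N (backPrim (prim (pl N a)))) at eq
  have hI1 := hG.normL2_sub_interp_le H.N_pos
  have hI2 := hG.normL2_dx_sub_interp_le H.N_pos
  rw [ha.normL2_dx_neg_prim] at hI1 hI2
  have hg : Lip01 (interp N (backPrim (prim (pl N a)))) := by fun_prop
  have hG1 := backPrim_one (prim (pl N a))
  have hΘ := lip01_prim ha
  have hdΘ := ha.dx_prim_ae
  generalize interp N (backPrim (prim (pl N a))) = γ at *
  generalize backPrim (prim (pl N a)) = G at *
  generalize pl N a' = θt at *
  generalize prim (pl N a) = Θ at *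
  generalize pl N a = θ at *
  generalize pl N b = ξ at *
  have hGl := hG.lip01
  have hdG := hG.dx_ae
  have hT := normL2_nonneg Θ
  have hτ := normL2_nonneg θ
  have hζ := normL2_nonneg ξ
  have hs := sq_nonneg (1 / N : ℝ)
  have ndG : normL2 (dx G) = normL2 Θ := by rw [normL2_congr_ae hdG, normL2_neg]
  have nG : normL2 G ≤ normL2 Θ := ndG ▸ normL2_le_normL2_dx hGl one_mem_I01 hG1
  have hdsub := dx_sub_ae hGl hg
  have nγ : normL2 γ ≤ normL2 Θ + (1 / N) ^ 2 * normL2 θ := by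
    have e : γ = fun x => G x - (G x - γ x) := by funext x; ring
    rw [e]
    exact (normL2_sub_le (by fun_prop) (by fun_prop)).trans (add_le_add nG hI1)
  have ndγ : normL2 (dx γ) ≤ normL2 Θ + 1 / N * normL2 θ := by
    have e : dx γ =ᵐ[vol01] fun x => dx G x - dx (fun x => G x - γ x) x := by
      filter_upwards [hdsub] with x hx
      rw [hx]; ring
    rw [normL2_congr_ae e]
    exact (normL2_sub_le (by fun_prop) (by fun_prop)).trans (add_le_add ndG.le hI2)
  have e : (fun x => (1 + α * w x) * (ξ x + σ x) + α * (v x * (θ x + ρ x)) -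
      α * ((θ x + ρ x) * (ξ x + σ x))) = fun x =>
      ((1 + α * w x) * (ξ x + σ x) + α * (v x * ρ x) -
      α * ((θ x + ρ x) * (ξ x + σ x))) + α * (v x * θ x) := by
    funext x; ring
  rw [e, ip_add_left (by fun_prop) (by fun_prop) (by fun_prop), ip_const_mul_left] at eq
  -- G is not piecewise linear; passing to its interpolant γ costs h²‖θ_t‖‖θ‖, where one factor h is
  -- spent on `norm_at_le`.
  have tA : |ip θt (fun x => G x - γ x)| ≤ normL2 θt * ((1 / N) ^ 2 * normL2 θ) :=
    abs_ip_le_of_le (by fun_prop) (by fun_prop) le_rfl hI1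
  rw [ip_sub_right (by fun_prop) (by fun_prop) (by fun_prop)] at tA
  have tB := abs_ip_le_of_le (by fun_prop) (by fun_prop) hF ndγ
  have nvθ : normL2 (fun x => v x * θ x) ≤ M * normL2 θ :=
    normL2_mul_le (by fun_prop) (by fun_prop) (by linarith) H.v_le
  -- Up to the interpolation error γ' is −Θ, and (v θ, Θ) = (v Θ, Θ') = −½ (v' Θ, Θ) since v
  -- vanishes at both ends; thus the transport term is bounded by ‖Θ‖².
  have tC : |α * ip (fun x => v x * θ x) (dx γ)| ≤
      M * normL2 Θ ^ 2 + 2 * M * (1 / N * normL2 θ ^ 2) := by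
    have e1 : dx γ =ᵐ[vol01] fun x => (-1) * Θ x - dx (fun x => G x - γ x) x := by
      filter_upwards [hdsub, hdG] with x hx hx'
      rw [hx, hx']; ring
    rw [ip_congr_ae (ae_eq_refl _) e1, ip_sub_right (by fun_prop) (by fun_prop) (by fun_prop),
      ip_const_mul_right]
    have e2 : ip (fun x => v x * θ x) Θ = ip (fun x => v x * Θ x) (dx Θ) := by
      rw [ip_congr_ae (f := fun x => v x * Θ x) (g := dx Θ) (f' := fun x => v x * Θ x) (g' := θ)
        (ae_eq_refl _) hdΘ]
      simp only [ip]
      congr 1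
      ext x
      ring
    rw [e2, ip_mul_dx_self hv hΘ (by rw [H.v_zero, zero_mul]) (by rw [H.v_one, zero_mul])]
    have h1 : |ip (fun x => dx v x * Θ x) Θ| ≤ M * normL2 Θ * normL2 Θ :=
      abs_ip_le_of_le (by fun_prop) (by fun_prop)
        (normL2_mul_le (by fun_prop) (by fun_prop) (by linarith) H.dv_le) le_rfl
    have h2 := abs_ip_le_of_le (by fun_prop) (by fun_prop) nvθ hI2
    have h3 : |-1 * (-(1 / 2) * ip (fun x => dx v x * Θ x) Θ)| ≤ 1 / 2 * (M * normL2 Θ ^ 2) := by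
      rw [← mul_assoc]
      norm_num [abs_mul]
      linarith
    refine (abs_mul_le_of_le H.hα ((abs_sub _ _).trans (add_le_add h3 h2))).trans (le_of_eq ?_)
    ring
  have tD : |ip ρt γ| ≤ M * (1 / N) ^ 2 * (normL2 Θ + (1 / N) ^ 2 * normL2 θ) :=
    abs_ip_le_of_le (by fun_prop) (by fun_prop) H.normρt_le nγ
  have tA' : normL2 θt * ((1 / N) ^ 2 * normL2 θ) ≤
      53 * M ^ 2 * (normL2 θ + normL2 ξ + (1 / N) ^ 2) * (1 / N * normL2 θ) := by
    have := mul_le_mul_of_nonneg_right hat (by positivity : (0 : ℝ) ≤ 1 / N * normL2 θ)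
    refine le_trans (le_of_eq ?_) this
    ring
  have total : ip θt G ≤ 53 * M ^ 2 * (normL2 θ + normL2 ξ + (1 / N) ^ 2) * (1 / N * normL2 θ) +
      13 * M ^ 2 * (normL2 ξ + (1 / N) ^ 2) * (normL2 Θ + 1 / N * normL2 θ) +
      (M * normL2 Θ ^ 2 + 2 * M * (1 / N * normL2 θ ^ 2)) +
      M * (1 / N) ^ 2 * (normL2 Θ + (1 / N) ^ 2 * normL2 θ) := by
    linarith [(abs_le.1 tA).2, (abs_le.1 tB).2, (abs_le.1 tC).2, (abs_le.1 tD).1]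
  refine total.trans ?_
  clear total tA' tD tC tA tB nvθ e eq ndγ nγ hdsub nG ndG hdG hI1 hI2 hF hat
  generalize normL2 θ = τ at *
  generalize normL2 ξ = ζ at *
  generalize normL2 Θ = T at *
  have hs4 : (1 / N : ℝ) ^ 4 = ((1 / N : ℝ) ^ 2) ^ 2 := by ring
  rw [hs4]
  have hsh : (1 / N : ℝ) ^ 2 ≤ 1 / N := by nlinarith
  generalize hsdef : (1 / N : ℝ) ^ 2 = s at *
  generalize (1 / N : ℝ) = h at *
  have hM2 : M ≤ M ^ 2 := by nlinarith
  have k1 : (τ + ζ + s) * (h * τ) ≤ h * (τ + ζ + s) ^ 2 := by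
    have : (τ + ζ + s) * τ ≤ (τ + ζ + s) ^ 2 := by rw [pow_two]; gcongr; linarith
    nlinarith
  have k2 : h * τ ^ 2 ≤ h * (τ + ζ + s) ^ 2 := by gcongr; linarith
  have k3 : (h * τ) ^ 2 ≤ h * τ ^ 2 := by
    rw [mul_pow, hsdef]
    exact mul_le_mul_of_nonneg_right hsh (sq_nonneg τ)
  have k4 : (ζ + s) * (T + h * τ) ≤ ζ ^ 2 + s ^ 2 + T ^ 2 + h * τ ^ 2 := by
    nlinarith [sq_nonneg (ζ + s - (T + h * τ)), sq_nonneg (ζ - s), sq_nonneg (T - h * τ)]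
  have k5 : s * (T + s * τ) ≤ s ^ 2 + T ^ 2 + h * τ ^ 2 := by
    have : s * τ ≤ h * τ := mul_le_mul_of_nonneg_right hsh hτ
    have : s * (T + s * τ) ≤ s * (T + h * τ) := by gcongr
    nlinarith [sq_nonneg (s - T), sq_nonneg (s - h * τ)]
  have m1 := mul_le_mul_of_nonneg_left k1 (by positivity : 0 ≤ 53 * M ^ 2)
  have m4 := mul_le_mul_of_nonneg_left k4 (by positivity : 0 ≤ 13 * M ^ 2)
  have m5 := mul_le_mul_of_nonneg_left k5 (by positivity : 0 ≤ M)
  have P0 : 0 ≤ T ^ 2 + s ^ 2 + h * τ ^ 2 := by positivity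
  have m6 := mul_le_mul_of_nonneg_right hM2 P0
  have m7 := mul_le_mul_of_nonneg_left k2 (by positivity : 0 ≤ M ^ 2)
  have m8 : 0 ≤ M ^ 2 * T ^ 2 := by positivity
  have m9 : 0 ≤ M ^ 2 * s ^ 2 := by positivity
  have m10 : 0 ≤ M ^ 2 * ζ ^ 2 := by positivity
  have m11 : 0 ≤ M ^ 2 * (h * τ ^ 2) := by positivity
  have m12 : 0 ≤ M * s ^ 2 := by positivity
  have m13 : 0 ≤ M * T ^ 2 := by positivity
  linarith

/-- The estimate of the time derivative of the error of `u` by duality. -/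
theorem norm_bt_le {L : ℝ} (hL : 1 ≤ L) (ha_le : ∀ x ∈ I01, |pl N a x| ≤ L * (1 / N)) :
    normL2 (pl N b') ≤ 500 * M ^ 2 * L * (normL2 (prim (pl N a)) + |prim (pl N a) 1| +
      normL2 (pl N b) + (1 / N) ^ 2 + 1 / N * (normL2 (pl N a) + (1 / N) ^ 2)) := by
  have hw := H.lip_w
  have hv := H.lip_v
  have hρ := H.lip_ρ
  have hσ := H.lip_σ
  have hσt := H.lip_σt
  have hM := H.one_le
  have hh := H.h_pos
  obtain ⟨c, s, hc0, hc1, hs, hdb, hs_le, coer, ndχ, nχ, hI2⟩ :=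
    exists_dual_test H.two_le H.bt_zero H.bt_last
  have eq := H.momentum c hc0 hc1
  have hp := H.normp_le
  have hq := H.normq_le
  have hqb := fun x hx => H.q_le' hE (x := x) hx
  have hpb : ∀ x ∈ I01, |pl N a x + ρ x| ≤ (L + M) * (1 / N) := fun x hx =>
    (abs_add_le _ _).trans (by linarith [ha_le x hx, H.ρ_le x hx])
  have ha := lip01_pl N a
  have hb := lip01_pl N b
  have hb' := lip01_pl N b'
  have hχ := lip01_pl N c
  have hdΘ := ha.dx_prim_ae
  have hΘ := lip01_prim ha
  have hΘ0 := prim_zero (pl N a)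
  generalize pl N c = χ at *
  generalize pl N b' = ξt at *
  generalize prim (pl N a) = Θ at *
  generalize pl N a = θ at *
  generalize pl N b = ξ at *
  have hX := normL2_nonneg ξt
  have main := ip_main_le hw hs hΘ ha hχ (fun x hx => H.coef_le H.hδ hx)
    (fun x hx => H.dw_le x hx) H.hδ hM hΘ0 hdΘ hs_le hdb hI2
  have e : (fun x => (θ x + ρ x) + β / 2 * (2 * v x * (ξ x + σ x) - (ξ x + σ x) ^ 2) +
      δ / 2 * (2 * w x * (θ x + ρ x) - (θ x + ρ x) ^ 2)) = fun x =>
      (1 + δ * w x) * θ x + (((1 + δ * w x) * ρ x + (β / 2 * (2 * v x - (ξ x + σ x))) *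
        (ξ x + σ x)) + (-(δ / 2) * (θ x + ρ x)) * (θ x + ρ x)) := by
    funext x; ring
  rw [e, ip_add_left (by fun_prop) (by fun_prop) (by fun_prop)] at eq
  have half : ∀ γ : ℝ, |γ| ≤ 2 → |γ / 2| ≤ 1 := by
    intro γ hγ
    rw [abs_div, abs_two]
    linarith
  have r1 : normL2 (fun x => (1 + δ * w x) * ρ x) ≤ 3 * M * (M * (1 / N) ^ 2) :=
    (normL2_mul_le (by fun_prop) (by fun_prop) (by linarith)
      fun x hx => H.coef_le H.hδ hx).trans
      (mul_le_mul_of_nonneg_left H.normρ_le (by linarith))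
  have r2 : normL2 (fun x => (β / 2 * (2 * v x - (ξ x + σ x))) * (ξ x + σ x)) ≤
      5 * M * (normL2 ξ + M * (1 / N) ^ 2) := by
    refine (normL2_mul_le (M := 5 * M) (by fun_prop) (by fun_prop) (by linarith)
      fun x hx => ?_).trans (mul_le_mul_of_nonneg_left hq (by linarith))
    have h2 : |2 * v x - (ξ x + σ x)| ≤ 5 * M := by
      refine (abs_sub _ _).trans ?_
      rw [abs_mul, abs_two]
      linarith [H.v_le x hx, hqb x hx]
    have h3 := abs_mul_le_of_le (half β H.hβ) h2
    linarith
  -- The pointwise bound of p by a multiple of h makes the quadratic term h‖p‖ instead of ‖p‖.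
  have r3 : normL2 (fun x => (-(δ / 2) * (θ x + ρ x)) * (θ x + ρ x)) ≤
      (L + M) * (1 / N) * (normL2 θ + M * (1 / N) ^ 2) := by
    have hLM : 0 ≤ (L + M) * (1 / N) := mul_nonneg (by linarith) hh.le
    refine (normL2_mul_le (M := (L + M) * (1 / N)) (by fun_prop) (by fun_prop) hLM
      fun x hx => ?_).trans (mul_le_mul_of_nonneg_left hp hLM)
    have := abs_mul_le_of_le (x := -(δ / 2)) (A := 1) (by rw [abs_neg]; exact half δ H.hδ)
      (hpb x hx)
    linarith
  have hR := (normL2_add_le (by fun_prop) (by fun_prop)).trans (add_le_add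
    ((normL2_add_le (by fun_prop) (by fun_prop)).trans (add_le_add r1 r2)) r3)
  have rem := abs_ip_le_of_le (by fun_prop) (by fun_prop) hR ndχ
  have last : |ip σt χ| ≤ M * (1 / N) ^ 2 * (3 * normL2 ξt) :=
    abs_ip_le_of_le (by fun_prop) (by fun_prop) H.normσt_le nχ
  have total : 1 / 12 * normL2 ξt ^ 2 ≤ ((6 * M * |Θ 1| + 7 * M * normL2 Θ +
      3 * M * (1 / N * normL2 θ)) + 3 * (3 * M * (M * (1 / N) ^ 2) +
      5 * M * (normL2 ξ + M * (1 / N) ^ 2) +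
      (L + M) * (1 / N) * (normL2 θ + M * (1 / N) ^ 2)) + 3 * (M * (1 / N) ^ 2)) *
      normL2 ξt := by
    rw [eq] at coer
    linarith [(abs_le.1 main).2, (abs_le.1 rem).2, (abs_le.1 last).1]
  exact bt_arith hM hL hX (normL2_nonneg Θ) (abs_nonneg (Θ 1)) (normL2_nonneg θ)
    (normL2_nonneg ξ) (sq_nonneg _) hh.le total

omit hE in
/-- The mass defect. -/
theorem abs_ip_one_le : |ip (pl N a') fun _ => 1| ≤ M * (1 / N) ^ 2 := by
  have hρt := H.lip_ρt
  -- The constant 1 belongs to S_h and has zero derivative, so the flux drops out and only ρ_t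
  -- remains.
  have e : EqOn (pl N fun _ => 1) (fun _ => 1) I01 := by
    intro x hx
    obtain ⟨i, hi, hxi⟩ := exists_cell H.N_pos hx
    rw [pl_eq H.N_pos _ hi hxi]
    ring
  have eq := H.mass fun _ => 1
  rw [ip_congr_ae (ae_eq_refl _) (ae_of_eqOn e), ip_congr_ae (ae_eq_refl ρt) (ae_of_eqOn e),
    ip_dx_pl H.N_pos] at eq
  · simp only [sub_self, mul_zero, zero_mul, Finset.sum_const_zero, zero_sub] at eq
    rw [eq, abs_neg]
    have h2 : normL2 (fun _ => (1 : ℝ)) = 1 := by simp [normL2, ip]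
    have := abs_ip_le_of_le (by fun_prop) (Bdd.const 1) H.normρt_le h2.le
    rwa [mul_one] at this
  · have hw := H.lip_w
    have hv := H.lip_v
    have hρ := H.lip_ρ
    have hσ := H.lip_σ
    fun_prop

end ErrorEquations

/-! ### Regularity of the exact solution and weak forms -/

/-- `w` is twice differentiable on `[0,1]`, and it and its derivatives `w₁`, `w₂` are bounded
by `M`. -/
structure IsC2 (M : ℝ) (w w₁ w₂ : ℝ → ℝ) : Prop where
  hasDeriv₁ : ∀ x ∈ I01, HasDerivWithinAt w (w₁ x) I01 x
  hasDeriv₂ : ∀ x ∈ I01, HasDerivWithinAt w₁ (w₂ x) I01 x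
  le₀ : ∀ x ∈ I01, |w x| ≤ M
  le₁ : ∀ x ∈ I01, |w₁ x| ≤ M
  le₂ : ∀ x ∈ I01, |w₂ x| ≤ M

/-- Moreover, the second derivative is Lipschitz continuous with constant `M`. -/
structure IsC21 (M : ℝ) (w w₁ w₂ : ℝ → ℝ) : Prop extends IsC2 M w w₁ w₂ where
  lip₂ : ∀ x ∈ I01, ∀ y ∈ I01, |w₂ x - w₂ y| ≤ M * |x - y|

theorem dx_eq_of_hasDerivWithinAt {w w₁ : ℝ → ℝ} {x : ℝ} (hx : x ∈ I01)
    (h : HasDerivWithinAt w (w₁ x) I01 x) : dx w x = w₁ x :=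
  h.derivWithin (uniqueDiffOn_Icc zero_lt_one x hx)

namespace IsC2

variable {M : ℝ} {w w₁ w₂ : ℝ → ℝ} (h : IsC2 M w w₁ w₂)
include h

theorem M_nonneg : 0 ≤ M := (abs_nonneg _).trans (h.le₀ 0 zero_mem_I01)

theorem lip : Lip01 w := lip01_of_hasDerivWithinAt h.hasDeriv₁ h.le₁

theorem isC11 : IsC11 w w₁ where
  cont := h.lip.continuousOn
  lip := lip01_of_hasDerivWithinAt h.hasDeriv₂ h.le₂
  deriv := fun x hx => (h.hasDeriv₁ x (Ioo_subset_Icc_self hx)).hasDerivAt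
    (Icc_mem_nhds hx.1 hx.2)

theorem normL2_dx₁_le : normL2 (dx w₁) ≤ M :=
  normL2_le_of_abs_le h.isC11.lip.bdd_dx h.M_nonneg fun x hx => by
    rw [dx_eq_of_hasDerivWithinAt hx (h.hasDeriv₂ x hx)]
    exact h.le₂ x hx

theorem abs_dx_le {x : ℝ} (hx : x ∈ I01) : |dx w x| ≤ M := by
  rw [dx_eq_of_hasDerivWithinAt hx (h.hasDeriv₁ x hx)]
  exact h.le₁ x hx

theorem abs_sub_le {x y : ℝ} (hx : x ∈ I01) (hy : y ∈ I01) : |w x - w y| ≤ M * |x - y| :=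
  (convex_Icc 0 1).norm_image_sub_le_of_norm_hasDerivWithin_le h.hasDeriv₁ h.le₁ hy hx

theorem interp_error_le {N : ℕ} (hN : 0 < N) {x : ℝ} (hx : x ∈ I01) :
    |w x - interp N w x| ≤ M * (1 / N) :=
  (h.isC11.abs_sub_interp_le hN hx).trans (by
    rw [mul_comm]
    exact mul_le_mul_of_nonneg_right h.normL2_dx₁_le (by positivity))

theorem normL2_interp_error_le {N : ℕ} (hN : 0 < N) :
    normL2 (fun x => w x - interp N w x) ≤ M * (1 / N) ^ 2 :=
  (h.isC11.normL2_sub_interp_le hN).trans (by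
    rw [mul_comm]
    exact mul_le_mul_of_nonneg_right h.normL2_dx₁_le (by positivity))

theorem normL2_dx_interp_error_le {N : ℕ} (hN : 0 < N) :
    normL2 (dx fun x => w x - interp N w x) ≤ M * (1 / N) :=
  (h.isC11.normL2_dx_sub_interp_le hN).trans (by
    rw [mul_comm]
    exact mul_le_mul_of_nonneg_right h.normL2_dx₁_le (by positivity))

end IsC2

/-- The weak form of the differential equations at a fixed time. -/
structure ExactWeak (α β δ : ℝ) (w v wt vt : ℝ → ℝ) : Prop where
  v_zero : v 0 = 0
  v_one : v 1 = 0
  vt_zero : vt 0 = 0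
  vt_one : vt 1 = 0
  mass : ∀ φ, Lip01 φ → ip wt φ = ip (fun x => v x + α * (w x * v x)) (dx φ)
  momentum : ∀ χ, Lip01 χ → χ 0 = 0 → χ 1 = 0 →
    bilin vt χ = ip (fun x => w x + β / 2 * v x ^ 2 + δ / 2 * w x ^ 2) (dx χ)

/-- The Galerkin equations, in conservation form, at a fixed time for functions with nodal values
`c`, `d`, and time derivatives with nodal values `c'`, `d'`. -/
structure DiscreteWeak (α β δ : ℝ) (N : ℕ) (c d c' d' : ℕ → ℝ) : Prop where
  d_zero : d 0 = 0
  d_last : d N = 0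
  dt_zero : d' 0 = 0
  dt_last : d' N = 0
  mass : ∀ e, ip (pl N c') (pl N e) =
    ip (fun x => pl N d x + α * (pl N c x * pl N d x)) (dx (pl N e))
  momentum : ∀ e : ℕ → ℝ, e 0 = 0 → e N = 0 → bilin (pl N d') (pl N e) =
    ip (fun x => pl N c x + β / 2 * pl N d x ^ 2 + δ / 2 * pl N c x ^ 2) (dx (pl N e))

theorem pl_sub (N : ℕ) (a b : ℕ → ℝ) :
    pl N (fun i => a i - b i) = fun x => pl N a x - pl N b x := by
  funext x
  simp [pl, sub_mul, Finset.sum_sub_distrib]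

theorem bilin_sub_left {f g k : ℝ → ℝ} (hf : Lip01 f) (hg : Lip01 g) (hk : Lip01 k) :
    bilin (fun x => f x - g x) k = bilin f k - bilin g k := by
  unfold bilin
  rw [ip_congr_ae (dx_sub_ae hf hg) (ae_eq_refl _),
    ip_sub_left (by fun_prop) (by fun_prop) (by fun_prop),
    ip_sub_left (by fun_prop) (by fun_prop) (by fun_prop)]
  ring

theorem errorEquations {α β δ M : ℝ} {N : ℕ} (hN : 2 ≤ N) (hM : 1 ≤ M) (hα : |α| ≤ 2)
    (hβ : |β| ≤ 2) (hδ : |δ| ≤ 2) {w w₁ w₂ v v₁ v₂ wt wt₁ wt₂ vt vt₁ vt₂ : ℝ → ℝ}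
    (hw : IsC21 M w w₁ w₂) (hv : IsC21 M v v₁ v₂) (hwt : IsC2 M wt wt₁ wt₂)
    (hvt : IsC2 M vt vt₁ vt₂) (hex : ExactWeak α β δ w v wt vt) {c d c' d' : ℕ → ℝ}
    (hd : DiscreteWeak α β δ N c d c' d') :
    ErrorEquations α β δ M N w v (fun x => w x - interp N w x) (fun x => v x - interp N v x)
      (fun x => wt x - interp N wt x) (fun x => vt x - interp N vt x)
      (fun i => w (node N i) - c i) (fun i => v (node N i) - d i)
      (fun i => wt (node N i) - c' i) (fun i => vt (node N i) - d' i) := by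
  have hN0 : 0 < N := by omega
  have lw := hw.lip
  have lv := hv.lip
  have lwt := hwt.lip
  have lvt := hvt.lip
  refine
  { two_le := hN
    one_le := hM
    hα := hα
    hβ := hβ
    hδ := hδ
    lip_w := lw
    lip_v := lv
    lip_ρ := by fun_prop
    lip_σ := by fun_prop
    lip_ρt := by fun_prop
    lip_σt := by fun_prop
    w_le := hw.le₀
    v_le := hv.le₀
    dw_le := fun x hx => hw.abs_dx_le hx
    dv_le := fun x hx => hv.abs_dx_le hx
    v_zero := hex.v_zero
    v_one := hex.v_one
    b_zero := by rw [node_zero, hex.v_zero, hd.d_zero, sub_zero]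
    b_last := by rw [node_last hN0, hex.v_one, hd.d_last, sub_zero]
    bt_zero := by rw [node_zero, hex.vt_zero, hd.dt_zero, sub_zero]
    bt_last := by rw [node_last hN0, hex.vt_one, hd.dt_last, sub_zero]
    ρ_le := fun x hx => hw.interp_error_le hN0 hx
    σ_le := fun x hx => hv.interp_error_le hN0 hx
    normρ_le := hw.normL2_interp_error_le hN0
    normσ_le := hv.normL2_interp_error_le hN0
    normρt_le := hwt.normL2_interp_error_le hN0
    normσt_le := hvt.normL2_interp_error_le hN0
    super_ρ := fun e => ip_mul_interp_error_dx_pl_le hN0 hw.hasDeriv₁ hw.hasDeriv₂ hw.le₁ hw.le₂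
      hw.lip₂ hv.le₀ (fun x hx y hy => hv.abs_sub_le hx hy) e
    super_σ := fun e => ?_
    mass := fun e => ?_
    momentum := fun e he0 he1 => ?_ }
  -- The superconvergence bound has one constant for function and weight, so it is applied with 3M,
  -- which dominates |1 + α w| ≤ 1 + 2M.
  · have le3 : ∀ y : ℝ, y ≤ M → y ≤ 3 * M := fun y hy => by linarith
    have := ip_mul_interp_error_dx_pl_le (M := 3 * M) (g := fun x => 1 + α * w x) hN0
      hv.hasDeriv₁ hv.hasDeriv₂ (fun x hx => le3 _ (hv.le₁ x hx)) (fun x hx => le3 _ (hv.le₂ x hx))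
      (fun x hx y hy => (hv.lip₂ x hx y hy).trans
        (mul_le_mul_of_nonneg_right (by linarith) (abs_nonneg _)))
      (fun x hx => by
        have h1 := abs_mul_le_of_le hα (hw.le₀ x hx)
        have := abs_add_le 1 (α * w x)
        rw [abs_one] at this
        linarith)
      (fun x hx y hy => by
        rw [add_sub_add_left_eq_sub, ← mul_sub]
        refine (abs_mul_le_of_le hα (hw.abs_sub_le hx hy)).trans ?_
        have := mul_nonneg hw.M_nonneg (abs_nonneg (x - y))
        linarith) e
    refine this.trans (le_of_eq (by ring))
  · have h1 : ip (pl N fun i => wt (node N i) - c' i) (pl N e) =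
        ip wt (pl N e) - ip (fun x => wt x - interp N wt x) (pl N e) - ip (pl N c') (pl N e) := by
      rw [pl_sub, ip_sub_left (by fun_prop) (by fun_prop) (by fun_prop),
        ip_sub_left (by fun_prop) (by fun_prop) (by fun_prop), interp]
      ring
    have h2 : (fun x => (1 + α * w x) * (pl N (fun i => v (node N i) - d i) x +
        (v x - interp N v x)) + α * (v x * (pl N (fun i => w (node N i) - c i) x +
        (w x - interp N w x))) - α * ((pl N (fun i => w (node N i) - c i) x +
        (w x - interp N w x)) * (pl N (fun i => v (node N i) - d i) x + (v x - interp N v x)))) =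
        fun x => (v x + α * (w x * v x)) - (pl N d x + α * (pl N c x * pl N d x)) := by
      funext x
      rw [pl_sub, pl_sub, interp, interp]
      ring
    rw [h1, h2, ip_sub_left (f := fun x => v x + α * (w x * v x))
      (g := fun x => pl N d x + α * (pl N c x * pl N d x)) (by fun_prop) (by fun_prop)
      (by fun_prop), hex.mass _ (lip01_pl N e), hd.mass]
    ring
  · have h1 : bilin (pl N fun i => vt (node N i) - d' i) (pl N e) =
        bilin vt (pl N e) - ip (fun x => vt x - interp N vt x) (pl N e) -
          bilin (pl N d') (pl N e) := by
      -- Orthogonality removes the derivative part, so that σ_t enters only through the L² product.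
      have h3 : bilin (fun x => vt x - interp N vt x) (pl N e) =
          ip (fun x => vt x - interp N vt x) (pl N e) := by
        rw [bilin, ip_dx_sub_interp_dx_pl hN0 lvt, mul_zero, add_zero]
      rw [← h3, pl_sub, bilin_sub_left (by fun_prop) (by fun_prop) (by fun_prop),
        bilin_sub_left (by fun_prop) (by fun_prop) (by fun_prop), interp]
      ring
    have h2 : (fun x => (pl N (fun i => w (node N i) - c i) x + (w x - interp N w x)) +
        β / 2 * (2 * v x * (pl N (fun i => v (node N i) - d i) x + (v x - interp N v x)) -
          (pl N (fun i => v (node N i) - d i) x + (v x - interp N v x)) ^ 2) +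
        δ / 2 * (2 * w x * (pl N (fun i => w (node N i) - c i) x + (w x - interp N w x)) -
          (pl N (fun i => w (node N i) - c i) x + (w x - interp N w x)) ^ 2)) =
        fun x => (w x + β / 2 * v x ^ 2 + δ / 2 * w x ^ 2) -
          (pl N c x + β / 2 * pl N d x ^ 2 + δ / 2 * pl N c x ^ 2) := by
      funext x
      rw [pl_sub, pl_sub, interp, interp]
      ring
    rw [h1, h2, ip_sub_left (f := fun x => w x + β / 2 * v x ^ 2 + δ / 2 * w x ^ 2)
      (g := fun x => pl N c x + β / 2 * pl N d x ^ 2 + δ / 2 * pl N c x ^ 2) (by fun_prop)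
      (by fun_prop) (by fun_prop),
      hex.momentum _ (lip01_pl N e) (by rw [pl_zero hN0, he0]) (by rw [pl_one hN0, he1]),
      hd.momentum e he0 he1]
    ring

/-- The flux form of the mass equation. -/
theorem ip_mass_flux {α : ℝ} {w v φ : ℝ → ℝ} (hw : Lip01 w) (hv : Lip01 v) (hφ : Lip01 φ)
    (hv0 : v 0 = 0) (hv1 : v 1 = 0) :
    ip (dx v) φ + α * ip (dx fun x => w x * v x) φ =
      - ip (fun x => v x + α * (w x * v x)) (dx φ) := by
  have hp : Lip01 fun x => w x * v x := by fun_prop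
  rw [ip_dx_left hv hφ, ip_dx_left hp hφ,
    ip_add_left (by fun_prop) (by fun_prop) (by fun_prop), ip_const_mul_left, hv0, hv1]
  ring

/-- The flux form of the momentum equation. -/
theorem ip_momentum_flux {β δ : ℝ} {w v χ : ℝ → ℝ} (hw : Lip01 w) (hv : Lip01 v) (hχ : Lip01 χ)
    (h0 : χ 0 = 0) (h1 : χ 1 = 0) :
    ip (dx w) χ + β * ip (fun x => v x * dx v x) χ + δ * ip (fun x => w x * dx w x) χ =
      - ip (fun x => w x + β / 2 * v x ^ 2 + δ / 2 * w x ^ 2) (dx χ) := by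
  have sq : ∀ f : ℝ → ℝ, Lip01 f → ip (fun x => f x * dx f x) χ =
      - (1 / 2) * ip (fun x => f x ^ 2) (dx χ) := by
    intro f hf
    have hs : Lip01 fun x => f x * f x := by fun_prop
    have e := ip_dx_left hs hχ
    rw [h0, h1, ip_congr_ae (dx_mul_ae hf hf) (ae_eq_refl χ),
      ip_add_left (by fun_prop) (by fun_prop) (by fun_prop)] at e
    simp only [pow_two]
    have e2 : ip (fun x => dx f x * f x) χ = ip (fun x => f x * dx f x) χ := by
      simp only [mul_comm]
    linarith
  rw [ip_dx_left hw hχ, sq v hv, sq w hw, h0, h1,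
    ip_add_left (by fun_prop) (by fun_prop) (by fun_prop),
    ip_add_left (by fun_prop) (by fun_prop) (by fun_prop), ip_const_mul_left, ip_const_mul_left]
  ring

theorem ip_zero_left (f : ℝ → ℝ) : ip (fun _ => 0) f = 0 := by simp [ip]

/-- The third-order term is integrated by parts against χ, which vanishes at the ends; hence u_xt
needs no boundary condition. The flux of the mass equation vanishes at the ends with v, so its test
functions are unrestricted. -/
theorem exactWeak {α β δ : ℝ} {w v wt vt vt₁ vt₂ : ℝ → ℝ} (hw : Lip01 w) (hv : Lip01 v)
    (hwt : Lip01 wt) {M : ℝ} (hvt : IsC2 M vt vt₁ vt₂) (hv0 : v 0 = 0) (hv1 : v 1 = 0)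
    (hvt0 : vt 0 = 0) (hvt1 : vt 1 = 0)
    (mass : ∀ x ∈ I01, wt x + dx v x + α * dx (fun y => w y * v y) x = 0)
    (momentum : ∀ x ∈ I01, vt x + dx w x + β * (v x * dx v x) + δ * (w x * dx w x)
      - 1 / 3 * vt₂ x = 0) : ExactWeak α β δ w v wt vt where
  v_zero := hv0
  v_one := hv1
  vt_zero := hvt0
  vt_one := hvt1
  mass := fun φ hφ => by
    have h1 := ip_congr_ae (ae_of_eqOn mass) (ae_eq_refl φ)
    have hp : Lip01 fun x => w x * v x := by fun_prop
    rw [ip_zero_left, ip_add_left (by fun_prop) (by fun_prop) (by fun_prop),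
      ip_add_left (by fun_prop) (by fun_prop) (by fun_prop), ip_const_mul_left] at h1
    have h2 := ip_mass_flux (α := α) hw hv hφ hv0 hv1
    linarith
  momentum := fun χ hχ h0 h1 => by
    have lvt := hvt.lip
    have lvt₁ := hvt.isC11.lip
    have e : EqOn (fun x => vt x + dx w x + β * (v x * dx v x) + δ * (w x * dx w x)
        - 1 / 3 * dx vt₁ x) (fun _ => 0) I01 := by
      intro x hx
      have := momentum x hx
      rwa [← dx_eq_of_hasDerivWithinAt hx (hvt.hasDeriv₂ x hx)] at this
    have h2 := ip_congr_ae (ae_of_eqOn e) (ae_eq_refl χ)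
    rw [ip_zero_left, ip_sub_left (by fun_prop) (by fun_prop) (by fun_prop),
      ip_add_left (by fun_prop) (by fun_prop) (by fun_prop),
      ip_add_left (by fun_prop) (by fun_prop) (by fun_prop),
      ip_add_left (by fun_prop) (by fun_prop) (by fun_prop), ip_const_mul_left, ip_const_mul_left,
      ip_const_mul_left, ip_dx_left lvt₁ hχ, h0, h1] at h2
    have h3 := ip_momentum_flux (β := β) (δ := δ) hw hv hχ h0 h1
    rw [bilin, ip_congr_ae hvt.isC11.dx_ae (ae_eq_refl _)]
    linarith

/-! ### Uniform bounds of the exact solution -/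

/-- Needed because a real supremum of an unbounded family is 0 by convention, in which case `normCk`
would bound nothing. -/
theorem iteratedDerivWithin_bdd {k j : ℕ} (hj : j ≤ k) {f : ℝ → ℝ} (hf : ContDiffOn ℝ k f I01) :
    BddAbove (range fun x : I01 => |iteratedDerivWithin j f I01 x|) := by
  have hc : ContinuousOn (iteratedDerivWithin j f I01) I01 :=
    hf.continuousOn_iteratedDerivWithin (by exact_mod_cast hj) (uniqueDiffOn_Icc zero_lt_one)
  obtain ⟨C, hC⟩ := isCompact_Icc.exists_bound_of_continuousOn hc
  exact ⟨C, by rintro _ ⟨x, rfl⟩; exact hC x x.2⟩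

theorem abs_iteratedDerivWithin_le_normCk {k j : ℕ} (hj : j ≤ k) {f : ℝ → ℝ}
    (hf : ContDiffOn ℝ k f I01) {x : ℝ} (hx : x ∈ I01) :
    |iteratedDerivWithin j f I01 x| ≤ normCk k f := by
  refine (le_ciSup (iteratedDerivWithin_bdd hj hf) ⟨x, hx⟩).trans ?_
  exact Finset.single_le_sum (f := fun j => ⨆ x : I01, |iteratedDerivWithin j f I01 x|)
    (fun i _ => Real.iSup_nonneg fun _ => abs_nonneg _) (Finset.mem_range.2 (by omega))

/-- Compactness of [0,T]: near each t₀ the C^k norm of f t exceeds that of f t₀ by at most 1. The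
intersection with [0,T] in the induction confines the claim to times at which f t is smooth. -/
theorem InCTCk.exists_bound {T : ℝ} {k : ℕ} {f : ℝ → ℝ → ℝ} (hf : InCTCk T k f) :
    ∃ M, 0 ≤ M ∧ ∀ t ∈ Icc 0 T, ∀ j ≤ k, ∀ x ∈ I01, |iteratedDerivWithin j (f t) I01 x| ≤ M := by
  suffices h : ∃ M, 0 ≤ M ∧ ∀ t ∈ Icc 0 T ∩ Icc 0 T, ∀ j ≤ k, ∀ x ∈ I01,
      |iteratedDerivWithin j (f t) I01 x| ≤ M by simpa using h
  refine (isCompact_Icc (a := (0 : ℝ)) (b := T)).induction_on (p := fun s => ∃ M, 0 ≤ M ∧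
    ∀ t ∈ s ∩ Icc 0 T, ∀ j ≤ k, ∀ x ∈ I01, |iteratedDerivWithin j (f t) I01 x| ≤ M) ?_ ?_ ?_ ?_
  · exact ⟨0, le_rfl, fun t ht => ht.1.elim⟩
  · rintro s t hst ⟨M, hM0, hM⟩
    exact ⟨M, hM0, fun r hr => hM r ⟨hst hr.1, hr.2⟩⟩
  · rintro s t ⟨M, hM0, hM⟩ ⟨M', hM0', hM'⟩
    refine ⟨max M M', le_max_of_le_left hM0, fun r hr j hj x hx => ?_⟩
    rcases hr.1 with h | h
    · exact (hM r ⟨h, hr.2⟩ j hj x hx).trans (le_max_left _ _)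
    · exact (hM' r ⟨h, hr.2⟩ j hj x hx).trans (le_max_right _ _)
  · intro t₀ ht₀
    have h1 : ∀ᶠ t in 𝓝[Icc 0 T] t₀, normCk k (f t - f t₀) < 1 :=
      (hf.2 t₀ ht₀).eventually (gt_mem_nhds zero_lt_one)
    refine ⟨{t | normCk k (f t - f t₀) < 1}, h1, normCk k (f t₀) + 1, ?_, ?_⟩
    · exact add_nonneg (Finset.sum_nonneg fun i _ => Real.iSup_nonneg fun _ => abs_nonneg _)
        zero_le_one
    · intro t ht j hj x hx
      have hc := hf.1 t ht.2
      have hc₀ := hf.1 t₀ ht₀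
      have h2 := abs_iteratedDerivWithin_le_normCk hj (hc.sub hc₀) hx
      have h3 := abs_iteratedDerivWithin_le_normCk hj hc₀ hx
      have hjk : (j : WithTop ℕ∞) ≤ k := by exact_mod_cast hj
      have e := iteratedDerivWithin_sub hx (uniqueDiffOn_Icc zero_lt_one)
        ((hc x hx).of_le hjk) ((hc₀ x hx).of_le hjk)
      have h4 : normCk k (f t - f t₀) < 1 := ht.1
      change |iteratedDerivWithin j (f t - f t₀) I01 x| ≤ normCk k (f t - f t₀) at h2
      rw [e] at h2
      have h5 := abs_add_le (iteratedDerivWithin j (f t) I01 x - iteratedDerivWithin j (f t₀) I01 x)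
        (iteratedDerivWithin j (f t₀) I01 x)
      rw [sub_add_cancel] at h5
      linarith

theorem hasDerivWithinAt_iterated {k j : ℕ} (hj : j < k) {f : ℝ → ℝ} (hf : ContDiffOn ℝ k f I01)
    {x : ℝ} (hx : x ∈ I01) :
    HasDerivWithinAt (iteratedDerivWithin j f I01) (iteratedDerivWithin (j + 1) f I01 x) I01 x := by
  have hd := hf.differentiableOn_iteratedDerivWithin (m := j) (by exact_mod_cast hj)
    (uniqueDiffOn_Icc zero_lt_one) x hx
  rw [iteratedDerivWithin_succ]
  exact hd.hasDerivWithinAt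

theorem isC2_of_bound {k : ℕ} (hk : 2 ≤ k) {M : ℝ} {f : ℝ → ℝ} (hf : ContDiffOn ℝ k f I01)
    (hM : ∀ j ≤ k, ∀ x ∈ I01, |iteratedDerivWithin j f I01 x| ≤ M) :
    IsC2 M f (iteratedDerivWithin 1 f I01) (iteratedDerivWithin 2 f I01) where
  hasDeriv₁ := fun x hx => by
    have := hasDerivWithinAt_iterated (by omega : 0 < k) hf hx
    rwa [iteratedDerivWithin_zero] at this
  hasDeriv₂ := fun x hx => hasDerivWithinAt_iterated (by omega : 1 < k) hf hx
  le₀ := fun x hx => by simpa using hM 0 (by omega) x hx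
  le₁ := hM 1 (by omega)
  le₂ := hM 2 (by omega)

theorem isC21_of_bound {M : ℝ} {f : ℝ → ℝ} (hf : ContDiffOn ℝ 3 f I01)
    (hM : ∀ j ≤ 3, ∀ x ∈ I01, |iteratedDerivWithin j f I01 x| ≤ M) :
    IsC21 M f (iteratedDerivWithin 1 f I01) (iteratedDerivWithin 2 f I01) where
  toIsC2 := isC2_of_bound (k := 3) (by norm_num) hf hM
  lip₂ := fun x hx y hy => (convex_Icc 0 1).norm_image_sub_le_of_norm_hasDerivWithin_le
    (fun z hz => hasDerivWithinAt_iterated (k := 3) (by norm_num : 2 < 3) hf hz)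
    (fun z hz => hM 3 le_rfl z hz) hy hx

/-- The properties of the exact solution that are used in the error analysis. -/
structure ExactFlow (α β δ M T : ℝ) (η ηt u ut : ℝ → ℝ → ℝ) : Prop where
  one_le : 1 ≤ M
  hα : |α| ≤ 2
  hβ : |β| ≤ 2
  hδ : |δ| ≤ 2
  T_pos : 0 < T
  c21_η : ∀ t ∈ Icc 0 T, ∃ w₁ w₂, IsC21 M (η t) w₁ w₂
  c21_u : ∀ t ∈ Icc 0 T, ∃ w₁ w₂, IsC21 M (u t) w₁ w₂
  c2_ηt : ∀ t ∈ Icc 0 T, ∃ w₁ w₂, IsC2 M (ηt t) w₁ w₂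
  c2_ut : ∀ t ∈ Icc 0 T, ∃ w₁ w₂, IsC2 M (ut t) w₁ w₂
  weak : ∀ t ∈ Icc 0 T, ExactWeak α β δ (η t) (u t) (ηt t) (ut t)
  timeDeriv_η : HasTimeDeriv T η ηt
  timeDeriv_u : HasTimeDeriv T u ut

theorem IsIBVPSolution.exists_exactFlow {α β δ T : ℝ} (hT : 0 < T) (hα : |α| ≤ 2) (hβ : |β| ≤ 2)
    (hδ : |δ| ≤ 2) {η₀ u₀ : ℝ → ℝ} {η ηt u ut : ℝ → ℝ → ℝ} (hreg : IsSmooth T η ηt u ut)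
    (hsol : IsIBVPSolution α β δ T η₀ u₀ η ηt u ut) : ∃ M, ExactFlow α β δ M T η ηt u ut := by
  obtain ⟨M₁, h₁, hM₁⟩ := hreg.η_mem.exists_bound
  obtain ⟨M₂, h₂, hM₂⟩ := hreg.ηt_mem.exists_bound
  obtain ⟨M₃, h₃, hM₃⟩ := hreg.u_mem.1.exists_bound
  obtain ⟨M₄, h₄, hM₄⟩ := hreg.ut_mem.1.exists_bound
  set M := 1 + M₁ + M₂ + M₃ + M₄ with hM
  have a1 : ∀ t ∈ Icc 0 T, IsC21 M (η t) (iteratedDerivWithin 1 (η t) I01)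
      (iteratedDerivWithin 2 (η t) I01) := fun t ht =>
    isC21_of_bound (hreg.η_mem.1 t ht)
      fun j hj x hx => (hM₁ t ht j hj x hx).trans (by linarith)
  have a2 : ∀ t ∈ Icc 0 T, IsC2 M (ηt t) (iteratedDerivWithin 1 (ηt t) I01)
      (iteratedDerivWithin 2 (ηt t) I01) := fun t ht =>
    isC2_of_bound (k := 2) le_rfl (hreg.ηt_mem.1 t ht)
      fun j hj x hx => (hM₂ t ht j hj x hx).trans (by linarith)
  have a3 : ∀ t ∈ Icc 0 T, IsC21 M (u t) (iteratedDerivWithin 1 (u t) I01)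
      (iteratedDerivWithin 2 (u t) I01) := fun t ht =>
    isC21_of_bound (hreg.u_mem.1.1 t ht)
      fun j hj x hx => (hM₃ t ht j hj x hx).trans (by linarith)
  have a4 : ∀ t ∈ Icc 0 T, IsC2 M (ut t) (iteratedDerivWithin 1 (ut t) I01)
      (iteratedDerivWithin 2 (ut t) I01) := fun t ht =>
    isC2_of_bound (k := 3) (by norm_num) (hreg.ut_mem.1.1 t ht)
      fun j hj x hx => (hM₄ t ht j hj x hx).trans (by linarith)
  exact ⟨M,
    { one_le := by linarith
      hα := hα
      hβ := hβ
      hδ := hδ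
      T_pos := hT
      c21_η := fun t ht => ⟨_, _, a1 t ht⟩
      c21_u := fun t ht => ⟨_, _, a3 t ht⟩
      c2_ηt := fun t ht => ⟨_, _, a2 t ht⟩
      c2_ut := fun t ht => ⟨_, _, a4 t ht⟩
      weak := fun t ht => exactWeak (a1 t ht).lip (a3 t ht).lip (a2 t ht).lip (a4 t ht)
        (hreg.u_mem.2 t ht).1 (hreg.u_mem.2 t ht).2 (hreg.ut_mem.2 t ht).1
        (hreg.ut_mem.2 t ht).2 (hsol.mass t ht) (hsol.momentum t ht)
      timeDeriv_η := hsol.timeDeriv_η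
      timeDeriv_u := hsol.timeDeriv_u }⟩

/-! ### Time derivatives of quadratic functionals of nodal values -/

theorem ip_sum_sum {n : ℕ} {B : ℕ → ℝ → ℝ} (hB : ∀ i, Bdd (B i)) (c e : ℕ → ℝ) :
    ip (fun x => ∑ i ∈ Finset.range n, c i * B i x) (fun x => ∑ i ∈ Finset.range n, e i * B i x) =
      ∑ i ∈ Finset.range n, ∑ j ∈ Finset.range n, c i * e j * ip (B i) (B j) := by
  have h : ∀ (c : ℕ → ℝ) (i : ℕ), Bdd (fun x => c i * B i x) := fun c i => (Bdd.const _).mul (hB i)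
  rw [ip_sum_left _ (fun i _ => h c i) (Bdd.sum _ fun i _ => h e i)]
  refine Finset.sum_congr rfl fun i _ => ?_
  rw [ip_sum_right _ (fun j _ => h e j) (h c i)]
  refine Finset.sum_congr rfl fun j _ => ?_
  rw [ip_const_mul_left, ip_const_mul_right]
  ring

/-- Time enters only through finitely many coefficients, so the product is a quadratic form in them
and nothing is differentiated under the integral. -/
theorem hasDerivWithinAt_ip_sum {n : ℕ} {B : ℕ → ℝ → ℝ} (hB : ∀ i, Bdd (B i)) {c : ℝ → ℕ → ℝ}
    {c' : ℕ → ℝ} {S : Set ℝ} {t : ℝ}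
    (hc : ∀ i < n, HasDerivWithinAt (fun s => c s i) (c' i) S t) :
    HasDerivWithinAt (fun s => ip (fun x => ∑ i ∈ Finset.range n, c s i * B i x)
      (fun x => ∑ i ∈ Finset.range n, c s i * B i x))
      (2 * ip (fun x => ∑ i ∈ Finset.range n, c' i * B i x)
        (fun x => ∑ i ∈ Finset.range n, c t i * B i x)) S t := by
  simp only [ip_sum_sum hB]
  have h : HasDerivWithinAt (fun s => ∑ i ∈ Finset.range n, ∑ j ∈ Finset.range n,
      c s i * c s j * ip (B i) (B j)) (∑ i ∈ Finset.range n, ∑ j ∈ Finset.range n,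
      (c' i * c t j + c t i * c' j) * ip (B i) (B j)) S t := by
    refine HasDerivWithinAt.fun_sum fun i hi => HasDerivWithinAt.fun_sum fun j hj => ?_
    exact ((hc i (Finset.mem_range.1 hi)).mul (hc j (Finset.mem_range.1 hj))).mul_const _
  refine h.congr_deriv ?_
  simp only [add_mul, Finset.sum_add_distrib]
  rw [two_mul]
  congr 1
  rw [Finset.sum_comm]
  refine Finset.sum_congr rfl fun i _ => Finset.sum_congr rfl fun j _ => ?_
  rw [ip_comm (B j)]
  ring

theorem dx_pl_ae (N : ℕ) (c : ℕ → ℝ) :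
    dx (pl N c) =ᵐ[vol01] fun x => ∑ i ∈ Finset.range (N + 1), c i * dx (hat N i) x := by
  have h := dx_sum_ae (Finset.range (N + 1)) (f := fun i x => c i * hat N i x)
    fun i _ => by fun_prop
  have h2 : ∀ᵐ x ∂vol01, ∀ i ∈ Finset.range (N + 1),
      dx (fun x => c i * hat N i x) x = c i * dx (hat N i) x :=
    (Finset.eventually_all _).2 fun i _ => dx_const_mul_ae (c i) (lip01_hat N i)
  filter_upwards [h, h2] with x hx hx2
  change dx (fun x => ∑ i ∈ Finset.range (N + 1), c i * hat N i x) x = _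
  rw [hx]
  exact Finset.sum_congr rfl hx2

theorem prim_pl (N : ℕ) (c : ℕ → ℝ) {x : ℝ} (hx : x ∈ I01) :
    prim (pl N c) x = ∑ i ∈ Finset.range (N + 1), c i * prim (hat N i) x := by
  unfold prim pl
  rw [intervalIntegral.integral_finsetSum fun i _ =>
    Bdd.intervalIntegrable (by fun_prop) zero_mem_I01 hx]
  simp only [intervalIntegral.integral_const_mul]

section timeDeriv

variable {N : ℕ} {c : ℝ → ℕ → ℝ} {c' : ℕ → ℝ} {S : Set ℝ} {t : ℝ}
  (hc : ∀ i ≤ N, HasDerivWithinAt (fun s => c s i) (c' i) S t)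
include hc

theorem hasDerivWithinAt_ip_pl :
    HasDerivWithinAt (fun s => ip (pl N (c s)) (pl N (c s)))
      (2 * ip (pl N c') (pl N (c t))) S t :=
  hasDerivWithinAt_ip_sum (B := hat N) (fun i => by fun_prop) fun i hi => hc i (by omega)

theorem hasDerivWithinAt_ip_dx_pl :
    HasDerivWithinAt (fun s => ip (dx (pl N (c s))) (dx (pl N (c s))))
      (2 * ip (dx (pl N c')) (dx (pl N (c t)))) S t := by
  have h := hasDerivWithinAt_ip_sum (B := fun i => dx (hat N i)) (fun i => by fun_prop)
    (n := N + 1) fun i hi => hc i (by omega)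
  rw [ip_congr_ae (dx_pl_ae N c') (dx_pl_ae N (c t))]
  simp only [fun s => ip_congr_ae (dx_pl_ae N (c s)) (dx_pl_ae N (c s))]
  exact h

theorem hasDerivWithinAt_bilin_pl :
    HasDerivWithinAt (fun s => bilin (pl N (c s)) (pl N (c s)))
      (2 * bilin (pl N c') (pl N (c t))) S t := by
  refine ((hasDerivWithinAt_ip_pl hc).add
    ((hasDerivWithinAt_ip_dx_pl hc).const_mul (1 / 3))).congr_deriv ?_
  rw [bilin]
  ring

theorem hasDerivWithinAt_ip_prim_pl :
    HasDerivWithinAt (fun s => ip (prim (pl N (c s))) (prim (pl N (c s))))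
      (2 * ip (prim (pl N c')) (prim (pl N (c t)))) S t := by
  have h := hasDerivWithinAt_ip_sum (B := fun i => prim (hat N i)) (fun i => by fun_prop)
    (n := N + 1) fun i hi => hc i (by omega)
  have e : ∀ c : ℕ → ℝ, prim (pl N c) =ᵐ[vol01]
      fun x => ∑ i ∈ Finset.range (N + 1), c i * prim (hat N i) x :=
    fun c => ae_of_eqOn fun x hx => prim_pl N c hx
  rw [ip_congr_ae (e c') (e (c t))]
  simp only [fun s => ip_congr_ae (e (c s)) (e (c s))]
  exact h

theorem hasDerivWithinAt_prim_pl_one :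
    HasDerivWithinAt (fun s => prim (pl N (c s)) 1) (prim (pl N c') 1) S t := by
  simp only [prim_pl N _ one_mem_I01]
  exact HasDerivWithinAt.fun_sum fun i hi =>
    (hc i (by have := Finset.mem_range.1 hi; omega)).mul_const _

theorem hasDerivWithinAt_pl (x : ℝ) :
    HasDerivWithinAt (fun s => pl N (c s) x) (pl N c' x) S t := by
  unfold pl
  exact HasDerivWithinAt.fun_sum fun i hi =>
    (hc i (by have := Finset.mem_range.1 hi; omega)).mul_const _

end timeDeriv

/-! ### Gronwall arguments for semidiscrete solutions -/

theorem gronwall_of_le {f f' : ℝ → ℝ} {τ K ε : ℝ} (hK : 0 < K)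
    (hf : ∀ t ∈ Icc 0 τ, HasDerivWithinAt f (f' t) (Icc 0 τ) t) (h0 : f 0 = 0)
    (hle : ∀ t ∈ Icc 0 τ, f' t ≤ K * (f t + ε)) {t : ℝ} (ht : t ∈ Icc 0 τ) :
    f t ≤ ε * (Real.exp (K * t) - 1) := by
  have h := le_gronwallBound_of_liminf_deriv_right_le (f := f) (f' := f') (δ := 0) (K := K)
    (ε := K * ε) (a := 0) (b := τ) (fun t ht => (hf t ht).continuousWithinAt)
    (fun x hx r hr => ?_) h0.le (fun x hx => by
      have := hle x ⟨hx.1, hx.2.le⟩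
      linarith) t ht
  · rw [gronwallBound_of_K_ne_0 hK.ne'] at h
    refine h.trans (le_of_eq ?_)
    rw [sub_zero]
    field_simp
    ring
  · have h1 : HasDerivWithinAt f (f' x) (Ici x) x :=
      (hf x ⟨hx.1, hx.2.le⟩).mono_of_mem_nhdsWithin
        (mem_of_superset (Icc_mem_nhdsGE hx.2) (Icc_subset_Icc_left hx.1))
    simpa [slope_def_field, div_eq_inv_mul] using h1.liminf_right_slope_le hr

/-- A solution of the semidiscrete equations on `[0,τ]`, given by its nodal values. -/
structure DiscreteFlow (α β δ τ : ℝ) (N : ℕ) (c d c' d' : ℝ → ℕ → ℝ) : Prop where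
  hasDeriv_c : ∀ t ∈ Icc 0 τ, ∀ i ≤ N,
    HasDerivWithinAt (fun s => c s i) (c' t i) (Icc 0 τ) t
  hasDeriv_d : ∀ t ∈ Icc 0 τ, ∀ i ≤ N,
    HasDerivWithinAt (fun s => d s i) (d' t i) (Icc 0 τ) t
  weak : ∀ t ∈ Icc 0 τ, DiscreteWeak α β δ N (c t) (d t) (c' t) (d' t)

/-- The nodal values of `f(t)`, minus `c(t)`. -/
def nodalError (N : ℕ) (f : ℝ → ℝ → ℝ) (c : ℝ → ℕ → ℝ) (t : ℝ) (i : ℕ) : ℝ :=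
  f t (node N i) - c t i

theorem pl_eq_zero {N : ℕ} {c : ℕ → ℝ} (h : ∀ i ≤ N, c i = 0) : pl N c = fun _ => 0 := by
  funext x
  refine Finset.sum_eq_zero fun i hi => ?_
  rw [h i (by have := Finset.mem_range.1 hi; omega), zero_mul]

theorem dx_zero : dx (fun _ => 0) = fun _ => 0 := by
  funext x
  simp [dx]

theorem normL2_zero : normL2 (fun _ => 0) = 0 := by simp [normL2, ip]

theorem energy_eq_zero {N : ℕ} {a b : ℕ → ℝ} (ha : ∀ i ≤ N, a i = 0) (hb : ∀ i ≤ N, b i = 0) :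
    energy N a b = 0 := by
  rw [energy_eq, pl_eq_zero ha, pl_eq_zero hb, dx_zero, normL2_zero]
  ring

section flow

variable {α β δ M T τ : ℝ} {N : ℕ} {η ηt u ut : ℝ → ℝ → ℝ} {c d c' d' : ℝ → ℕ → ℝ}
  (hex : ExactFlow α β δ M T η ηt u ut) (hN : 2 ≤ N) (hτ : τ ≤ T)
  (hflow : DiscreteFlow α β δ τ N c d c' d')
include hex hN hτ hflow

theorem DiscreteFlow.errorEquations {t : ℝ} (ht : t ∈ Icc 0 τ) :
    ErrorEquations α β δ M N (η t) (u t) (fun x => η t x - interp N (η t) x)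
      (fun x => u t x - interp N (u t) x) (fun x => ηt t x - interp N (ηt t) x)
      (fun x => ut t x - interp N (ut t) x) (nodalError N η c t) (nodalError N u d t)
      (nodalError N ηt c' t) (nodalError N ut d' t) := by
  have ht' : t ∈ Icc 0 T := ⟨ht.1, ht.2.trans hτ⟩
  obtain ⟨_, _, h1⟩ := hex.c21_η t ht'
  obtain ⟨_, _, h2⟩ := hex.c21_u t ht'
  obtain ⟨_, _, h3⟩ := hex.c2_ηt t ht'
  obtain ⟨_, _, h4⟩ := hex.c2_ut t ht'
  exact BoussinesqGalerkin.errorEquations hN hex.one_le hex.hα hex.hβ hex.hδ h1 h2 h3 h4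
    (hex.weak t ht') (hflow.weak t ht)

theorem DiscreteFlow.hasDeriv_errors {t : ℝ} (ht : t ∈ Icc 0 τ) {i : ℕ} (hi : i ≤ N) :
    HasDerivWithinAt (fun s => nodalError N η c s i) (nodalError N ηt c' t i) (Icc 0 τ) t ∧
    HasDerivWithinAt (fun s => nodalError N u d s i) (nodalError N ut d' t i) (Icc 0 τ) t := by
  have ht' : t ∈ Icc 0 T := ⟨ht.1, ht.2.trans hτ⟩
  have hn := node_mem (by omega : 0 < N) hi
  exact ⟨((hex.timeDeriv_η t ht' _ hn).mono (Icc_subset_Icc_right hτ)).sub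
      (hflow.hasDeriv_c t ht i hi),
    ((hex.timeDeriv_u t ht' _ hn).mono (Icc_subset_Icc_right hτ)).sub
      (hflow.hasDeriv_d t ht i hi)⟩

theorem DiscreteFlow.hasDeriv_energy {t : ℝ} (ht : t ∈ Icc 0 τ) :
    HasDerivWithinAt (fun s => energy N (nodalError N η c s) (nodalError N u d s))
      (2 * (ip (pl N (nodalError N ηt c' t)) (pl N (nodalError N η c t)) +
        bilin (pl N (nodalError N ut d' t)) (pl N (nodalError N u d t)))) (Icc 0 τ) t := by
  have h1 := hasDerivWithinAt_ip_pl
    fun i hi => (hflow.hasDeriv_errors hex hN hτ ht (i := i) hi).1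
  have h2 := hasDerivWithinAt_bilin_pl
    fun i hi => (hflow.hasDeriv_errors hex hN hτ ht (i := i) hi).2
  simp only [energy, normL2_sq]
  refine (h1.add h2).congr_deriv ?_
  ring

variable (hc0 : ∀ i ≤ N, nodalError N η c 0 i = 0) (hd0 : ∀ i ≤ N, nodalError N u d 0 i = 0)
  (hE : ∀ t ∈ Icc 0 τ, energy N (nodalError N η c t) (nodalError N u d t) ≤ (1 / N : ℝ) ^ 2)
include hc0 hd0 hE

/-- `energy_deriv_le` bounds half of the time derivative, hence 1000 = 2 · 500. The bound depends on
T but not on τ, as the continuation argument requires. -/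
theorem DiscreteFlow.energy_le {t : ℝ} (ht : t ∈ Icc 0 τ) :
    energy N (nodalError N η c t) (nodalError N u d t) ≤
      (1 / N : ℝ) ^ 3 * Real.exp (1000 * M ^ 2 * T) := by
  have hM := hex.one_le
  have h := gronwall_of_le (K := 1000 * M ^ 2) (ε := (1 / N : ℝ) ^ 3) (by positivity)
    (fun t ht => hflow.hasDeriv_energy hex hN hτ ht) (energy_eq_zero hc0 hd0)
    (fun t ht => by
      have := (hflow.errorEquations hex hN hτ ht).energy_deriv_le (hE t ht)
      linarith) ht
  refine h.trans (mul_le_mul_of_nonneg_left ?_ (by positivity))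
  have : Real.exp (1000 * M ^ 2 * t) ≤ Real.exp (1000 * M ^ 2 * T) :=
    Real.exp_le_exp.2 (mul_le_mul_of_nonneg_left (ht.2.trans hτ) (by positivity))
  linarith

-- The energy bound of order h³ feeds the duality estimate twice: it makes θ pointwise O(h), and it
-- makes h‖θ‖ of order h².
omit hc0 hd0 in
theorem DiscreteFlow.norm_bt_le {K : ℝ} (hK : 1 ≤ K)
    (hEK : ∀ t ∈ Icc 0 τ, energy N (nodalError N η c t) (nodalError N u d t) ≤ (1 / N : ℝ) ^ 3 * K)
    {t : ℝ} (ht : t ∈ Icc 0 τ) :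
    normL2 (pl N (nodalError N ut d' t)) ≤ 4500 * M ^ 2 * K ^ 2 *
      (normL2 (prim (pl N (nodalError N η c t))) + |prim (pl N (nodalError N η c t)) 1| +
        normL2 (pl N (nodalError N u d t)) + (1 / N) ^ 2) := by
  have H := hflow.errorEquations hex hN hτ ht
  have hh := H.h_pos
  have hNh := H.N_mul_h
  have hM := hex.one_le
  have hE3 := hEK t ht
  have hE2 := hE t ht
  rw [energy_eq] at hE3
  have p1 := sq_nonneg (normL2 (pl N (nodalError N u d t)))
  have p2 := sq_nonneg (normL2 (dx (pl N (nodalError N u d t))))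
  have hτ2 : normL2 (pl N (nodalError N η c t)) ^ 2 ≤ (1 / N : ℝ) ^ 3 * K := by linarith
  -- The inverse inequality gives θ² ≤ 6N · K h³ = 6K h² ≤ (3K h)².
  have hL : ∀ x ∈ I01, |pl N (nodalError N η c t) x| ≤ 3 * K * (1 / N) := by
    intro x hx
    apply abs_le_of_sq_le_sq _ (by positivity)
    refine (pl_sq_le H.N_pos _ hx).trans ?_
    have e1 : 6 * N * normL2 (pl N (nodalError N η c t)) ^ 2 ≤
        6 * N * ((1 / N : ℝ) ^ 3 * K) := mul_le_mul_of_nonneg_left hτ2 (by positivity)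
    have e2 : 6 * N * ((1 / N : ℝ) ^ 3 * K) = (N * (1 / N)) * (6 * (1 / N) ^ 2 * K) := by ring
    rw [e2, hNh, one_mul] at e1
    have e3 : (1 / N : ℝ) ^ 2 * K ≤ (1 / N) ^ 2 * K ^ 2 :=
      mul_le_mul_of_nonneg_left (by nlinarith) (by positivity)
    have e4 : 0 ≤ (1 / N : ℝ) ^ 2 * K ^ 2 := by positivity
    nlinarith
  have key := H.norm_bt_le hE2 (L := 3 * K) (by linarith) hL
  have hτ1 : 1 / N * (normL2 (pl N (nodalError N η c t)) + (1 / N) ^ 2) ≤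
      (K + 1) * (1 / N : ℝ) ^ 2 := by
    have e1 : normL2 (pl N (nodalError N η c t)) ≤ K * (1 / N) := by
      apply (abs_le_of_sq_le_sq' _ (by positivity)).2
      refine hτ2.trans ?_
      have e3 : (1 / N : ℝ) ^ 3 ≤ (1 / N) ^ 2 := by
        have := H.h_le_half
        nlinarith [sq_nonneg (1 / N : ℝ)]
      calc (1 / N : ℝ) ^ 3 * K ≤ (1 / N) ^ 2 * K ^ 2 :=
            mul_le_mul e3 (by nlinarith) (by linarith) (by positivity)
        _ = _ := by ring
    have e2 : (1 / N : ℝ) ^ 2 ≤ 1 / N := by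
      have := H.h_le_half
      nlinarith
    calc _ ≤ 1 / N * (K * (1 / N) + 1 / N) :=
          mul_le_mul_of_nonneg_left (add_le_add e1 e2) hh.le
      _ = _ := by ring
  refine key.trans ?_
  have q1 := normL2_nonneg (prim (pl N (nodalError N η c t)))
  have q2 := abs_nonneg (prim (pl N (nodalError N η c t)) 1)
  have q3 := normL2_nonneg (pl N (nodalError N u d t))
  have q4 := sq_nonneg (1 / N : ℝ)
  generalize normL2 (prim (pl N (nodalError N η c t))) = A at *
  generalize |prim (pl N (nodalError N η c t)) 1| = B at *
  generalize normL2 (pl N (nodalError N u d t)) = C at *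
  generalize (1 / N : ℝ) ^ 2 = s at *
  calc _ ≤ 500 * M ^ 2 * (3 * K) * (A + B + C + s + (K + 1) * s) := by gcongr
    _ ≤ 500 * M ^ 2 * (3 * K) * (3 * K * (A + B + C + s)) := by
        refine mul_le_mul_of_nonneg_left ?_ (by positivity)
        nlinarith [mul_nonneg (sub_nonneg.2 hK) (by positivity : 0 ≤ A + B + C),
          mul_nonneg (sub_nonneg.2 hK) q4]
    _ = _ := by ring

/-- The estimate in the weaker norms. -/
theorem DiscreteFlow.weak_energy_le {K : ℝ} (hK : 1 ≤ K)
    (hEK : ∀ t ∈ Icc 0 τ, energy N (nodalError N η c t) (nodalError N u d t) ≤ (1 / N : ℝ) ^ 3 * K)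
    {t : ℝ} (ht : t ∈ Icc 0 τ) :
    normL2 (prim (pl N (nodalError N η c t))) ^ 2 + prim (pl N (nodalError N η c t)) 1 ^ 2 +
      normL2 (pl N (nodalError N u d t)) ^ 2 ≤
      (1 / N : ℝ) ^ 4 * Real.exp (40000 * M ^ 2 * K ^ 2 * T) := by
  have hM := hex.one_le
  have hderiv : ∀ t ∈ Icc 0 τ, HasDerivWithinAt (fun t =>
      normL2 (prim (pl N (nodalError N η c t))) ^ 2 + prim (pl N (nodalError N η c t)) 1 ^ 2 +
      normL2 (pl N (nodalError N u d t)) ^ 2)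
      (2 * ip (prim (pl N (nodalError N ηt c' t))) (prim (pl N (nodalError N η c t))) +
        2 * (prim (pl N (nodalError N η c t)) 1 * prim (pl N (nodalError N ηt c' t)) 1) +
        2 * ip (pl N (nodalError N ut d' t)) (pl N (nodalError N u d t))) (Icc 0 τ) t := by
    intro t ht
    have h1 := hasDerivWithinAt_ip_prim_pl
      fun i hi => (hflow.hasDeriv_errors hex hN hτ ht (i := i) hi).1
    have h2 := hasDerivWithinAt_prim_pl_one
      fun i hi => (hflow.hasDeriv_errors hex hN hτ ht (i := i) hi).1
    have h3 := hasDerivWithinAt_ip_pl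
      fun i hi => (hflow.hasDeriv_errors hex hN hτ ht (i := i) hi).2
    simp only [normL2_sq]
    refine ((h1.add (h2.pow 2)).add h3).congr_deriv ?_
    norm_num
    ring
  have h := gronwall_of_le (K := 40000 * M ^ 2 * K ^ 2) (ε := (1 / N : ℝ) ^ 4) (by positivity)
    hderiv ?_ ?_ ht
  · refine h.trans (mul_le_mul_of_nonneg_left ?_ (by positivity))
    have : Real.exp (40000 * M ^ 2 * K ^ 2 * t) ≤ Real.exp (40000 * M ^ 2 * K ^ 2 * T) :=
      Real.exp_le_exp.2 (mul_le_mul_of_nonneg_left (ht.2.trans hτ) (by positivity))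
    linarith
  · have e : prim (fun _ => 0) = fun _ => 0 := by funext x; simp [prim]
    simp only [pl_eq_zero hc0, pl_eq_zero hd0, e, normL2_zero]
    norm_num
  · intro t ht
    have H := hflow.errorEquations hex hN hτ ht
    have hh := H.h_pos
    have k1 := H.negative_norm_deriv_le (hE t ht)
    rw [← ip_prim_prim (lip01_pl _ _) (lip01_pl _ _)] at k1
    have k2 := H.abs_ip_one_le
    rw [← prim_one] at k2
    -- The growth of ‖ξ‖² is 2(ξ_t, ξ), with ξ_t bounded by duality. Testing the momentum equation
    -- with ξ would bring in ‖ξ'‖, which is not part of the weak energy.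
    have k3 := hflow.norm_bt_le hex hN hτ hE hK hEK ht
    have k4 := abs_ip_le_of_le (lip01_pl N (nodalError N ut d' t)).bdd
      (lip01_pl N (nodalError N u d t)).bdd k3 le_rfl
    have hE3 := hEK t ht
    rw [energy_eq] at hE3
    have q1 := normL2_nonneg (prim (pl N (nodalError N η c t)))
    have q2 := abs_nonneg (prim (pl N (nodalError N η c t)) 1)
    have q3 := normL2_nonneg (pl N (nodalError N u d t))
    have q4 := sq_nonneg (1 / N : ℝ)
    have q5 := sq_nonneg (normL2 (dx (pl N (nodalError N u d t))))
    have k5 := (le_abs_self _).trans (abs_mul_le_of_le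
      (le_refl |prim (pl N (nodalError N η c t)) 1|) k2)
    have k6 := (le_abs_self _).trans k4
    rw [← sq_abs (prim (pl N (nodalError N η c t)) 1)]
    -- The first-level bound enters here: ‖θ‖² and ‖ξ‖² are at most K h³, and the extra factor h
    -- brings the source to order h⁴.
    have hD : 1 / N * (normL2 (pl N (nodalError N η c t)) + normL2 (pl N (nodalError N u d t)) +
        (1 / N : ℝ) ^ 2) ^ 2 ≤ 6 * K * (1 / N) ^ 4 := by
      have e1 : (normL2 (pl N (nodalError N η c t)) + normL2 (pl N (nodalError N u d t)) +
          (1 / N : ℝ) ^ 2) ^ 2 ≤ 3 * (normL2 (pl N (nodalError N η c t)) ^ 2 +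
          normL2 (pl N (nodalError N u d t)) ^ 2 + ((1 / N : ℝ) ^ 2) ^ 2) := by
        generalize normL2 (pl N (nodalError N η c t)) = a
        generalize normL2 (pl N (nodalError N u d t)) = b
        generalize (1 / N : ℝ) ^ 2 = s
        nlinarith [sq_nonneg (a - b), sq_nonneg (a - s), sq_nonneg (b - s)]
      have e2 : ((1 / N : ℝ) ^ 2) ^ 2 ≤ (1 / N) ^ 3 * K := by
        have : (1 / N : ℝ) ≤ K := by linarith [H.h_le_half]
        calc ((1 / N : ℝ) ^ 2) ^ 2 = (1 / N) ^ 3 * (1 / N) := by ring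
          _ ≤ _ := mul_le_mul_of_nonneg_left this (by positivity)
      calc _ ≤ 1 / N * (6 * ((1 / N : ℝ) ^ 3 * K)) := by
            refine mul_le_mul_of_nonneg_left (e1.trans ?_) hh.le
            linarith
        _ = _ := by ring
    have hs4 : (1 / N : ℝ) ^ 4 = ((1 / N : ℝ) ^ 2) ^ 2 := by ring
    rw [hs4] at hD k1 ⊢
    clear hs4 hE3 k4 k3 k2 hderiv q5
    generalize 1 / N * (normL2 (pl N (nodalError N η c t)) + normL2 (pl N (nodalError N u d t)) +
        (1 / N : ℝ) ^ 2) ^ 2 = W at *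
    generalize normL2 (prim (pl N (nodalError N η c t))) = A at *
    generalize |prim (pl N (nodalError N η c t)) 1| = B at *
    generalize normL2 (pl N (nodalError N u d t)) = C at *
    generalize (1 / N : ℝ) ^ 2 = s at *
    have hMK : M ^ 2 * K ≤ M ^ 2 * K ^ 2 := mul_le_mul_of_nonneg_left (by nlinarith) (sq_nonneg M)
    have hMK1 : M ≤ M ^ 2 * K ^ 2 := by nlinarith [sq_nonneg M]
    have hMK2 : M ^ 2 ≤ M ^ 2 * K ^ 2 := by nlinarith [sq_nonneg M]
    have g1 : 200 * M ^ 2 * (A ^ 2 + C ^ 2 + s ^ 2 + W) ≤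
        M ^ 2 * K ^ 2 * (200 * (A ^ 2 + C ^ 2) + 1400 * s ^ 2) := by
      have w1 := mul_le_mul_of_nonneg_left hD (sq_nonneg M)
      have w2 := mul_le_mul_of_nonneg_right hMK (sq_nonneg s)
      have w3 := mul_le_mul_of_nonneg_right hMK2 (by positivity : 0 ≤ A ^ 2 + C ^ 2 + s ^ 2)
      linarith
    have g2 : B * (M * s) ≤ M ^ 2 * K ^ 2 * (B ^ 2 + s ^ 2) := by
      have w1 : B * s ≤ B ^ 2 + s ^ 2 := by nlinarith [sq_nonneg (B - s)]
      have w2 := mul_le_mul hMK1 w1 (by positivity) (by positivity)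
      linarith
    have g3 : 4500 * M ^ 2 * K ^ 2 * (A + B + C + s) * C ≤
        M ^ 2 * K ^ 2 * (4500 * (1 / 2 * (A ^ 2 + B ^ 2 + s ^ 2) + 5 / 2 * C ^ 2)) := by
      have w1 : (A + B + C + s) * C ≤ 1 / 2 * (A ^ 2 + B ^ 2 + s ^ 2) + 5 / 2 * C ^ 2 := by
        nlinarith [sq_nonneg (A - C), sq_nonneg (B - C), sq_nonneg (s - C)]
      have w2 := mul_le_mul_of_nonneg_left w1 (by positivity : 0 ≤ 4500 * M ^ 2 * K ^ 2)
      linarith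
    have P : 0 ≤ M ^ 2 * K ^ 2 := by positivity
    have z1 := mul_nonneg P (sq_nonneg A)
    have z2 := mul_nonneg P (sq_nonneg B)
    have z3 := mul_nonneg P (sq_nonneg C)
    have z4 := mul_nonneg P (sq_nonneg s)
    linarith

end flow

/-! ### Ordinary differential equations with an a priori bound -/

section ODE

variable {E : Type*} [NormedAddCommGroup E] [NormedSpace ℝ E] [FiniteDimensional ℝ E]

/-- A compactly supported `C¹` vector field has global integral curves. -/
theorem exists_integralCurve_of_hasCompactSupport {F : E → E} (hF : ContDiff ℝ 1 F)
    (hs : HasCompactSupport F) {T : ℝ} (hT : 0 ≤ T) (y₀ : E) :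
    ∃ y : ℝ → E, y 0 = y₀ ∧ ∀ t ∈ Icc 0 T, HasDerivWithinAt y (F (y t)) (Icc 0 T) t := by
  obtain ⟨K, hK⟩ := hF.lipschitzWith_of_hasCompactSupport hs one_ne_zero
  obtain ⟨B, hB⟩ := hs.exists_bound_of_continuous hF.continuous
  have hPL : IsPicardLindelof (fun _ : ℝ => F) (⟨0, le_rfl, hT⟩ : Icc 0 T) y₀
      (B.toNNReal * T.toNNReal) 0 B.toNNReal K :=
    { lipschitzOnWith := fun _ _ => hK.lipschitzOnWith
      continuousOn := fun _ _ => continuousOn_const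
      norm_le := fun _ _ x _ => (hB x).trans (Real.le_coe_toNNReal B)
      mul_max_le := by simp [hT] }
  exact hPL.exists_eq_forall_mem_Icc_hasDerivWithinAt₀

/-- A solution of `y' = F(y)` exists on `[0,T]` if an a priori estimate keeps solutions inside
a bounded sublevel set of `G`. -/
theorem exists_integralCurve_of_apriori {F : E → E} (hF : ContDiff ℝ 1 F) {T : ℝ} (hT : 0 ≤ T)
    {y₀ : E} {G : ℝ → E → ℝ} {g R : ℝ}
    (hcont : ∀ y : ℝ → E, ContinuousOn y (Icc 0 T) → ContinuousOn (fun t => G t (y t)) (Icc 0 T))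
    (hball : ∀ t ∈ Icc 0 T, ∀ y, G t y ≤ g → ‖y‖ ≤ R) (h₀ : G 0 y₀ < g)
    (hapriori : ∀ τ ∈ Icc 0 T, ∀ y : ℝ → E, y 0 = y₀ →
      (∀ t ∈ Icc 0 τ, HasDerivWithinAt y (F (y t)) (Icc 0 τ) t) →
      (∀ t ∈ Icc 0 τ, G t (y t) ≤ g) → G τ (y τ) < g) :
    ∃ y : ℝ → E, y 0 = y₀ ∧ (∀ t ∈ Icc 0 T, HasDerivWithinAt y (F (y t)) (Icc 0 T) t) ∧
      ∀ t ∈ Icc 0 T, G t (y t) ≤ g := by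
  -- The field is cut off outside the ball that contains the sublevel set, which makes solutions
  -- global; on the sublevel set it is unchanged. The absolute value keeps the radii positive for
  -- any sign of R.
  let φ : ContDiffBump (0 : E) := ⟨|R| + 1, |R| + 2, by positivity, by linarith⟩
  have hφ1 : ∀ t ∈ Icc 0 T, ∀ y, G t y ≤ g → φ y = 1 := by
    intro t ht y hy
    refine φ.one_of_mem_closedBall ?_
    rw [mem_closedBall_zero_iff]
    exact (hball t ht y hy).trans ((le_abs_self R).trans (by simp [φ]))
  obtain ⟨y, hy0, hy⟩ := exists_integralCurve_of_hasCompactSupport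
    (F := fun y => φ y • F y) (φ.contDiff.smul hF) φ.hasCompactSupport.smul_right hT y₀
  have hc : ContinuousOn (fun t => G t (y t)) (Icc 0 T) :=
    hcont y fun t ht => (hy t ht).continuousWithinAt
  have hlt : ∀ t ∈ Icc 0 T, G t (y t) < g := by
    by_contra! hcon
    have hcpt : IsCompact (Icc 0 T ∩ (fun t => G t (y t)) ⁻¹' Ici g) :=
      isCompact_Icc.of_isClosed_subset (hc.preimage_isClosed_of_isClosed isClosed_Icc isClosed_Ici)
        inter_subset_left
    -- τ is the first time at which G reaches g; up to τ the truncated and original equations agree,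
    -- and the a priori estimate is contradicted.
    obtain ⟨τ, ⟨hτ, hgτ⟩, hmin⟩ := hcpt.exists_isLeast (by
      obtain ⟨t, ht, h⟩ := hcon
      exact ⟨t, ht, h⟩)
    have hle : ∀ t ∈ Icc 0 τ, G t (y t) ≤ g := by
      intro t ht
      rcases ht.2.lt_or_eq with h | rfl
      · by_contra! hgt
        exact absurd (hmin ⟨⟨ht.1, ht.2.trans hτ.2⟩, hgt.le⟩) (not_le.2 h)
      -- At τ itself G ≥ g is known; by the intermediate value theorem the value g is attained, and
      -- by minimality not before τ.
      · obtain ⟨s, hs, hgs⟩ := intermediate_value_Icc hτ.1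
          (hc.mono (Icc_subset_Icc_right hτ.2)) ⟨by simpa only [hy0] using h₀.le, hgτ⟩
        have hst : t ≤ s := hmin ⟨⟨hs.1, hs.2.trans hτ.2⟩, hgs.ge⟩
        rw [le_antisymm hst hs.2]
        exact hgs.le
    refine absurd (hapriori τ hτ y hy0 (fun t ht => ?_) hle) (not_lt.2 hgτ)
    have ht' : t ∈ Icc 0 T := ⟨ht.1, ht.2.trans hτ.2⟩
    have h := (hy t ht').mono (Icc_subset_Icc_right hτ.2)
    rwa [hφ1 t ht' _ (hle t ht), one_smul] at h
  refine ⟨y, hy0, fun t ht => ?_, fun t ht => (hlt t ht).le⟩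
  have h := hy t ht
  rwa [hφ1 t ht _ (hlt t ht).le, one_smul] at h

omit [FiniteDimensional ℝ E] in
theorem hasDerivWithinAt_Ici_of_Icc {f : ℝ → E} {f' : E} {a b t : ℝ}
    (h : HasDerivWithinAt f f' (Icc a b) t) (ht : t ∈ Ico a b) : HasDerivWithinAt f f' (Ici t) t :=
  h.mono_of_mem_nhdsWithin
    (mem_of_superset (Icc_mem_nhdsGE ht.2) (Icc_subset_Icc_left ht.1))

/-- The field is only locally Lipschitz, but both curves stay in a common closed ball, on which it
is Lipschitz by compactness and convexity. -/
theorem integralCurve_unique {F : E → E} (hF : ContDiff ℝ 1 F) {T : ℝ} {y z : ℝ → E}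
    (hy : ∀ t ∈ Icc 0 T, HasDerivWithinAt y (F (y t)) (Icc 0 T) t)
    (hz : ∀ t ∈ Icc 0 T, HasDerivWithinAt z (F (z t)) (Icc 0 T) t) (h0 : y 0 = z 0) :
    EqOn y z (Icc 0 T) := by
  have cy : ContinuousOn y (Icc 0 T) := fun t ht => (hy t ht).continuousWithinAt
  have cz : ContinuousOn z (Icc 0 T) := fun t ht => (hz t ht).continuousWithinAt
  obtain ⟨R₁, h₁⟩ := isCompact_Icc.exists_bound_of_continuousOn cy
  obtain ⟨R₂, h₂⟩ := isCompact_Icc.exists_bound_of_continuousOn cz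
  obtain ⟨K, hK⟩ :=
    (hF.contDiffOn (s := Metric.closedBall (0 : E) (max R₁ R₂))).exists_lipschitzOnWith one_ne_zero
      (convex_closedBall _ _) (isCompact_closedBall _ _)
  refine ODE_solution_unique_of_mem_Icc_right (v := fun _ => F)
    (s := fun _ => Metric.closedBall (0 : E) (max R₁ R₂)) (fun _ _ => hK) cy
    (fun t ht => hasDerivWithinAt_Ici_of_Icc (hy t (Ico_subset_Icc_self ht)) ht) (fun t ht => ?_) cz
    (fun t ht => hasDerivWithinAt_Ici_of_Icc (hz t (Ico_subset_Icc_self ht)) ht) (fun t ht => ?_) h0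
  · exact mem_closedBall_zero_iff.2 ((h₁ t (Ico_subset_Icc_self ht)).trans (le_max_left _ _))
  · exact mem_closedBall_zero_iff.2 ((h₂ t (Ico_subset_Icc_self ht)).trans (le_max_right _ _))

end ODE

/-! ### The semidiscrete problem as a system of ordinary differential equations -/

section system

variable {N : ℕ}

/-- Extension of a finite vector of nodal values by zero. -/
def coeff (v : Fin (N + 1) → ℝ) (i : ℕ) : ℝ := if h : i < N + 1 then v ⟨i, h⟩ else 0

theorem coeff_fin (v : Fin (N + 1) → ℝ) (i : Fin (N + 1)) : coeff v i = v i := dif_pos i.2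

theorem coeff_of_le (v : Fin (N + 1) → ℝ) {i : ℕ} (hi : i ≤ N) :
    coeff v i = v ⟨i, Nat.lt_succ_of_le hi⟩ := dif_pos _

theorem coeff_restrict (e : ℕ → ℝ) {i : ℕ} (hi : i ≤ N) :
    coeff (fun j : Fin (N + 1) => e j) i = e i := coeff_of_le _ hi

theorem pl_congr {a b : ℕ → ℝ} (h : ∀ i ≤ N, a i = b i) : pl N a = pl N b := by
  funext x
  exact Finset.sum_congr rfl fun i hi => by rw [h i (by have := Finset.mem_range.1 hi; omega)]

theorem pl_coeff_restrict (e : ℕ → ℝ) : pl N (coeff fun j : Fin (N + 1) => e j) = pl N e :=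
  pl_congr fun _ hi => coeff_restrict e hi

theorem pl_coeff (v : Fin (N + 1) → ℝ) (x : ℝ) : pl N (coeff v) x = ∑ i, v i * hat N i x := by
  rw [pl, Finset.sum_range]
  simp only [coeff_fin]

theorem ip_pl_right {f : ℝ → ℝ} (hf : Bdd f) (e : ℕ → ℝ) :
    ip f (pl N e) = ∑ i ∈ Finset.range (N + 1), e i * ip f (hat N i) := by
  unfold pl
  rw [ip_sum_right _ (fun i _ => by fun_prop) hf]
  simp only [ip_const_mul_right]

theorem ip_dx_pl_right {f : ℝ → ℝ} (hf : Bdd f) (e : ℕ → ℝ) :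
    ip f (dx (pl N e)) = ∑ i ∈ Finset.range (N + 1), e i * ip f (dx (hat N i)) := by
  rw [ip_congr_ae (ae_eq_refl _) (dx_pl_ae N e), ip_sum_right _ (fun i _ => by fun_prop) hf]
  simp only [ip_const_mul_right]

theorem bilin_pl_right {f : ℝ → ℝ} (hf : Lip01 f) (e : ℕ → ℝ) :
    bilin f (pl N e) = ∑ i ∈ Finset.range (N + 1), e i * bilin f (hat N i) := by
  rw [bilin, ip_pl_right hf.bdd, ip_dx_pl_right hf.bdd_dx, Finset.mul_sum,
    ← Finset.sum_add_distrib]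
  exact Finset.sum_congr rfl fun i _ => by rw [bilin]; ring

theorem bilin_comm (f g : ℝ → ℝ) : bilin f g = bilin g f := by
  rw [bilin, bilin, ip_comm f, ip_comm (dx f)]

theorem pl_single {j : ℕ} (hj : j ≤ N) : pl N (fun i => if i = j then 1 else 0) = hat N j := by
  funext x
  simp [pl, Nat.lt_succ_of_le hj]

theorem ip_pl_coeff_left (v : Fin (N + 1) → ℝ) {g : ℝ → ℝ} (hg : Bdd g) :
    ip (pl N (coeff v)) g = ∑ i, v i * ip (hat N i) g := by
  rw [ip_comm, ip_pl_right hg, Finset.sum_range]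
  simp only [coeff_fin, ip_comm g]

theorem bilin_pl_coeff_left (v : Fin (N + 1) → ℝ) {g : ℝ → ℝ} (hg : Lip01 g) :
    bilin (pl N (coeff v)) g = ∑ i, v i * bilin (hat N i) g := by
  rw [bilin_comm, bilin_pl_right hg, Finset.sum_range]
  simp only [coeff_fin, bilin_comm g]

theorem coeff_eq_zero_of_ip (hN : 0 < N) {v : Fin (N + 1) → ℝ}
    (h : ip (pl N (coeff v)) (pl N (coeff v)) ≤ 0) : v = 0 := by
  funext i
  have h1 := coeff_sq_le hN (coeff v) (Nat.le_of_lt_succ i.2)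
  rw [normL2_sq, coeff_fin] at h1
  have h2 : (6 : ℝ) * N * ip (pl N (coeff v)) (pl N (coeff v)) ≤ 0 :=
    mul_nonpos_of_nonneg_of_nonpos (by positivity) h
  exact pow_eq_zero_iff two_ne_zero |>.1 (le_antisymm (h1.trans h2) (sq_nonneg _))

/-- The mass matrix. -/
def massMap (N : ℕ) : (Fin (N + 1) → ℝ) →ₗ[ℝ] (Fin (N + 1) → ℝ) :=
  Matrix.mulVecLin (Matrix.of fun j i : Fin (N + 1) => ip (hat N i) (hat N j))

theorem massMap_apply (v : Fin (N + 1) → ℝ) (j : Fin (N + 1)) :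
    massMap N v j = ip (pl N (coeff v)) (hat N j) := by
  rw [ip_pl_coeff_left v (by fun_prop)]
  simp [massMap, Matrix.mulVec, dotProduct, mul_comm]

theorem massMap_injective (hN : 0 < N) : Function.Injective (massMap N) := by
  rw [← LinearMap.ker_eq_bot, LinearMap.ker_eq_bot']
  intro v hv
  refine coeff_eq_zero_of_ip hN (le_of_eq ?_)
  rw [ip_pl_right (by fun_prop), Finset.sum_range]
  exact Finset.sum_eq_zero fun i _ => by rw [← massMap_apply, hv, Pi.zero_apply, mul_zero]

/-- The index belongs to a boundary node. -/
def IsEnd (j : Fin (N + 1)) : Prop := j = 0 ∨ j = Fin.last N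

instance (j : Fin (N + 1)) : Decidable (IsEnd j) := inferInstanceAs (Decidable (_ ∨ _))

/-- The matrix of the form `bilin`, with the rows of the boundary nodes replaced by those of the
identity matrix. -/
def momentumMap (N : ℕ) : (Fin (N + 1) → ℝ) →ₗ[ℝ] (Fin (N + 1) → ℝ) :=
  Matrix.mulVecLin (Matrix.of fun j i : Fin (N + 1) =>
    if IsEnd j then (if i = j then 1 else 0) else bilin (hat N i) (hat N j))

theorem momentumMap_apply (v : Fin (N + 1) → ℝ) (j : Fin (N + 1)) :
    momentumMap N v j = if IsEnd j then v j else bilin (pl N (coeff v)) (hat N j) := by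
  rw [bilin_pl_coeff_left v (by fun_prop)]
  simp only [momentumMap, Matrix.mulVecLin_apply, Matrix.mulVec, dotProduct, Matrix.of_apply]
  split_ifs
  · simp
  · simp only [mul_comm]

/-- A null vector vanishes at the end nodes and is orthogonal, with respect to the form, to the
inner hats; hence the form vanishes on it. -/
theorem momentumMap_injective (hN : 0 < N) : Function.Injective (momentumMap N) := by
  rw [← LinearMap.ker_eq_bot, LinearMap.ker_eq_bot']
  intro v hv
  have h : bilin (pl N (coeff v)) (pl N (coeff v)) = 0 := by
    rw [bilin_pl_right (by fun_prop), Finset.sum_range]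
    refine Finset.sum_eq_zero fun i _ => ?_
    have hi := congrFun hv i
    rw [momentumMap_apply, Pi.zero_apply] at hi
    split_ifs at hi with h1
    · rw [coeff_fin, hi, zero_mul]
    · rw [hi, mul_zero]
  rw [bilin] at h
  refine coeff_eq_zero_of_ip hN ?_
  linarith [ip_self_nonneg (dx (pl N (coeff v)))]

def massEquiv (hN : 0 < N) : (Fin (N + 1) → ℝ) ≃L[ℝ] (Fin (N + 1) → ℝ) :=
  (LinearEquiv.ofInjectiveEndo _ (massMap_injective hN)).toContinuousLinearEquiv

def momentumEquiv (hN : 0 < N) : (Fin (N + 1) → ℝ) ≃L[ℝ] (Fin (N + 1) → ℝ) :=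
  (LinearEquiv.ofInjectiveEndo _ (momentumMap_injective hN)).toContinuousLinearEquiv

/-- The flux of the mass equation, tested with the nodal basis. -/
def massLoad (α : ℝ) (N : ℕ) (y : (Fin (N + 1) → ℝ) × (Fin (N + 1) → ℝ)) (j : Fin (N + 1)) : ℝ :=
  ip (fun x => pl N (coeff y.2) x + α * (pl N (coeff y.1) x * pl N (coeff y.2) x)) (dx (hat N j))

/-- The flux of the momentum equation, tested with the nodal basis. -/
def momentumLoad (β δ : ℝ) (N : ℕ) (y : (Fin (N + 1) → ℝ) × (Fin (N + 1) → ℝ))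
    (j : Fin (N + 1)) : ℝ :=
  if IsEnd j then 0 else ip (fun x => pl N (coeff y.1) x + β / 2 * pl N (coeff y.2) x ^ 2 +
    δ / 2 * pl N (coeff y.1) x ^ 2) (dx (hat N j))

theorem ip_pl_mul_pl (v w : Fin (N + 1) → ℝ) {g : ℝ → ℝ} (hg : Bdd g) :
    ip (fun x => pl N (coeff v) x * pl N (coeff w) x) g =
      ∑ i, ∑ k, v i * w k * ip (fun x => hat N i x * hat N k x) g := by
  simp only [pl_coeff, Finset.sum_mul_sum]
  rw [ip_sum_left _ (fun i _ => Bdd.sum _ fun k _ => by fun_prop) hg]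
  refine Finset.sum_congr rfl fun i _ => ?_
  rw [ip_sum_left _ (fun k _ => by fun_prop) hg]
  refine Finset.sum_congr rfl fun k _ => ?_
  rw [← ip_const_mul_left]
  congr 1
  funext x
  ring

/-- The load is a quadratic polynomial in the nodal values. -/
theorem contDiff_massLoad (α : ℝ) : ContDiff ℝ 1 (massLoad α N) := by
  refine contDiff_pi.2 fun j => ?_
  have e : (fun y => massLoad α N y j) =
      fun y => ∑ i : Fin (N + 1), y.2 i * ip (hat N i) (dx (hat N j)) +
      α * ∑ i : Fin (N + 1), ∑ k : Fin (N + 1), y.1 i * y.2 k *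
        ip (fun x => hat N i x * hat N k x) (dx (hat N j)) := by
    funext y
    rw [massLoad, ip_add_left (by fun_prop) (by fun_prop) (by fun_prop), ip_const_mul_left,
      ip_pl_mul_pl _ _ (by fun_prop), ip_pl_coeff_left _ (by fun_prop)]
  rw [e]
  fun_prop

theorem contDiff_momentumLoad (β δ : ℝ) : ContDiff ℝ 1 (momentumLoad β δ N) := by
  refine contDiff_pi.2 fun j => ?_
  by_cases hj : IsEnd j
  · simp only [momentumLoad, hj, if_true]
    fun_prop
  have e : (fun y => momentumLoad β δ N y j) =
      fun y => ∑ i : Fin (N + 1), y.1 i * ip (hat N i) (dx (hat N j)) +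
      β / 2 * (∑ i : Fin (N + 1), ∑ k : Fin (N + 1), y.2 i * y.2 k *
        ip (fun x => hat N i x * hat N k x) (dx (hat N j))) +
      δ / 2 * ∑ i : Fin (N + 1), ∑ k : Fin (N + 1), y.1 i * y.1 k *
        ip (fun x => hat N i x * hat N k x) (dx (hat N j)) := by
    funext y
    rw [momentumLoad, if_neg hj, ip_add_left (by fun_prop) (by fun_prop) (by fun_prop),
      ip_add_left (by fun_prop) (by fun_prop) (by fun_prop), ip_const_mul_left, ip_const_mul_left,
      ip_pl_coeff_left _ (by fun_prop)]
    simp only [pow_two]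
    rw [ip_pl_mul_pl _ _ (by fun_prop), ip_pl_mul_pl _ _ (by fun_prop)]
  rw [e]
  fun_prop

/-- The vector field of the semidiscrete problem. -/
def galerkinField (α β δ : ℝ) (hN : 0 < N) (y : (Fin (N + 1) → ℝ) × (Fin (N + 1) → ℝ)) :
    (Fin (N + 1) → ℝ) × (Fin (N + 1) → ℝ) :=
  ((massEquiv hN).symm (massLoad α N y), (momentumEquiv hN).symm (momentumLoad β δ N y))

theorem contDiff_galerkinField (α β δ : ℝ) (hN : 0 < N) :
    ContDiff ℝ 1 (galerkinField α β δ hN) :=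
  ((massEquiv hN).symm.contDiff.comp (contDiff_massLoad α)).prodMk
    ((momentumEquiv hN).symm.contDiff.comp (contDiff_momentumLoad β δ))

theorem eq_galerkinField_iff {α β δ : ℝ} (hN : 0 < N)
    {y y' : (Fin (N + 1) → ℝ) × (Fin (N + 1) → ℝ)} :
    y' = galerkinField α β δ hN y ↔
      massMap N y'.1 = massLoad α N y ∧ momentumMap N y'.2 = momentumLoad β δ N y := by
  rw [Prod.ext_iff, galerkinField, ContinuousLinearEquiv.eq_symm_apply,
    ContinuousLinearEquiv.eq_symm_apply]
  rfl

/-- Identity rows with zero load freeze the boundary values of u_h, so the boundary condition is an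
invariant of a system posed on all nodal values. -/
theorem galerkinField_end {α β δ : ℝ} (hN : 0 < N)
    (y : (Fin (N + 1) → ℝ) × (Fin (N + 1) → ℝ)) {j : Fin (N + 1)} (hj : IsEnd j) :
    (galerkinField α β δ hN y).2 j = 0 := by
  have h := congrFun ((eq_galerkinField_iff (α := α) (β := β) (δ := δ) hN (y := y)).1 rfl).2 j
  rwa [momentumMap_apply, momentumLoad, if_pos hj, if_pos hj] at h

theorem isEnd_zero : IsEnd (0 : Fin (N + 1)) := Or.inl rfl
theorem isEnd_last : IsEnd (Fin.last N) := Or.inr rfl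

theorem coeff_zero (v : Fin (N + 1) → ℝ) : coeff v 0 = v 0 := coeff_fin v 0

theorem coeff_last (v : Fin (N + 1) → ℝ) : coeff v N = v (Fin.last N) := coeff_fin v (Fin.last N)

theorem discreteWeak_of_galerkinField {α β δ : ℝ} (hN : 0 < N)
    {y : (Fin (N + 1) → ℝ) × (Fin (N + 1) → ℝ)} (h0 : y.2 0 = 0) (h1 : y.2 (Fin.last N) = 0) :
    DiscreteWeak α β δ N (coeff y.1) (coeff y.2) (coeff (galerkinField α β δ hN y).1)
      (coeff (galerkinField α β δ hN y).2) := by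
  obtain ⟨e1, e2⟩ := (eq_galerkinField_iff (α := α) (β := β) (δ := δ) hN (y := y)).1 rfl
  refine
    { d_zero := by rw [coeff_zero, h0]
      d_last := by rw [coeff_last, h1]
      dt_zero := by rw [coeff_zero, galerkinField_end hN y isEnd_zero]
      dt_last := by rw [coeff_last, galerkinField_end hN y isEnd_last]
      mass := fun e => ?_
      momentum := fun e he0 he1 => ?_ }
  · rw [ip_pl_right (by fun_prop), ip_dx_pl_right (by fun_prop), Finset.sum_range, Finset.sum_range]
    refine Finset.sum_congr rfl fun i _ => ?_
    rw [← massMap_apply, e1, massLoad]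
  · rw [bilin_pl_right (by fun_prop), ip_dx_pl_right (by fun_prop), Finset.sum_range,
      Finset.sum_range]
    refine Finset.sum_congr rfl fun i _ => ?_
    by_cases hi : IsEnd i
    · have : e i = 0 := by rcases hi with rfl | rfl <;> simpa
      rw [this, zero_mul, zero_mul]
    · have h := congrFun e2 i
      rw [momentumMap_apply, momentumLoad, if_neg hi, if_neg hi] at h
      rw [h]

theorem DiscreteWeak.eq_galerkinField {α β δ : ℝ} (hN : 0 < N) {c d c' d' : ℕ → ℝ}
    (h : DiscreteWeak α β δ N c d c' d') :
    ((fun i : Fin (N + 1) => c' i, fun i : Fin (N + 1) => d' i) :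
        (Fin (N + 1) → ℝ) × (Fin (N + 1) → ℝ)) =
      galerkinField α β δ hN (fun i => c i, fun i => d i) := by
  rw [eq_galerkinField_iff]
  constructor
  · funext j
    have := h.mass fun i => if i = j then 1 else 0
    rw [pl_single (Nat.le_of_lt_succ j.2)] at this
    rw [massMap_apply, massLoad, pl_coeff_restrict, pl_coeff_restrict, pl_coeff_restrict, this]
  · funext j
    rw [momentumMap_apply, momentumLoad]
    by_cases hj : IsEnd j
    · rw [if_pos hj, if_pos hj]
      rcases hj with rfl | rfl
      · exact h.dt_zero
      · exact h.dt_last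
    · have hj0 : (j : ℕ) ≠ 0 := fun e => hj (Or.inl (Fin.ext e))
      have hj1 : (j : ℕ) ≠ N := fun e => hj (Or.inr (Fin.ext e))
      have := h.momentum (fun i => if i = j then 1 else 0) (if_neg hj0.symm) (if_neg hj1.symm)
      rw [pl_single (Nat.le_of_lt_succ j.2)] at this
      rw [if_neg hj, if_neg hj, pl_coeff_restrict, pl_coeff_restrict, pl_coeff_restrict, this]

end system

/-! ### Unique solvability of the semidiscrete problem -/

section solvability

variable {α β δ T : ℝ} {N : ℕ}

theorem discreteFlow_of_integralCurve (hN : 0 < N) {τ : ℝ}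
    {y : ℝ → (Fin (N + 1) → ℝ) × (Fin (N + 1) → ℝ)}
    (hy : ∀ t ∈ Icc 0 τ, HasDerivWithinAt y (galerkinField α β δ hN (y t)) (Icc 0 τ) t)
    (h0 : ∀ j, IsEnd j → (y 0).2 j = 0) :
    DiscreteFlow α β δ τ N (fun t => coeff (y t).1) (fun t => coeff (y t).2)
      (fun t => coeff (galerkinField α β δ hN (y t)).1)
      (fun t => coeff (galerkinField α β δ hN (y t)).2) := by
  have h1 : ∀ t ∈ Icc 0 τ, ∀ j, HasDerivWithinAt (fun s => (y s).1 j)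
      ((galerkinField α β δ hN (y t)).1 j) (Icc 0 τ) t := fun t ht =>
    hasDerivWithinAt_pi.1 (hasFDerivAt_fst (𝕜 := ℝ) (p := y t) |>.comp_hasDerivWithinAt t (hy t ht))
  have h2 : ∀ t ∈ Icc 0 τ, ∀ j, HasDerivWithinAt (fun s => (y s).2 j)
      ((galerkinField α β δ hN (y t)).2 j) (Icc 0 τ) t := fun t ht =>
    hasDerivWithinAt_pi.1 (hasFDerivAt_snd (𝕜 := ℝ) (p := y t) |>.comp_hasDerivWithinAt t (hy t ht))
  have hend : ∀ j, IsEnd j → ∀ t ∈ Icc 0 τ, (y t).2 j = 0 := by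
    intro j hj t ht
    refine (constant_of_has_deriv_right_zero (f := fun s => (y s).2 j)
      (fun t ht => (h2 t ht j).continuousWithinAt) (fun t ht => ?_) t ht).trans (h0 j hj)
    have := hasDerivWithinAt_Ici_of_Icc (h2 t (Ico_subset_Icc_self ht) j) ht
    rwa [galerkinField_end hN _ hj] at this
  refine ⟨fun t ht i hi => ?_, fun t ht i hi => ?_, fun t ht => ?_⟩
  · simp only [coeff_of_le _ hi]
    exact h1 t ht _
  · simp only [coeff_of_le _ hi]
    exact h2 t ht _
  · exact discreteWeak_of_galerkinField hN (hend _ isEnd_zero t ht) (hend _ isEnd_last t ht)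

theorem DiscreteFlow.integralCurve (hN : 0 < N) {c d c' d' : ℝ → ℕ → ℝ}
    (h : DiscreteFlow α β δ T N c d c' d') {t : ℝ} (ht : t ∈ Icc 0 T) :
    HasDerivWithinAt (fun s => ((fun i : Fin (N + 1) => c s i, fun i : Fin (N + 1) => d s i) :
        (Fin (N + 1) → ℝ) × (Fin (N + 1) → ℝ)))
      (galerkinField α β δ hN (fun i => c t i, fun i => d t i)) (Icc 0 T) t := by
  rw [← (h.weak t ht).eq_galerkinField hN]
  exact (hasDerivWithinAt_pi.2 fun i : Fin (N + 1) =>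
      h.hasDeriv_c t ht i.1 (Nat.le_of_lt_succ i.2)).prodMk
    (hasDerivWithinAt_pi.2 fun i : Fin (N + 1) => h.hasDeriv_d t ht i.1 (Nat.le_of_lt_succ i.2))

theorem DiscreteFlow.isGalerkinSolution (hN : 0 < N) (hT : 0 ≤ T) {c d c' d' : ℝ → ℕ → ℝ}
    (h : DiscreteFlow α β δ T N c d c' d') {η₀ u₀ : ℝ → ℝ}
    (hc : ∀ i ≤ N, c 0 i = η₀ (node N i)) (hd : ∀ i ≤ N, d 0 i = u₀ (node N i)) :
    IsGalerkinSolution α β δ T N η₀ u₀ (fun t => pl N (c t)) (fun t => pl N (c' t))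
      (fun t => pl N (d t)) (fun t => pl N (d' t)) := by
  have hmem : ∀ t ∈ Icc 0 T, InSh0 N (pl N (d t)) := fun t ht =>
    ⟨inSh_pl hN _, by rw [pl_zero hN, (h.weak t ht).d_zero],
      by rw [pl_one hN, (h.weak t ht).d_last]⟩
  refine
    { mem_η := fun t _ => inSh_pl hN _
      mem_u := hmem
      timeDeriv_η := fun t ht x _ => hasDerivWithinAt_pl (h.hasDeriv_c t ht) x
      timeDeriv_u := fun t ht x _ => hasDerivWithinAt_pl (h.hasDeriv_d t ht) x
      mass := fun t ht φ hφ => ?_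
      momentum := fun t ht χ hχ => ?_
      initial_η := ⟨inSh_pl hN _, fun i hi => by rw [pl_node hN _ hi, hc i hi]⟩
      initial_u := ⟨hmem 0 ⟨le_rfl, hT⟩, fun i hi => by rw [pl_node hN _ hi, hd i hi]⟩ }
  · have e := ae_of_eqOn (hφ.eqOn hN)
    rw [ip_congr_ae (ae_eq_refl _) e, ip_congr_ae (ae_eq_refl (dx (pl N (d t)))) e,
      ip_congr_ae (ae_eq_refl (dx fun x => pl N (c t) x * pl N (d t) x)) e, add_assoc,
      ip_mass_flux (by fun_prop) (by fun_prop) (by fun_prop) (hmem t ht).2.1 (hmem t ht).2.2,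
      (h.weak t ht).mass]
    ring
  · have e := hχ.1.eqOn hN
    have e1 := ae_of_eqOn e
    have h0 : χ (node N 0) = 0 := by rw [node_zero, hχ.2.1]
    have h1 : χ (node N N) = 0 := by rw [node_last hN, hχ.2.2]
    have hb : bilin (pl N (d' t)) χ = bilin (pl N (d' t)) (pl N fun i => χ (node N i)) := by
      rw [bilin, bilin, ip_congr_ae (ae_eq_refl _) e1,
        ip_congr_ae (ae_eq_refl (dx (pl N (d' t)))) (ae_of_eqOn (dx_congr e))]
    have := ip_momentum_flux (β := β) (δ := δ) (lip01_pl N (c t)) (lip01_pl N (d t))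
      (lip01_pl N fun i => χ (node N i)) (by rw [pl_zero hN, h0]) (by rw [pl_one hN, h1])
    rw [hb, (h.weak t ht).momentum _ h0 h1, ip_congr_ae (ae_eq_refl (dx (pl N (c t)))) e1,
      ip_congr_ae (ae_eq_refl (fun x => pl N (d t) x * dx (pl N (d t)) x)) e1,
      ip_congr_ae (ae_eq_refl (fun x => pl N (c t) x * dx (pl N (c t)) x)) e1]
    linarith

/-- A solution is required to have its values, not its time derivatives, in S_h. The latter follows
by differentiating the nodal representation and uniqueness of derivatives within [0,T], where T > 0
is needed. -/
theorem HasTimeDeriv.eqOn_pl (hN : 0 < N) (hT : 0 < T) {f ft : ℝ → ℝ → ℝ}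
    (hf : HasTimeDeriv T f ft) (hmem : ∀ t ∈ Icc 0 T, InSh N (f t)) {t : ℝ} (ht : t ∈ Icc 0 T) :
    EqOn (ft t) (pl N fun i => ft t (node N i)) I01 := by
  intro x hx
  have h1 := hasDerivWithinAt_pl (N := N) (c := fun s i => f s (node N i))
    (fun i hi => hf t ht _ (node_mem hN hi)) x
  have h2 : HasDerivWithinAt (fun s => f s x) _ (Icc 0 T) t :=
    h1.congr_of_mem (fun s hs => (hmem s hs).eqOn hN hx) ht
  exact (uniqueDiffOn_Icc hT t ht).eq_deriv _ (hf t ht x hx) h2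

theorem IsGalerkinSolution.discreteFlow (hN : 0 < N) (hT : 0 < T) {η₀ u₀ : ℝ → ℝ}
    {ηh ηht uh uht : ℝ → ℝ → ℝ} (h : IsGalerkinSolution α β δ T N η₀ u₀ ηh ηht uh uht) :
    DiscreteFlow α β δ T N (fun t i => ηh t (node N i)) (fun t i => uh t (node N i))
      (fun t i => ηht t (node N i)) (fun t i => uht t (node N i)) := by
  have hend : ∀ x ∈ I01, (∀ t ∈ Icc 0 T, uh t x = 0) → ∀ t ∈ Icc 0 T, uht t x = 0 := by
    intro x hx h0 t ht
    exact (uniqueDiffOn_Icc hT t ht).eq_deriv _ (h.timeDeriv_u t ht x hx)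
      ((hasDerivWithinAt_const t _ (0 : ℝ)).congr_of_mem h0 ht)
  refine ⟨fun t ht i hi => h.timeDeriv_η t ht _ (node_mem hN hi),
    fun t ht i hi => h.timeDeriv_u t ht _ (node_mem hN hi), fun t ht => ?_⟩
  have e1 := (h.mem_η t ht).eqOn hN
  have e2 := (h.mem_u t ht).1.eqOn hN
  have e3 := ae_of_eqOn (h.timeDeriv_η.eqOn_pl hN hT h.mem_η ht)
  have e4 := h.timeDeriv_u.eqOn_pl hN hT (fun t ht => (h.mem_u t ht).1) ht
  have z0 : uh t (node N 0) = 0 := by rw [node_zero, (h.mem_u t ht).2.1]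
  have z1 : uh t (node N N) = 0 := by rw [node_last hN, (h.mem_u t ht).2.2]
  have d1 := dx_congr e1
  have d2 := dx_congr e2
  refine
    { d_zero := z0
      d_last := z1
      dt_zero := by
        rw [node_zero, hend 0 zero_mem_I01 (fun t ht => (h.mem_u t ht).2.1) t ht]
      dt_last := by
        rw [node_last hN, hend 1 one_mem_I01 (fun t ht => (h.mem_u t ht).2.2) t ht]
      mass := fun e => ?_
      momentum := fun e he0 he1 => ?_ }
  · have hm := h.mass t ht _ (inSh_pl hN e)
    have e5 : EqOn (fun x => ηh t x * uh t x) (fun x => pl N (fun i => ηh t (node N i)) x *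
        pl N (fun i => uh t (node N i)) x) I01 := fun x hx => by
      simp only [e1 hx, e2 hx]
    rw [ip_congr_ae e3 (ae_eq_refl _), ip_congr_ae (ae_of_eqOn d2) (ae_eq_refl _),
      ip_congr_ae (ae_of_eqOn (dx_congr e5)) (ae_eq_refl _)] at hm
    have := ip_mass_flux (α := α) (lip01_pl N fun i => ηh t (node N i))
      (lip01_pl N fun i => uh t (node N i)) (lip01_pl N e) (by rw [pl_zero hN, z0])
      (by rw [pl_one hN, z1])
    linarith
  · have p0 : pl N e 0 = 0 := by rw [pl_zero hN, he0]
    have p1 : pl N e 1 = 0 := by rw [pl_one hN, he1]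
    have hm := h.momentum t ht _ ⟨inSh_pl hN e, p0, p1⟩
    have sq : ∀ f g : ℝ → ℝ, EqOn f g I01 →
        EqOn (fun x => f x * dx f x) (fun x => g x * dx g x) I01 :=
      fun f g hfg x hx => by simp only [hfg hx, dx_congr hfg hx]
    rw [bilin, ip_congr_ae (ae_of_eqOn e4) (ae_eq_refl _),
      ip_congr_ae (ae_of_eqOn (dx_congr e4)) (ae_eq_refl _),
      ip_congr_ae (ae_of_eqOn d1) (ae_eq_refl _),
      ip_congr_ae (ae_of_eqOn (sq _ _ e2)) (ae_eq_refl _),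
      ip_congr_ae (ae_of_eqOn (sq _ _ e1)) (ae_eq_refl _)] at hm
    have := ip_momentum_flux (β := β) (δ := δ) (lip01_pl N fun i => ηh t (node N i))
      (lip01_pl N fun i => uh t (node N i)) (lip01_pl N e) p0 p1
    rw [bilin]
    linarith

theorem IsGalerkinSolution.unique (hN : 0 < N) (hT : 0 < T) {η₀ u₀ : ℝ → ℝ}
    {ηh ηht uh uht ηh' ηht' uh' uht' : ℝ → ℝ → ℝ}
    (h : IsGalerkinSolution α β δ T N η₀ u₀ ηh ηht uh uht)
    (h' : IsGalerkinSolution α β δ T N η₀ u₀ ηh' ηht' uh' uht') {t : ℝ} (ht : t ∈ Icc 0 T) :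
    EqOn (ηh' t) (ηh t) I01 ∧ EqOn (uh' t) (uh t) I01 := by
  have key := integralCurve_unique (contDiff_galerkinField α β δ hN)
    (fun t ht => (h'.discreteFlow hN hT).integralCurve hN ht)
    (fun t ht => (h.discreteFlow hN hT).integralCurve hN ht)
    (Prod.ext
      (funext fun i => (h'.initial_η.2 i (Nat.le_of_lt_succ i.2)).trans
        (h.initial_η.2 i (Nat.le_of_lt_succ i.2)).symm)
      (funext fun i => (h'.initial_u.2 i (Nat.le_of_lt_succ i.2)).trans
        (h.initial_u.2 i (Nat.le_of_lt_succ i.2)).symm)) ht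
  have k1 : ∀ i ≤ N, ηh' t (node N i) = ηh t (node N i) := fun i hi =>
    congrFun (congrArg Prod.fst key) ⟨i, Nat.lt_succ_of_le hi⟩
  have k2 : ∀ i ≤ N, uh' t (node N i) = uh t (node N i) := fun i hi =>
    congrFun (congrArg Prod.snd key) ⟨i, Nat.lt_succ_of_le hi⟩
  refine ⟨fun x hx => ?_, fun x hx => ?_⟩
  · rw [(h'.mem_η t ht).eqOn hN hx, (h.mem_η t ht).eqOn hN hx, pl_congr k1]
  · rw [(h'.mem_u t ht).1.eqOn hN hx, (h.mem_u t ht).1.eqOn hN hx, pl_congr k2]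

end solvability

/-! ### Existence of the semidiscrete solution, and the error bounds -/

theorem continuousOn_ip_sum {n : ℕ} {B : ℕ → ℝ → ℝ} (hB : ∀ i, Bdd (B i)) {c : ℝ → ℕ → ℝ}
    {S : Set ℝ} (hc : ∀ i < n, ContinuousOn (fun s => c s i) S) :
    ContinuousOn (fun s => ip (fun x => ∑ i ∈ Finset.range n, c s i * B i x)
      (fun x => ∑ i ∈ Finset.range n, c s i * B i x)) S := by
  simp only [ip_sum_sum hB]
  exact continuousOn_finsetSum _ fun i hi => continuousOn_finsetSum _ fun j hj =>
    ((hc i (Finset.mem_range.1 hi)).mul (hc j (Finset.mem_range.1 hj))).mul continuousOn_const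

theorem continuousOn_energy {N : ℕ} {a b : ℝ → ℕ → ℝ} {S : Set ℝ}
    (ha : ∀ i ≤ N, ContinuousOn (fun s => a s i) S)
    (hb : ∀ i ≤ N, ContinuousOn (fun s => b s i) S) :
    ContinuousOn (fun s => energy N (a s) (b s)) S := by
  have h1 := continuousOn_ip_sum (B := hat N) (fun i => by fun_prop) (n := N + 1) (c := a)
    fun i hi => ha i (by omega)
  have h2 := continuousOn_ip_sum (B := hat N) (fun i => by fun_prop) (n := N + 1) (c := b)
    fun i hi => hb i (by omega)
  have h3 := continuousOn_ip_sum (B := fun i => dx (hat N i)) (fun i => by fun_prop) (n := N + 1)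
    (c := b) fun i hi => hb i (by omega)
  simp only [← fun s => ip_congr_ae (dx_pl_ae N (b s)) (dx_pl_ae N (b s))] at h3
  simp only [energy_eq, normL2_sq]
  exact (h1.add h2).add (continuousOn_const.mul h3)

theorem sq_coeff_le_energy {N : ℕ} (hN : 0 < N) (a b : ℕ → ℝ) {i : ℕ} (hi : i ≤ N) :
    a i ^ 2 ≤ 6 * N * energy N a b ∧ b i ^ 2 ≤ 6 * N * energy N a b := by
  have h1 := coeff_sq_le hN a hi
  have h2 := coeff_sq_le hN b hi
  have e := energy_eq N a b
  have hN' : (0 : ℝ) ≤ 6 * N := by positivity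
  have p1 := sq_nonneg (normL2 (pl N a))
  have p2 := sq_nonneg (normL2 (pl N b))
  have p3 := sq_nonneg (normL2 (dx (pl N b)))
  exact ⟨h1.trans (mul_le_mul_of_nonneg_left (by linarith) hN'),
    h2.trans (mul_le_mul_of_nonneg_left (by linarith) hN')⟩

section existence

variable {α β δ M T : ℝ} {N : ℕ} {η ηt u ut : ℝ → ℝ → ℝ}
  (hex : ExactFlow α β δ M T η ηt u ut) (hN : 2 ≤ N)
include hex hN

/-- Bootstrap: on any interval [0,τ] where the energy is at most h², `energy_le` improves this to K
h³, which is strictly below h² when K h < 1. -/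
theorem ExactFlow.exists_discreteFlow (hsmall : 1 / (N : ℝ) * Real.exp (1000 * M ^ 2 * T) < 1) :
    ∃ c d c' d' : ℝ → ℕ → ℝ, DiscreteFlow α β δ T N c d c' d' ∧
      (∀ i ≤ N, nodalError N η c 0 i = 0) ∧ (∀ i ≤ N, nodalError N u d 0 i = 0) ∧
      ∀ t ∈ Icc 0 T, energy N (nodalError N η c t) (nodalError N u d t) ≤ (1 / N : ℝ) ^ 2 := by
  have hN0 : 0 < N := by omega
  have hNr : (1 : ℝ) ≤ N := by exact_mod_cast hN0
  have hT := hex.T_pos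
  have hh : (0 : ℝ) < 1 / N := by positivity
  let y₀ : (Fin (N + 1) → ℝ) × (Fin (N + 1) → ℝ) :=
    (fun i => η 0 (node N i), fun i => u 0 (node N i))
  have hy₀ : ∀ j, IsEnd j → y₀.2 j = 0 := by
    have hw := hex.weak 0 ⟨le_rfl, hT.le⟩
    rintro j (rfl | rfl)
    · simp [y₀, node_zero, hw.v_zero]
    · simp [y₀, node_last hN0, hw.v_one]
  have hc0 : ∀ y : ℝ → (Fin (N + 1) → ℝ) × (Fin (N + 1) → ℝ), y 0 = y₀ →
      (∀ i ≤ N, nodalError N η (fun t => coeff (y t).1) 0 i = 0) ∧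
      ∀ i ≤ N, nodalError N u (fun t => coeff (y t).2) 0 i = 0 := by
    refine fun y hy => ⟨fun i hi => ?_, fun i hi => ?_⟩ <;>
    simp [nodalError, hy, coeff_of_le _ hi, y₀]
  refine Exists.elim (exists_integralCurve_of_apriori
    (contDiff_galerkinField α β δ hN0) hT.le (y₀ := y₀)
    (G := fun t y => energy N (nodalError N η (fun _ => coeff y.1) t)
      (nodalError N u (fun _ => coeff y.2) t)) (g := (1 / N : ℝ) ^ 2) (R := M + 6 * N)
    ?_ ?_ ?_ ?_) ?_
  · intro y hy
    refine continuousOn_energy (a := fun t => nodalError N η (fun _ => coeff (y t).1) t)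
      (b := fun t => nodalError N u (fun _ => coeff (y t).2) t) (fun i hi => ?_) fun i hi => ?_
    · simp only [nodalError, coeff_of_le _ hi]
      refine ContinuousOn.sub (fun t ht => (hex.timeDeriv_η t ht _
        (node_mem hN0 hi)).continuousWithinAt) ?_
      exact continuousOn_pi.1 (continuous_fst.comp_continuousOn hy) _
    · simp only [nodalError, coeff_of_le _ hi]
      refine ContinuousOn.sub (fun t ht => (hex.timeDeriv_u t ht _
        (node_mem hN0 hi)).continuousWithinAt) ?_
      exact continuousOn_pi.1 (continuous_snd.comp_continuousOn hy) _
  · intro t ht y hyE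
    have hM := hex.one_le
    obtain ⟨_, _, hη⟩ := hex.c21_η t ht
    obtain ⟨_, _, hu⟩ := hex.c21_u t ht
    -- Through `sq_coeff_le_energy` the nodal errors satisfy r² ≤ 6N h² ≤ 36N². With the bound M of
    -- the exact solution this is the radius M + 6N; it may depend on N, since it serves only for
    -- existence.
    have hb : ∀ r : ℝ, r ^ 2 ≤ 6 * N * (1 / N : ℝ) ^ 2 → |r| ≤ 6 * N := by
      intro r hr
      refine abs_le_of_sq_le_sq (hr.trans ?_) (by positivity)
      have h1 : (1 / N : ℝ) ^ 2 ≤ 1 :=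
        pow_le_one₀ hh.le (by rw [div_le_one (by linarith)]; exact hNr)
      nlinarith
    have hcoef : ∀ {f c : ℝ}, |f| ≤ M → |f - c| ≤ 6 * N → |c| ≤ M + 6 * N := by
      intro f c h1 h2
      have := abs_sub f (f - c)
      rw [sub_sub_cancel] at this
      linarith
    have hs := fun (i : Fin (N + 1)) => sq_coeff_le_energy hN0
      (nodalError N η (fun _ => coeff y.1) t) (nodalError N u (fun _ => coeff y.2) t)
      (Nat.le_of_lt_succ i.2)
    have h6 : 6 * N * energy N (nodalError N η (fun _ => coeff y.1) t)
      (nodalError N u (fun _ => coeff y.2) t) ≤ 6 * N * (1 / N : ℝ) ^ 2 :=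
      mul_le_mul_of_nonneg_left hyE (by positivity)
    rw [Prod.norm_def]
    refine max_le ((pi_norm_le_iff_of_nonneg (by positivity)).2 fun i => ?_)
      ((pi_norm_le_iff_of_nonneg (by positivity)).2 fun i => ?_)
    · refine hcoef (hη.le₀ _ (node_mem hN0 (Nat.le_of_lt_succ i.2))) ?_
      have := hb _ ((hs i).1.trans h6)
      rwa [nodalError, coeff_fin] at this
    · refine hcoef (hu.le₀ _ (node_mem hN0 (Nat.le_of_lt_succ i.2))) ?_
      have := hb _ ((hs i).2.trans h6)
      rwa [nodalError, coeff_fin] at this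
  · obtain ⟨h1, h2⟩ := hc0 (fun _ => y₀) rfl
    refine lt_of_eq_of_lt (energy_eq_zero h1 h2) (by positivity)
  · intro τ hτ y hy0 hy hE
    have hf := discreteFlow_of_integralCurve hN0 hy (by rwa [hy0])
    refine lt_of_le_of_lt (hf.energy_le hex hN hτ.2 (hc0 y hy0).1 (hc0 y hy0).2 hE
      ⟨hτ.1, le_rfl⟩) ?_
    calc (1 / N : ℝ) ^ 3 * Real.exp (1000 * M ^ 2 * T)
        = (1 / N : ℝ) ^ 2 * (1 / N * Real.exp (1000 * M ^ 2 * T)) := by ring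
      _ < (1 / N : ℝ) ^ 2 * 1 := mul_lt_mul_of_pos_left hsmall (by positivity)
      _ = _ := mul_one _
  · rintro y ⟨hy0, hy, hE⟩
    exact ⟨_, _, _, _, discreteFlow_of_integralCurve hN0 hy (by rwa [hy0]), (hc0 y hy0).1,
      (hc0 y hy0).2, hE⟩

end existence

/-- Since K ≥ 1, its square root is at most K, so no roots appear in the final constants. -/
theorem le_mul_of_sq_le_mul {x s K : ℝ} (hs : 0 ≤ s) (hK : 1 ≤ K) (h : x ^ 2 ≤ s ^ 2 * K) :
    x ≤ K * s := by
  refine (abs_le_of_sq_le_sq' (h.trans ?_) (by positivity)).2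
  nlinarith [mul_nonneg (sq_nonneg s) (by nlinarith : 0 ≤ K * (K - 1))]

theorem normH1_le {f : ℝ → ℝ} : normH1 f ≤ normL2 f + normL2 (dx f) := by
  have h1 := normL2_nonneg f
  have h2 := normL2_nonneg (dx f)
  rw [normH1]
  refine Real.sqrt_le_iff.2 ⟨by positivity, ?_⟩
  nlinarith [mul_nonneg h1 h2, sq_nonneg (normL2 (dx f))]

theorem normL2_sub_pl_le {N : ℕ} {f : ℝ → ℝ} (hf : Lip01 f) (c : ℕ → ℝ) :
    normL2 (f - pl N c) ≤ normL2 (pl N fun i => f (node N i) - c i) +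
      normL2 (fun x => f x - interp N f x) := by
  have e : f - pl N c = fun x => pl N (fun i => f (node N i) - c i) x + (f x - interp N f x) := by
    funext x
    rw [pl_sub, interp, Pi.sub_apply]
    ring
  rw [e]
  exact normL2_add_le (by fun_prop) (by fun_prop)

theorem normL2_dx_sub_pl_le {N : ℕ} {f : ℝ → ℝ} (hf : Lip01 f) (c : ℕ → ℝ) :
    normL2 (dx (f - pl N c)) ≤ normL2 (dx (pl N fun i => f (node N i) - c i)) +
      normL2 (dx fun x => f x - interp N f x) := by
  have e : f - pl N c = fun x => pl N (fun i => f (node N i) - c i) x + (f x - interp N f x) := by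
    funext x
    rw [pl_sub, interp, Pi.sub_apply]
    ring
  rw [e, normL2_congr_ae (dx_add_ae (by fun_prop) (by fun_prop))]
  exact normL2_add_le (by fun_prop) (by fun_prop)

theorem DiscreteFlow.error_bounds {α β δ M T : ℝ} {N : ℕ} {η ηt u ut : ℝ → ℝ → ℝ}
    {c d c' d' : ℝ → ℕ → ℝ} (hflow : DiscreteFlow α β δ T N c d c' d')
    (hex : ExactFlow α β δ M T η ηt u ut) (hN : 2 ≤ N)
    (hc0 : ∀ i ≤ N, nodalError N η c 0 i = 0) (hd0 : ∀ i ≤ N, nodalError N u d 0 i = 0)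
    (hE : ∀ t ∈ Icc 0 T, energy N (nodalError N η c t) (nodalError N u d t) ≤ (1 / N : ℝ) ^ 2)
    {K L : ℝ} (hK : K = Real.exp (1000 * M ^ 2 * T))
    (hL : L = Real.exp (40000 * M ^ 2 * K ^ 2 * T)) {t : ℝ} (ht : t ∈ Icc 0 T) :
    normL2 (η t - pl N (c t)) ≤ (K + M) * (1 / (N : ℝ)) ^ (3 / 2 : ℝ) ∧
    normH1 (u t - pl N (d t)) ≤ (L + 2 * M + 2) * (1 / (N : ℝ)) ∧
    normL2 (u t - pl N (d t)) ≤ (L + M) * (1 / (N : ℝ)) ^ 2 ∧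
    normL2 (ut t - pl N (d' t)) ≤ (4500 * M ^ 2 * K ^ 2 * (3 * L + 1) + M) * (1 / (N : ℝ)) ^ 2 := by
  have hN0 : 0 < N := by omega
  have hM := hex.one_le
  have hT := hex.T_pos
  have hK1 : 1 ≤ K := by rw [hK]; exact Real.one_le_exp (by positivity)
  have hL1 : 1 ≤ L := by rw [hL]; exact Real.one_le_exp (by positivity)
  have hEK : ∀ t ∈ Icc 0 T,
      energy N (nodalError N η c t) (nodalError N u d t) ≤ (1 / N : ℝ) ^ 3 * K := fun t ht => by
    rw [hK]
    exact hflow.energy_le hex hN le_rfl hc0 hd0 hE ht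
  have hw := hflow.weak_energy_le hex hN le_rfl hc0 hd0 hE hK1 hEK ht
  have hbt := hflow.norm_bt_le hex hN le_rfl hE hK1 hEK ht
  have H := hflow.errorEquations hex hN le_rfl ht
  have hdb := H.norm_db_le (hE t ht)
  have hE3 := hEK t ht
  have hh := H.h_pos
  have hh1 : (1 / N : ℝ) ≤ 1 := H.h_le_half.trans (by norm_num)
  obtain ⟨_, _, cη⟩ := hex.c21_η t ht
  obtain ⟨_, _, cu⟩ := hex.c21_u t ht
  obtain ⟨_, _, cut⟩ := hex.c2_ut t ht
  have iη := cη.normL2_interp_error_le hN0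
  have iu := cu.normL2_interp_error_le hN0
  have idu := cu.normL2_dx_interp_error_le hN0
  have iut := cut.normL2_interp_error_le hN0
  have tη := normL2_sub_pl_le (N := N) cη.lip (c t)
  have tu := normL2_sub_pl_le (N := N) cu.lip (d t)
  have tdu := normL2_dx_sub_pl_le (N := N) cu.lip (d t)
  have tut := normL2_sub_pl_le (N := N) cut.lip (d' t)
  change _ ≤ normL2 (pl N (nodalError N η c t)) + _ at tη
  change _ ≤ normL2 (pl N (nodalError N u d t)) + _ at tu
  change _ ≤ normL2 (dx (pl N (nodalError N u d t))) + _ at tdu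
  change _ ≤ normL2 (pl N (nodalError N ut d' t)) + _ at tut
  rw [← hL, (by ring : (1 / N : ℝ) ^ 4 = ((1 / N) ^ 2) ^ 2)] at hw
  have q0 := sq_nonneg (1 / N : ℝ)
  have p1 := sq_nonneg (normL2 (prim (pl N (nodalError N η c t))))
  have p2 := sq_nonneg (prim (pl N (nodalError N η c t)) 1)
  have p3 := sq_nonneg (normL2 (pl N (nodalError N u d t)))
  have w1 : normL2 (prim (pl N (nodalError N η c t))) ≤ L * (1 / N : ℝ) ^ 2 :=
    le_mul_of_sq_le_mul q0 hL1 (by linarith)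
  have w2 : |prim (pl N (nodalError N η c t)) 1| ≤ L * (1 / N : ℝ) ^ 2 :=
    le_mul_of_sq_le_mul q0 hL1 (by rw [sq_abs]; linarith)
  have w3 : normL2 (pl N (nodalError N u d t)) ≤ L * (1 / N : ℝ) ^ 2 :=
    le_mul_of_sq_le_mul q0 hL1 (by linarith)
  have hu2 : normL2 (u t - pl N (d t)) ≤ (L + M) * (1 / (N : ℝ)) ^ 2 := by linarith
  refine ⟨?_, ?_, hu2, ?_⟩
  · have hs0 : (0 : ℝ) ≤ (1 / N : ℝ) ^ (3 / 2 : ℝ) := Real.rpow_nonneg hh.le _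
    have hs2 : ((1 / N : ℝ) ^ (3 / 2 : ℝ)) ^ 2 = (1 / N : ℝ) ^ 3 := by
      rw [← Real.rpow_natCast, ← Real.rpow_mul hh.le, ← Real.rpow_natCast]
      norm_num
    generalize (1 / N : ℝ) ^ (3 / 2 : ℝ) = s at *
    have h2s : (1 / N : ℝ) ^ 2 ≤ s := by
      refine (abs_le_of_sq_le_sq' ?_ hs0).2
      rw [hs2]
      calc ((1 / N : ℝ) ^ 2) ^ 2 = (1 / N : ℝ) ^ 3 * (1 / N) := by ring
        _ ≤ (1 / N : ℝ) ^ 3 * 1 := mul_le_mul_of_nonneg_left hh1 (by positivity)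
        _ = _ := mul_one _
    have ha : normL2 (pl N (nodalError N η c t)) ≤ K * s := by
      refine le_mul_of_sq_le_mul hs0 hK1 ?_
      rw [hs2]
      rw [energy_eq] at hE3
      have p4 := sq_nonneg (normL2 (dx (pl N (nodalError N u d t))))
      linarith
    have := mul_le_mul_of_nonneg_left h2s (by linarith : (0 : ℝ) ≤ M)
    linarith
  -- The first-order bounds ‖ξ'‖ ≤ 2h and ‖σ'‖ ≤ M h suffice here.
  · have h2 : (1 / N : ℝ) ^ 2 ≤ 1 / N := by nlinarith
    have := mul_le_mul_of_nonneg_left h2 (by linarith : (0 : ℝ) ≤ L + M)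
    have := normH1_le (f := u t - pl N (d t))
    linarith
  · have := mul_le_mul_of_nonneg_left (by linarith :
      normL2 (prim (pl N (nodalError N η c t))) + |prim (pl N (nodalError N η c t)) 1| +
        normL2 (pl N (nodalError N u d t)) + (1 / N : ℝ) ^ 2 ≤ (3 * L + 1) * (1 / N : ℝ) ^ 2)
      (by positivity : (0 : ℝ) ≤ 4500 * M ^ 2 * K ^ 2)
    linarith

theorem IsIBVPSolution.exists_errorBounds {α β δ T : ℝ} (hT : 0 < T) (hα : |α| ≤ 2) (hβ : |β| ≤ 2)
    (hδ : |δ| ≤ 2) {η₀ u₀ : ℝ → ℝ} {η ηt u ut : ℝ → ℝ → ℝ} (hreg : IsSmooth T η ηt u ut)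
    (hsol : IsIBVPSolution α β δ T η₀ u₀ η ηt u ut) :
    ∃ C h₀ : ℝ, 0 < h₀ ∧ ∀ N : ℕ, 2 ≤ N → 1 / (N : ℝ) ≤ h₀ →
      UniqueSolutionWithErrorBounds α β δ T η₀ u₀ η u ut C N := by
  obtain ⟨M, hex⟩ := hsol.exists_exactFlow hT hα hβ hδ hreg
  have hM := hex.one_le
  obtain ⟨K, hK⟩ : ∃ K, K = Real.exp (1000 * M ^ 2 * T) := ⟨_, rfl⟩
  obtain ⟨L, hL⟩ : ∃ L, L = Real.exp (40000 * M ^ 2 * K ^ 2 * T) := ⟨_, rfl⟩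
  have hK0 : 0 < K := by rw [hK]; positivity
  have hL0 : 0 < L := by rw [hL]; positivity
  -- The constant dominates the four individual ones, and h₀ = 1/(2K) gives K h ≤ 1/2 < 1, as the
  -- bootstrap requires.
  refine ⟨K + (L + 2 * M + 2) + 4500 * M ^ 2 * K ^ 2 * (3 * L + 1), 1 / (2 * K), by positivity,
    fun N hN hNh => ?_⟩
  have hN0 : 0 < N := by omega
  have hsmall : 1 / (N : ℝ) * K < 1 := by
    have := mul_le_mul_of_nonneg_right hNh hK0.le
    have e : 1 / (2 * K) * K = 1 / 2 := by field_simp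
    linarith
  obtain ⟨c, d, c', d', hflow, hc0, hd0, hE⟩ := hex.exists_discreteFlow hN (by rwa [← hK])
  have hG := hflow.isGalerkinSolution hN0 hT.le (η₀ := η₀) (u₀ := u₀)
    (fun i hi => by
      rw [← hsol.initial_η _ (node_mem hN0 hi)]
      exact (sub_eq_zero.1 (hc0 i hi)).symm)
    (fun i hi => by
      rw [← hsol.initial_u _ (node_mem hN0 hi)]
      exact (sub_eq_zero.1 (hd0 i hi)).symm)
  refine ⟨_, _, _, _, hG, fun _ _ _ _ h' t ht => hG.unique hN0 hT h' ht, fun t ht => ?_⟩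
  obtain ⟨b1, b2, b3, b4⟩ := hflow.error_bounds hex hN hc0 hd0 hE hK hL ht
  have hP : 0 ≤ 4500 * M ^ 2 * K ^ 2 * (3 * L + 1) := by positivity
  refine ⟨b1.trans ?_, b2.trans ?_, b3.trans ?_, b4.trans ?_⟩ <;>
    exact mul_le_mul_of_nonneg_right (by linarith) (by positivity)

end BoussinesqGalerkin

end

open BoussinesqGalerkin in
theorem theorem2p1 (T : ℝ) (hT : 0 < T) (η₀ u₀ : ℝ → ℝ) (η ηt u ut : ℝ → ℝ → ℝ)
    (hreg : IsSmooth T η ηt u ut) :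
    (IsCBSolution T η₀ u₀ η ηt u ut →
      ∃ C h₀ : ℝ, 0 < h₀ ∧ ∀ N : ℕ, 2 ≤ N → 1 / (N : ℝ) ≤ h₀ →
        CBUniqueSolutionWithErrorBounds T η₀ u₀ η u ut C N) ∧
    (IsSCBSolution T η₀ u₀ η ηt u ut →
      ∃ C h₀ : ℝ, 0 < h₀ ∧ ∀ N : ℕ, 2 ≤ N → 1 / (N : ℝ) ≤ h₀ →
        SCBUniqueSolutionWithErrorBounds T η₀ u₀ η u ut C N) := by
  refine ⟨fun h => h.exists_errorBounds hT ?_ ?_ ?_ hreg,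
    fun h => h.exists_errorBounds hT ?_ ?_ ?_ hreg⟩ <;>
  · rw [abs_of_nonneg (by norm_num)]
    norm_num
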